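/- Let $\Omega=(0,1)^2$, let $\beta,\gamma>0$ be constants, $b\in C^1(\overline\Omega)$, $c\in C(\overline\Omega)$ with $b\ge\beta$ and $c+\tfrac12 b_x\ge\gamma$ on $\overline\Omega$, and let $M$ be a constant. There is a constant $C$, depending only on $\beta,\gamma,b,c,M$, such that the following holds for all $\varepsilon,N,f,u,S,E_1,E_2,E_{12}$ as below. **Problem.** $u$ solves $-\varepsilon\Delta u-bu_x+cu=f$ in $\Omega$, $u=0$ on $\partial\Omega$, and $u=S+E_1+E_2+E_{12}$ on $\overline\Omega$, where all four components are in $C^3(\overline\Omega)$ and, for $0\le m+n\le3$ and $(x,y)\in\overline\Omega$, $$|\partial_x^m\partial_y^nS|\le M,\qquad |\partial_x^m\partial_y^nE_1|\le M\varepsilon^{-m}e^{-\beta x/\varepsilon},\qquad |\partial_x^m\partial_y^nE_2|\le M\varepsilon^{-n/2}\bigl(e^{-y/\sqrt\varepsilon}+e^{-(1-y)/\sqrt\varepsilon}\bigr),$$ $$|\partial_x^m\partial_y^nE_{12}|\le M\varepsilon^{-(m+n/2)}e^{-\beta x/\varepsilon}\bigl(e^{-y/\sqrt\varepsilon}+e^{-(1-y)/\sqrt\varepsilon}\bigr).$$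 **Mesh.** $N\ge4$ is an integer divisible by $4$, $\sigma=\tfrac52$, $0<\varepsilon\le N^{-1}$, $\frac{\sigma\varepsilon}{\beta}\ln\frac1\varepsilon\le\frac12$ and $\sigma\sqrt\varepsilon\ln\frac1\varepsilon\le\frac14$. The mesh points are $$x_i=-\tfrac{\sigma\varepsilon}{\beta}\ln\bigl(1-2(1-\varepsilon)\tfrac iN\bigr)\ (0\le i\le\tfrac N2),\qquad x_i=1-(1-x_{N/2})\tfrac{2(N-i)}N\ (\tfrac N2<i\le N),$$ $$y_j=-\sigma\sqrt\varepsilon\,\ln\bigl(1-4(1-\sqrt\varepsilon)\tfrac jN\bigr)\ (0\le j\le\tfrac N4),\qquad y_j=1+\sigma\sqrt\varepsilon\,\ln\bigl(1-4(1-\sqrt\varepsilon)(1-\tfrac jN)\bigr)\ (\tfrac{3N}4\le j\le N),$$ and $y_j$ is affine in $j$ for $\tfrac N4\le j\le\tfrac{3N}4$. Put $K_{i,j}=[x_i,x_{i+1}]\times[y_j,y_{j+1}]$ and $H=x_{N/2+1}-x_{N/2}$. Let $\theta_{i,j}$ be the piecewise bilinear nodal basis function of $(x_i,y_j)$, let $w^I=\sum_{i,j=0}^Nw(x_i,y_j)\theta_{i,j}$,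 let $V^N$ be the space of continuous functions on $\overline\Omega$ that vanish on $\partial\Omega$ and are bilinear on each $K_{i,j}$, let $(\cdot,\cdot)$ be the inner product of $L^2(\Omega)$, and let $\|v\|_\varepsilon^2=\varepsilon\|\nabla v\|_{L^2(\Omega)}^2+\|v\|_{L^2(\Omega)}^2$. **Interpolation.** $\mathcal PS=\sum_{i=N/2-1}^{N/2}\sum_{j=N/4}^{3N/4}\mathcal PS(x_i,y_j)\theta_{i,j}$ is required to satisfy $\mathcal PS(x_{N/2-1},y_j)=S(x_{N/2-1},y_j)$ for $j\in\{\frac N4,\frac{3N}4\}$, $\mathcal PS(x_{N/2},y_j)=S(x_{N/2},y_j)$ for $\frac N4\le j\le\frac{3N}4$, and for $\frac N4<j<\frac{3N}4$ $$\int_{K_{N/2-1,j-1}\cup K_{N/2-1,j}}(S-\mathcal PS)_x\,\theta_{N/2,j}\,dx\,dy=\frac{H^2}{12}\int_{y_{j-1}}^{y_{j+1}}S_{xx}(x_{N/2},y)\,\theta_{N/2,j}(x_{N/2},y)\,dy .$$ $\mathcal LS$ is the piecewise bilinear function on $[x_{N/2-2},x_{N/2-1}]\times[y_{N/4},y_{3N/4}]$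 with $\mathcal LS=\mathcal PS$ at $(x_{N/2-1},y_j)$ and $\mathcal LS=S$ at $(x_{N/2-2},y_j)$, $\frac N4\le j\le\frac{3N}4$. Finally $\Pi S=\mathcal PS$ on $[x_{N/2-1},x_{N/2}]\times[y_{N/4},y_{3N/4}]$, $\Pi S=\mathcal LS$ on $[x_{N/2-2},x_{N/2-1}]\times[y_{N/4},y_{3N/4}]$, and $\Pi S=S^I$ elsewhere. **Conclusion.** $\mathcal PS$ (hence $\Pi S$) exists and is unique; $|(S-\mathcal PS)(x_{N/2-1},y_j)|\le CN^{-2}$ for $\frac N4<j<\frac{3N}4$; and for every $v\in V^N$ $$\bigl|(-b(S-\Pi S)_x,v)\bigr|\le C\varepsilon^{1/4}N^{-3/2}\ln^{1/2}N\,\|v\|_\varepsilon+CN^{-2}\ln^{1/2}N\,\|v\|_\varepsilon .$$ -/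

import Mathlib

open MeasureTheory Set

noncomputable section

namespace Bakhvalov

/-! ### The domain and partial derivatives -/

/-- The open unit square `Ω = (0,1)²`. -/
def Om : Set (ℝ × ℝ) := Ioo (0 : ℝ) 1 ×ˢ Ioo (0 : ℝ) 1

/-- The closed unit square. -/
def OmBar : Set (ℝ × ℝ) := Icc (0 : ℝ) 1 ×ˢ Icc (0 : ℝ) 1

/-- The partial derivative `∂w/∂x` on the closed unit square (one-sided on the boundary). -/
def pdx (w : ℝ × ℝ → ℝ) : ℝ × ℝ → ℝ :=
  fun p => derivWithin (fun t => w (t, p.2)) (Icc 0 1) p.1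

/-- The partial derivative `∂w/∂y` on the closed unit square (one-sided on the boundary). -/
def pdy (w : ℝ × ℝ → ℝ) : ℝ × ℝ → ℝ :=
  fun p => derivWithin (fun t => w (p.1, t)) (Icc 0 1) p.2

/-- The mixed partial derivative `∂^(m+n) w / ∂x^m ∂y^n`. -/
def pd (m n : ℕ) (w : ℝ × ℝ → ℝ) : ℝ × ℝ → ℝ := pdx^[m] (pdy^[n] w)

/-! ### The boundary value problem and the decomposition of its solution -/

/-- The standing assumptions on the coefficients: `b ≥ β > 0` and `c + b_x / 2 ≥ γ > 0`
on the closed unit square. -/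
structure IsData (β γ : ℝ) (b c : ℝ × ℝ → ℝ) : Prop where
  beta_pos : 0 < β
  gamma_pos : 0 < γ
  b_smooth : ContDiffOn ℝ 1 b OmBar
  c_cont : ContinuousOn c OmBar
  b_ge : ∀ p ∈ OmBar, β ≤ b p
  c_ge : ∀ p ∈ OmBar, γ ≤ c p + pdx b p / 2

/-- `u` solves `-ε Δu - b u_x + c u = f` in `Ω`, `u = 0` on the boundary of `Ω`. -/
structure IsSolution (ε : ℝ) (b c f u : ℝ × ℝ → ℝ) : Prop where
  smooth : ContDiffOn ℝ 2 u OmBar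
  equation : ∀ p ∈ Om,
    -ε * (pdx (pdx u) p + pdy (pdy u) p) - b p * pdx u p + c p * u p = f p
  boundary : ∀ p ∈ OmBar, p ∉ Om → u p = 0

/-- The decomposition `u = S + E₁ + E₂ + E₁₂` of a function `u` on the closed unit square into a
smooth part, an exponential layer at `x = 0`, parabolic layers at `y = 0` and `y = 1`, and corner
layers, with the usual derivative bounds up to order three with constant `M`. -/
structure IsDecomposition (ε β M : ℝ) (u S E₁ E₂ E₁₂ : ℝ × ℝ → ℝ) : Prop where
  sum_eq : ∀ p ∈ OmBar, u p = S p + E₁ p + E₂ p + E₁₂ p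
  smooth_S : ContDiffOn ℝ 3 S OmBar
  smooth_E₁ : ContDiffOn ℝ 3 E₁ OmBar
  smooth_E₂ : ContDiffOn ℝ 3 E₂ OmBar
  smooth_E₁₂ : ContDiffOn ℝ 3 E₁₂ OmBar
  bound_S : ∀ m n : ℕ, m + n ≤ 3 → ∀ p ∈ OmBar, |pd m n S p| ≤ M
  bound_E₁ : ∀ m n : ℕ, m + n ≤ 3 → ∀ p ∈ OmBar,
    |pd m n E₁ p| ≤ M * ε ^ (-(m : ℝ)) * Real.exp (-β * p.1 / ε)
  bound_E₂ : ∀ m n : ℕ, m + n ≤ 3 → ∀ p ∈ OmBar,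
    |pd m n E₂ p| ≤ M * ε ^ (-(n : ℝ) / 2) *
      (Real.exp (-p.2 / √ε) + Real.exp (-(1 - p.2) / √ε))
  bound_E₁₂ : ∀ m n : ℕ, m + n ≤ 3 → ∀ p ∈ OmBar,
    |pd m n E₁₂ p| ≤ M * ε ^ (-((m : ℝ) + (n : ℝ) / 2)) * Real.exp (-β * p.1 / ε) *
      (Real.exp (-p.2 / √ε) + Real.exp (-(1 - p.2) / √ε))

/-! ### The Bakhvalov-type mesh -/

/-- The mesh parameter `σ = 5/2`. -/
def σ : ℝ := 5 / 2

/-- The transition point `x_{N/2}` in the `x`-direction. -/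
def transX (β ε : ℝ) : ℝ := -(σ * ε / β) * Real.log ε

/-- The mesh points `x_i`. -/
def meshX (β ε : ℝ) (N i : ℕ) : ℝ :=
  if i ≤ N / 2 then -(σ * ε / β) * Real.log (1 - 2 * (1 - ε) * ((i : ℝ) / N))
  else 1 - (1 - transX β ε) * (2 * ((N : ℝ) - i) / N)

/-- The transition point `y_{N/4}` in the `y`-direction. -/
def transY (ε : ℝ) : ℝ := -(σ * √ε) * Real.log √ε

/-- The mesh points `y_j`. -/
def meshY (ε : ℝ) (N j : ℕ) : ℝ :=
  if j ≤ N / 4 then -(σ * √ε) * Real.log (1 - 4 * (1 - √ε) * ((j : ℝ) / N))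
  else if j < 3 * N / 4 then
    2 * (1 - transY ε) * ((j : ℝ) / N - 1 / 4) - 2 * transY ε * ((j : ℝ) / N - 3 / 4)
  else 1 + σ * √ε * Real.log (1 - 4 * (1 - √ε) * (1 - (j : ℝ) / N))

/-- The assumptions on the mesh and on the perturbation parameter. -/
structure IsAdmissible (β ε : ℝ) (N : ℕ) : Prop where
  four_le : 4 ≤ N
  four_dvd : 4 ∣ N
  eps_pos : 0 < ε
  eps_le : ε ≤ (N : ℝ)⁻¹
  transition_x : σ * ε / β * Real.log (1 / ε) ≤ 1 / 2
  transition_y : σ * √ε * Real.log (1 / ε) ≤ 1 / 4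

/-- The mesh rectangle `K_{i,j} = [x_i, x_{i+1}] × [y_j, y_{j+1}]`. -/
def cell (β ε : ℝ) (N i j : ℕ) : Set (ℝ × ℝ) :=
  Icc (meshX β ε N i) (meshX β ε N (i + 1)) ×ˢ Icc (meshY ε N j) (meshY ε N (j + 1))

/-! ### The bilinear finite element space -/

/-- The one-dimensional piecewise linear nodal basis function of the node `t i`. -/
def hat (t : ℕ → ℝ) (i : ℕ) (s : ℝ) : ℝ :=
  if 0 < i ∧ t (i - 1) ≤ s ∧ s ≤ t i then (s - t (i - 1)) / (t i - t (i - 1))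
  else if t i ≤ s ∧ s ≤ t (i + 1) then (t (i + 1) - s) / (t (i + 1) - t i)
  else 0

/-- The bilinear nodal basis function `θ_{i,j}` of the node `(x_i, y_j)`. -/
def theta (β ε : ℝ) (N i j : ℕ) (p : ℝ × ℝ) : ℝ :=
  hat (meshX β ε N) i p.1 * hat (meshY ε N) j p.2

/-- The finite element space `V^N`: continuous functions on the closed unit square that vanish on
its boundary and are bilinear on every mesh rectangle. -/
def femSpace (β ε : ℝ) (N : ℕ) : Set (ℝ × ℝ → ℝ) :=
  {v | ContinuousOn v OmBar ∧ (∀ p ∈ OmBar, p ∉ Om → v p = 0) ∧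
    ∀ i < N, ∀ j < N, ∃ a₀₀ a₁₀ a₀₁ a₁₁ : ℝ, ∀ p ∈ cell β ε N i j,
      v p = a₀₀ + a₁₀ * p.1 + a₀₁ * p.2 + a₁₁ * (p.1 * p.2)}

/-- The energy norm `(ε |v|₁² + ‖v‖²)^(1/2)`. -/
def energyNorm (ε : ℝ) (v : ℝ × ℝ → ℝ) : ℝ :=
  √(ε * (∫ p in Om, (pdx v p ^ 2 + pdy v p ^ 2)) + ∫ p in Om, v p ^ 2)

/-! ### The interpolations -/

/-- The Lagrange interpolant `w^I`. -/
def lagrange (β ε : ℝ) (N : ℕ) (w : ℝ × ℝ → ℝ) (p : ℝ × ℝ) : ℝ :=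
  ∑ i ∈ Finset.range (N + 1), ∑ j ∈ Finset.range (N + 1),
    w (meshX β ε N i, meshY ε N j) * theta β ε N i j p

/-- `P` is the interpolant `𝒫S` in the columns `N/2 - 1`, `N/2` of mesh points. Here
`meshX β ε N (N / 2 + 1) - meshX β ε N (N / 2)` is the coarse mesh width `H`. -/
structure IsTransitionInterp (β ε : ℝ) (N : ℕ) (S P : ℝ × ℝ → ℝ) : Prop where
  expansion : ∀ p, P p =
    ∑ i ∈ Finset.Icc (N / 2 - 1) (N / 2), ∑ j ∈ Finset.Icc (N / 4) (3 * N / 4),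
      P (meshX β ε N i, meshY ε N j) * theta β ε N i j p
  moments : ∀ j ∈ Finset.Icc (N / 4 + 1) (3 * N / 4 - 1),
    (∫ p in cell β ε N (N / 2 - 1) (j - 1), pdx (S - P) p * theta β ε N (N / 2) j p) +
      (∫ p in cell β ε N (N / 2 - 1) j, pdx (S - P) p * theta β ε N (N / 2) j p) =
    (meshX β ε N (N / 2 + 1) - meshX β ε N (N / 2)) ^ 2 / 12 *
      ((∫ y in meshY ε N (j - 1)..meshY ε N j,
          pd 2 0 S (meshX β ε N (N / 2), y) *
            theta β ε N (N / 2) j (meshX β ε N (N / 2), y)) +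
        ∫ y in meshY ε N j..meshY ε N (j + 1),
          pd 2 0 S (meshX β ε N (N / 2), y) *
            theta β ε N (N / 2) j (meshX β ε N (N / 2), y))
  ends : ∀ j ∈ ({N / 4, 3 * N / 4} : Finset ℕ),
    P (meshX β ε N (N / 2 - 1), meshY ε N j) = S (meshX β ε N (N / 2 - 1), meshY ε N j)
  right : ∀ j ∈ Finset.Icc (N / 4) (3 * N / 4),
    P (meshX β ε N (N / 2), meshY ε N j) = S (meshX β ε N (N / 2), meshY ε N j)

/-- The interpolant `ℒS`, with the nodal values of `𝒫S = P` on the line `x = x_{N/2-1}` and those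
of `S` on the line `x = x_{N/2-2}`. -/
def linkInterp (β ε : ℝ) (N : ℕ) (S P : ℝ × ℝ → ℝ) (p : ℝ × ℝ) : ℝ :=
  ∑ j ∈ Finset.Icc (N / 4) (3 * N / 4),
    (P (meshX β ε N (N / 2 - 1), meshY ε N j) * theta β ε N (N / 2 - 1) j p +
      S (meshX β ε N (N / 2 - 2), meshY ε N j) * theta β ε N (N / 2 - 2) j p)

open Classical in
/-- The new interpolant `ΠS`, built from `P = 𝒫S`. -/
def newInterp (β ε : ℝ) (N : ℕ) (S P : ℝ × ℝ → ℝ) (p : ℝ × ℝ) : ℝ :=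
  if p ∈ Icc (meshX β ε N (N / 2 - 1)) (meshX β ε N (N / 2)) ×ˢ
      Icc (meshY ε N (N / 4)) (meshY ε N (3 * N / 4)) then P p
  else if p ∈ Icc (meshX β ε N (N / 2 - 2)) (meshX β ε N (N / 2 - 1)) ×ˢ
      Icc (meshY ε N (N / 4)) (meshY ε N (3 * N / 4)) then linkInterp β ε N S P p
  else lagrange β ε N S p

end Bakhvalov

end

/-! The integral is analysed one horizontal line at a time. Relative to the Lagrange interpolant,
`ΠS` changes nodal values only on the line x = x_{N/2-1}, by a piecewise linear function D(y) with D
= S - 𝒫S at the nodes (`newInterp_eq`). Hence (S - ΠS)_x splits into an x-interpolation error, the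
y-interpolation error of x-increments, which is O(N^{-2}) by `nodal_increment`, and terms ±D/width
on the two strips to the left and right of that line.

On the uniform coarse part the x-error is superconvergent: each cell contributes (H²/12) b S_xx
times the increment of v. Summation by parts (`line_estimate`) leaves O(N^{-2}) and one boundary
term -(H²/12) b S_xx v at x = x_{N/2}. Bounding that term directly by a trace inequality would cost
√N or √ln(1/ε); the modified interpolant is there to cancel it. Averaging b v over the two strips
turns the D-terms into D b (v(x_{N/2-2}) - v(x_{N/2}))/2. The first half is cheap, because a trace
from x = 0 costs √(x/ε) and x_{N/2-2} = O(ε ln N). The second half joins the boundary term, so that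
-b R v remains on x = x_{N/2}, with R = (H²/12) S_xx + D/2 (`residual`, `lineIntegral_bound`).

The moment conditions say exactly that, tested with interior hat functions in y, R agrees with a
weighted strip mean of the Lagrange error (`stripMean`). This is O(N^{-1}) times the width of the
strip, which is at most x_{N/2} (`residual_moment`). Replacing b v on that line by its piecewise
linear interpolant leaves N^{-1} x_{N/2} √(x_{N/2}/ε), which is O(ε^{1/4} N^{-3/2})
(`residual_middle`, `transition_bounds`). Near y = 0 and y = 1 there are no moment conditions, but
those strips are so thin that the trace factor is bounded (`residual_end_le`). For x ≤ x_{N/2} the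
first-order error N^{-1} suffices, since v is small in L¹ there (`integral_fine_le`).

The moment conditions are equivalent to a tridiagonal system with stencil 1, 4, 1 for the nodal
values of D (`moment_iff`). Diagonal dominance gives existence, uniqueness and D = O(N^{-2})
(`existsUnique_transitionInterp`, `abs_corr_le`). -/

namespace Bakhvalov

/-! ### Piecewise linear functions on a one-dimensional mesh -/

section Hat

variable {t : ℕ → ℝ} {N : ℕ}

lemma mesh_lt (ht : ∀ i < N, t i < t (i + 1)) {i j : ℕ} (hij : i < j) (hj : j ≤ N) :
    t i < t j :=
  strictMonoOn_Iic_of_lt_succ (ψ := t) (n := N) (fun m hm => ht m hm)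
    (mem_Iic.2 (hij.le.trans hj)) (mem_Iic.2 hj) hij

lemma mesh_le (ht : ∀ i < N, t i < t (i + 1)) {i j : ℕ} (hij : i ≤ j) (hj : j ≤ N) :
    t i ≤ t j := by
  rcases hij.eq_or_lt with rfl | h
  · exact le_rfl
  · exact (mesh_lt ht h hj).le

lemma hat_left (ht : ∀ i < N, t i < t (i + 1)) {j : ℕ} (hj : j < N) {s : ℝ}
    (hs : s ∈ Icc (t j) (t (j + 1))) :
    hat t j s = (t (j + 1) - s) / (t (j + 1) - t j) := by
  unfold hat
  have h1 := ht j hj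
  split_ifs with h h'
  -- The closed branches of `hat` overlap at the node itself; the rising branch is selected there,
  -- and both branches give 1.
  · have e : s = t j := le_antisymm h.2.2 hs.1
    obtain ⟨i, rfl⟩ : ∃ i, j = i + 1 := ⟨j - 1, by omega⟩
    have h0 := ht i (by omega)
    rw [e, div_self (sub_pos.2 h1).ne']
    simp only [Nat.add_sub_cancel]
    exact div_self (sub_pos.2 h0).ne'
  · rfl
  · exact absurd hs h'

lemma hat_right {j : ℕ} {s : ℝ} (hs : s ∈ Icc (t j) (t (j + 1))) :
    hat t (j + 1) s = (s - t j) / (t (j + 1) - t j) := by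
  unfold hat
  rw [if_pos]
  · simp
  · simpa using hs

lemma hat_other (ht : ∀ i < N, t i < t (i + 1)) {j : ℕ} (hj : j < N) {s : ℝ}
    (hs : s ∈ Icc (t j) (t (j + 1))) {a : ℕ} (ha : a ≤ N) (h0 : a ≠ j) (h1 : a ≠ j + 1) :
    hat t a s = 0 := by
  have hjj := ht j hj
  unfold hat
  rcases lt_or_gt_of_ne h0 with h | h
  · have h2 : t (a + 1) ≤ t j := mesh_le ht (by omega) (by omega)
    have h3 : t a < t (a + 1) := ht a (by omega)
    rw [if_neg (by intro h'; linarith [hs.1, h'.2.2])]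
    split_ifs with h'
    -- Closed supports of neighbouring hats can still touch the cell at an endpoint, where the hat
    -- vanishes.
    · have : s = t (a + 1) := le_antisymm h'.2 (h2.trans hs.1)
      simp [this]
    · rfl
  · have h2 : t (j + 1) < t a := mesh_lt ht (by omega) (by omega)
    have h3 : t (j + 1) ≤ t (a - 1) := mesh_le ht (by omega) (by omega)
    split_ifs with h' h''
    · have : s = t (a - 1) := le_antisymm (hs.2.trans h3) h'.2.1
      simp [this]
    · linarith [hs.2, h''.1]
    · rfl

lemma sum_hat (ht : ∀ i < N, t i < t (i + 1)) {j : ℕ} (hj : j < N) {s : ℝ}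
    (hs : s ∈ Icc (t j) (t (j + 1))) (A : Finset ℕ) (hA : ∀ a ∈ A, a ≤ N) (hjA : j ∈ A)
    (hjA' : j + 1 ∈ A) (c : ℕ → ℝ) :
    ∑ a ∈ A, c a * hat t a s =
      c j * ((t (j + 1) - s) / (t (j + 1) - t j)) +
        c (j + 1) * ((s - t j) / (t (j + 1) - t j)) := by
  rw [← Finset.add_sum_erase A _ hjA,
    ← Finset.add_sum_erase (A.erase j) _ (Finset.mem_erase.2 ⟨by omega, hjA'⟩),
    Finset.sum_eq_zero, hat_left ht hj hs, hat_right hs, add_zero]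
  intro a ha
  simp only [Finset.mem_erase] at ha
  rw [hat_other ht hj hs (hA a ha.2.2) ha.2.1 ha.1, mul_zero]

/-- The node is viewed as the right end of the cell before it, hence `0 < j`; only such nodes occur
below. -/
lemma hat_node (ht : ∀ i < N, t i < t (i + 1)) {j : ℕ} (hj0 : 0 < j) (hj : j ≤ N)
    {a : ℕ} (ha : a ≤ N) : hat t a (t j) = if a = j then 1 else 0 := by
  obtain ⟨i, rfl⟩ : ∃ i, j = i + 1 := ⟨j - 1, by omega⟩
  have hi := ht i (by omega)
  have hm : t (i + 1) ∈ Icc (t i) (t (i + 1)) := ⟨hi.le, le_rfl⟩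
  split_ifs with h
  · rw [h, hat_right hm, div_self (sub_pos.2 hi).ne']
  · by_cases h' : a = i
    · rw [h', hat_left ht (by omega) hm]; simp
    · exact hat_other ht (by omega) hm ha h' h

/-- The piecewise linear function on the mesh `t 0 < ⋯ < t N` with nodal values `c`. -/
noncomputable def pl (t : ℕ → ℝ) (N : ℕ) (c : ℕ → ℝ) (s : ℝ) : ℝ :=
  ∑ a ∈ Finset.range (N + 1), c a * hat t a s

lemma pl_eq (ht : ∀ i < N, t i < t (i + 1)) {j : ℕ} (hj : j < N) {s : ℝ}
    (hs : s ∈ Icc (t j) (t (j + 1))) (c : ℕ → ℝ) :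
    pl t N c s = c j * ((t (j + 1) - s) / (t (j + 1) - t j)) +
        c (j + 1) * ((s - t j) / (t (j + 1) - t j)) :=
  sum_hat ht hj hs _ (fun a ha => by simp at ha; omega) (by simp; omega) (by simp; omega) c

lemma pl_sub (c d : ℕ → ℝ) (s : ℝ) :
    pl t N (fun j => c j - d j) s = pl t N c s - pl t N d s := by
  simp only [pl, sub_mul, Finset.sum_sub_distrib]

lemma exists_cell {m k : ℕ} (hmk : m < k) {s : ℝ}
    (hs : s ∈ Icc (t m) (t k)) : ∃ j, m ≤ j ∧ j < k ∧ s ∈ Icc (t j) (t (j + 1)) := by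
  induction k, hmk using Nat.le_induction with
  | base => exact ⟨m, le_rfl, Nat.lt_succ_self m, hs⟩
  | succ k hmk ih =>
    by_cases h : s ≤ t k
    · obtain ⟨j, h1, h2, h3⟩ := ih ⟨hs.1, h⟩
      exact ⟨j, h1, by omega, h3⟩
    · exact ⟨k, by omega, by omega, (not_le.1 h).le, hs.2⟩

lemma pl_continuousOn (ht : ∀ i < N, t i < t (i + 1)) (c : ℕ → ℝ) {k : ℕ} (hk : k ≤ N) :
    ContinuousOn (pl t N c) (Icc (t 0) (t k)) := by
  induction k with
  | zero => simp
  | succ k ih =>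
    rw [← Icc_union_Icc_eq_Icc (mesh_le ht (Nat.zero_le k) (by omega)) (ht k (by omega)).le]
    refine (ih (by omega)).union_of_isClosed ?_ isClosed_Icc isClosed_Icc
    refine ContinuousOn.congr ?_ (fun s hs => pl_eq ht (by omega) hs c)
    fun_prop

lemma abs_pl_le (ht : ∀ i < N, t i < t (i + 1)) (hN : 0 < N) {c : ℕ → ℝ} {K : ℝ}
    (hc : ∀ j ≤ N, |c j| ≤ K) {s : ℝ} (hs : s ∈ Icc (t 0) (t N)) : |pl t N c s| ≤ K := by
  obtain ⟨j, -, hj, hsj⟩ := exists_cell hN hs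
  have h := sub_pos.2 (ht j hj)
  rw [pl_eq ht hj hsj]
  have e : K = K * ((t (j + 1) - s) / (t (j + 1) - t j)) +
      K * ((s - t j) / (t (j + 1) - t j)) := by field_simp; ring
  have h1 : 0 ≤ (t (j + 1) - s) / (t (j + 1) - t j) := div_nonneg (by linarith [hsj.2]) h.le
  have h2 : 0 ≤ (s - t j) / (t (j + 1) - t j) := div_nonneg (by linarith [hsj.1]) h.le
  rw [e]
  refine (abs_add_le _ _).trans (add_le_add ?_ ?_)
  · rw [abs_mul, abs_of_nonneg h1]; exact mul_le_mul_of_nonneg_right (hc j hj.le) h1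
  · rw [abs_mul, abs_of_nonneg h2]; exact mul_le_mul_of_nonneg_right (hc (j + 1) hj) h2

end Hat

/-! ### The tridiagonal system `a (j - 1) + 4 * a j + a (j + 1) = f j` -/

/-- Diagonal dominance: where |a| is maximal, 4|a| ≤ K + 2|a|. -/
lemma tridiag_bound {l r : ℕ} {a : ℕ → ℝ} {K : ℝ} (hK : 0 ≤ K) (hl : a l = 0) (hr : a r = 0)
    (h : ∀ j, l < j → j < r → |a (j - 1) + 4 * a j + a (j + 1)| ≤ K) {j : ℕ}
    (hj : j ∈ Finset.Icc l r) : |a j| ≤ K / 2 := by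
  obtain ⟨m, hm, hmax⟩ := Finset.exists_max_image (Finset.Icc l r) (fun j => |a j|) ⟨j, hj⟩
  refine (hmax j hj).trans ?_
  rw [Finset.mem_Icc] at hm
  by_cases h1 : m = l
  · simp only [h1, hl, abs_zero]; linarith
  by_cases h2 : m = r
  · simp only [h2, hr, abs_zero]; linarith
  have e1 := hmax (m - 1) (by simp; omega)
  have e2 := hmax (m + 1) (by simp; omega)
  have e3 := h m (by omega) (by omega)
  have e4 : |4 * a m| ≤ |a (m - 1) + 4 * a m + a (m + 1)| + |a (m - 1)| + |a (m + 1)| := by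
    have := abs_sub_abs_le_abs_sub (4 * a m) (-(a (m - 1) + a (m + 1)))
    rw [abs_neg] at this
    have h5 := abs_add_le (a (m - 1)) (a (m + 1))
    have : 4 * a m - -(a (m - 1) + a (m + 1)) = a (m - 1) + 4 * a m + a (m + 1) := by ring
    simp_all only [Finset.mem_Icc]
    linarith
  rw [abs_mul, abs_of_pos (by norm_num : (0 : ℝ) < 4)] at e4
  show |a m| ≤ K / 2
  linarith

/-- The system is square on the interior indices, and `tridiag_bound` with `K = 0` makes it
injective, hence surjective. -/
lemma tridiag_exists (l r : ℕ) (f : ℕ → ℝ) :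
    ∃ a : ℕ → ℝ, (∀ j, ¬ (l < j ∧ j < r) → a j = 0) ∧
      ∀ j, l < j → j < r → a (j - 1) + 4 * a j + a (j + 1) = f j := by
  let T := {j : ℕ // j ∈ Finset.Ioo l r}
  -- Extension by zero encodes the boundary values at `l` and `r`. The truncated `j - 1` is harmless
  -- because `j > l`.
  let ext : (T → ℝ) →ₗ[ℝ] (ℕ → ℝ) :=
    { toFun := fun d j => if h : j ∈ Finset.Ioo l r then d ⟨j, h⟩ else 0
      map_add' := by intro d e; ext j; by_cases h : j ∈ Finset.Ioo l r <;> simp [h, -Finset.mem_Ioo]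
      map_smul' := by intro d e; ext j; by_cases h : j ∈ Finset.Ioo l r <;> simp [h, -Finset.mem_Ioo] }
  let A : (T → ℝ) →ₗ[ℝ] (T → ℝ) :=
    { toFun := fun d j => ext d (j - 1) + 4 * ext d j + ext d (j + 1)
      map_add' := by intro d e; ext j; simp only [map_add, Pi.add_apply]; ring
      map_smul' := by
        intro d e; ext j
        simp only [map_smul, Pi.smul_apply, smul_eq_mul, RingHom.id_apply]; ring }
  have ext0 : ∀ d j, ¬ (l < j ∧ j < r) → ext d j = 0 := by
    intro d j h
    have : j ∉ Finset.Ioo l r := by simpa using h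
    exact dif_neg this
  have inj : Function.Injective A := by
    rw [← LinearMap.ker_eq_bot, LinearMap.ker_eq_bot']
    intro d hd
    ext j
    have hj := Finset.mem_Ioo.1 j.2
    have := tridiag_bound (l := l) (r := r) (a := ext d) (K := 0) le_rfl
      (ext0 d l (by simp)) (ext0 d r (by simp))
      (fun i h1 h2 => by
        have := congrFun hd ⟨i, Finset.mem_Ioo.2 ⟨h1, h2⟩⟩
        rw [show ext d (i - 1) + 4 * ext d i + ext d (i + 1) = 0 from this]; simp)
      (j := j) (Finset.mem_Icc.2 ⟨hj.1.le, hj.2.le⟩)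
    have h0 : ext d j = 0 := by simpa using this
    have h1 : ext d j = d j := dif_pos j.2
    rw [← h1, h0]; rfl
  obtain ⟨d, hd⟩ := (LinearMap.injective_iff_surjective.1 inj) (fun j => f j)
  exact ⟨ext d, ext0 d, fun j h1 h2 => congrFun hd ⟨j, Finset.mem_Ioo.2 ⟨h1, h2⟩⟩⟩

end Bakhvalov

namespace Bakhvalov

/-! ### One-dimensional estimates on an interval -/

section Interval

variable {a b : ℝ}

lemma abs_sub_le_of_hasDerivWithinAt {g g' : ℝ → ℝ} {K : ℝ}
    (hg : ∀ x ∈ Icc a b, HasDerivWithinAt g (g' x) (Icc a b) x)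
    (hK : ∀ x ∈ Icc a b, |g' x| ≤ K) {x y : ℝ} (hx : x ∈ Icc a b) (hy : y ∈ Icc a b) :
    |g y - g x| ≤ K * |y - x| :=
  (convex_Icc a b).norm_image_sub_le_of_norm_hasDerivWithin_le hg hK hx hy

/-- Mean value inequality for g(x) - g'(y) x over the whole interval. -/
lemma abs_deriv_sub_slope_le (hab : a < b) {g g' : ℝ → ℝ} {R : ℝ}
    (hg : ∀ x ∈ Icc a b, HasDerivWithinAt g (g' x) (Icc a b) x) {y : ℝ}
    (hR : ∀ x ∈ Icc a b, |g' x - g' y| ≤ R) :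
    |g' y - (g b - g a) / (b - a)| ≤ R := by
  have h := abs_sub_le_of_hasDerivWithinAt (g := fun x => g x - g' y * x)
    (g' := fun x => g' x - g' y)
    (fun x hx => by
      exact ((hg x hx).sub ((hasDerivWithinAt_id x _).const_mul (g' y))).congr_deriv (by simp)) hR
    (left_mem_Icc.2 hab.le) (right_mem_Icc.2 hab.le)
  have h0 := sub_pos.2 hab
  rw [abs_of_pos h0] at h
  have e : g' y - (g b - g a) / (b - a) = -((g b - g' y * b - (g a - g' y * a)) / (b - a)) := by
    field_simp; ring
  rw [e, abs_neg, abs_div, abs_of_pos h0, div_le_iff₀ h0]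
  exact h

/-- The error vanishes at `a`, and its derivative is `g'` minus the chord slope, which
`abs_deriv_sub_slope_le` bounds by `R`. -/
lemma abs_sub_interp_le (hab : a < b) {g g' : ℝ → ℝ} {R : ℝ}
    (hg : ∀ x ∈ Icc a b, HasDerivWithinAt g (g' x) (Icc a b) x)
    (hR : ∀ x ∈ Icc a b, ∀ y ∈ Icc a b, |g' x - g' y| ≤ R) {y : ℝ} (hy : y ∈ Icc a b) :
    |g y - (g a * ((b - y) / (b - a)) + g b * ((y - a) / (b - a)))| ≤ R * (b - a) := by
  have h0 := sub_pos.2 hab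
  have h := abs_sub_le_of_hasDerivWithinAt (g := fun x => g x - (g b - g a) / (b - a) * x)
    (g' := fun x => g' x - (g b - g a) / (b - a))
    (fun x hx => by
      exact ((hg x hx).sub
        ((hasDerivWithinAt_id x _).const_mul ((g b - g a) / (b - a)))).congr_deriv (by simp))
    (fun x hx => abs_deriv_sub_slope_le hab hg (fun z hz => hR z hz x hx))
    (left_mem_Icc.2 hab.le) hy
  have e : g y - (g a * ((b - y) / (b - a)) + g b * ((y - a) / (b - a))) =
      g y - (g b - g a) / (b - a) * y - (g a - (g b - g a) / (b - a) * a) := by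
    field_simp; ring
  rw [e]
  refine h.trans (mul_le_mul_of_nonneg_left ?_ ((abs_nonneg _).trans (hR y hy y hy)))
  rw [abs_of_nonneg (by linarith [hy.1])]
  linarith [hy.2]

lemma integral_sub_left_pow (n : ℕ) :
    ∫ x in a..b, (x - a) ^ n = (b - a) ^ (n + 1) / (n + 1) := by
  rw [intervalIntegral.integral_comp_sub_right (fun x => x ^ n) a, integral_pow]
  simp

/-- An inverse inequality: the test function 2(x - a) - (b - a) is orthogonal to constants and
bounded by b - a, so it isolates the slope. -/
lemma sq_mul_abs_slope_le (hab : a ≤ b) (p s : ℝ) :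
    (b - a) ^ 2 * |s| ≤ 6 * ∫ x in a..b, |p + s * (x - a)| := by
  have e : ∫ x in a..b, (p + s * (x - a)) * ((x - a) * 2 - (b - a)) = s * (b - a) ^ 3 / 6 := by
    have : ∀ x, (p + s * (x - a)) * ((x - a) * 2 - (b - a)) =
        (2 * s) * (x - a) ^ 2 + (2 * p - s * (b - a)) * (x - a) ^ 1 -
          (p * (b - a)) * (x - a) ^ 0 := fun x => by ring
    simp only [this]
    rw [intervalIntegral.integral_sub, intervalIntegral.integral_add,
      intervalIntegral.integral_const_mul, intervalIntegral.integral_const_mul,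
      intervalIntegral.integral_const_mul, integral_sub_left_pow, integral_sub_left_pow,
      integral_sub_left_pow]
    · push_cast; ring
    all_goals exact Continuous.intervalIntegrable (by fun_prop) _ _
  rcases hab.eq_or_lt with rfl | hab
  · simp
  have h0 := sub_pos.2 hab
  have h : |s * (b - a) ^ 3 / 6| ≤ (b - a) * ∫ x in a..b, |p + s * (x - a)| := by
    rw [← e, ← intervalIntegral.integral_const_mul]
    refine (intervalIntegral.abs_integral_le_integral_abs hab.le).trans ?_
    refine intervalIntegral.integral_mono_on hab.le
      (Continuous.intervalIntegrable (by fun_prop) _ _)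
      (Continuous.intervalIntegrable (by fun_prop) _ _) fun x hx => ?_
    rw [abs_mul, mul_comm]
    refine mul_le_mul_of_nonneg_right ?_ (abs_nonneg _)
    rw [abs_le]; constructor <;> linarith [hx.1, hx.2]
  rw [abs_div, abs_mul, abs_of_pos (pow_pos h0 3), abs_of_pos (by norm_num : (0 : ℝ) < 6)] at h
  refine le_of_mul_le_mul_left ?_ h0
  linarith

/-- An end value is the mean plus or minus half the rise. The mean costs 1 and half the rise costs 3
by `sq_mul_abs_slope_le`, hence the 4. -/
lemma mul_abs_ends_le (hab : a ≤ b) (p s : ℝ) :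
    (b - a) * |p| ≤ 4 * (∫ x in a..b, |p + s * (x - a)|) ∧
      (b - a) * |p + s * (b - a)| ≤ 4 * ∫ x in a..b, |p + s * (x - a)| := by
  have e : ∫ x in a..b, (p + s * (x - a)) = (b - a) * (p + s * (b - a) / 2) := by
    have : ∀ x, (p + s * (x - a)) = p * (x - a) ^ 0 + s * (x - a) ^ 1 := fun x => by ring
    simp only [this]
    rw [intervalIntegral.integral_add,
      intervalIntegral.integral_const_mul, intervalIntegral.integral_const_mul,
      integral_sub_left_pow, integral_sub_left_pow]
    · push_cast; ring
    all_goals exact Continuous.intervalIntegrable (by fun_prop) _ _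
  have h0 := sub_nonneg.2 hab
  have h1 := sq_mul_abs_slope_le hab p s
  have h2 := intervalIntegral.abs_integral_le_integral_abs (μ := volume)
    (f := fun x => p + s * (x - a)) hab
  rw [e, abs_mul, abs_of_nonneg h0] at h2
  set I := ∫ x in a..b, |p + s * (x - a)|
  have h3 : (b - a) * |s * (b - a) / 2| = (b - a) ^ 2 * |s| / 2 := by
    rw [abs_div, abs_mul, abs_of_nonneg h0, abs_two]; ring
  constructor
  · have : |p| ≤ |p + s * (b - a) / 2| + |s * (b - a) / 2| := by
      have := abs_sub (p + s * (b - a) / 2) (s * (b - a) / 2)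
      rwa [add_sub_cancel_right] at this
    have := mul_le_mul_of_nonneg_left this h0
    linarith
  · have : |p + s * (b - a)| ≤ |p + s * (b - a) / 2| + |s * (b - a) / 2| := by
      refine le_trans (le_of_eq ?_) (abs_add_le _ _)
      congr 1; ring
    have := mul_le_mul_of_nonneg_left this h0
    linarith

lemma mul_sq_left_le (hab : a ≤ b) (p s : ℝ) :
    (b - a) * p ^ 2 ≤ 4 * ∫ x in a..b, (p + s * (x - a)) ^ 2 := by
  have e : ∫ x in a..b, (p + s * (x - a)) ^ 2 =
      (b - a) * (p ^ 2 + p * (s * (b - a)) + (s * (b - a)) ^ 2 / 3) := by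
    have : ∀ x, (p + s * (x - a)) ^ 2 =
      s ^ 2 * (x - a) ^ 2 + (2 * p * s) * (x - a) ^ 1 + p ^ 2 * (x - a) ^ 0 := fun x => by ring
    simp only [this]
    rw [intervalIntegral.integral_add, intervalIntegral.integral_add,
      intervalIntegral.integral_const_mul, intervalIntegral.integral_const_mul,
      intervalIntegral.integral_const_mul, integral_sub_left_pow, integral_sub_left_pow,
      integral_sub_left_pow]
    · push_cast; ring
    all_goals exact Continuous.intervalIntegrable (by fun_prop) _ _
  rw [e]
  -- The right side minus the left side is (b - a)/3 times this square.
  nlinarith [mul_nonneg (sub_nonneg.2 hab) (sq_nonneg (3 * p + 2 * (s * (b - a))))]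

/-- Superconvergence on a single cell for the derivative of the linear interpolation error. -/
lemma cell_estimate (hab : a < b) {f f' f'' f''' w v : ℝ → ℝ} {M B Λ s : ℝ}
    (hM : 0 ≤ M)
    (hf : ∀ x ∈ Icc a b, HasDerivWithinAt f (f' x) (Icc a b) x)
    (hf' : ∀ x ∈ Icc a b, HasDerivWithinAt f' (f'' x) (Icc a b) x)
    (hf'' : ∀ x ∈ Icc a b, HasDerivWithinAt f'' (f''' x) (Icc a b) x)
    (b2 : ∀ x ∈ Icc a b, |f'' x| ≤ M) (b3 : ∀ x ∈ Icc a b, |f''' x| ≤ M)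
    (hw : ContinuousOn w (Icc a b)) (hB : |w a| ≤ B)
    (hΛ : ∀ x ∈ Icc a b, |w x - w a| ≤ Λ * (b - a))
    (hv : ∀ x ∈ Icc a b, v x = v a + s * (x - a)) :
    |(∫ x in a..b, w x * (f' x - (f b - f a) / (b - a)) * v x) -
        (b - a) ^ 2 / 12 * (w a * f'' a * (v b - v a))|
      ≤ (Λ * M + 12 * B * M) * (b - a) ^ 2 * ∫ x in a..b, |v x| := by
  have h0 := sub_pos.2 hab
  have ma : a ∈ Icc a b := left_mem_Icc.2 hab.le
  have mb : b ∈ Icc a b := right_mem_Icc.2 hab.le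
  have cf' : ContinuousOn f' (Icc a b) := fun x hx => (hf' x hx).continuousWithinAt
  have cv : ContinuousOn v (Icc a b) :=
    ContinuousOn.congr (f := fun x => v a + s * (x - a)) (by fun_prop) hv
  have uI : uIcc a b = Icc a b := uIcc_of_le hab.le
  have ii : ∀ {g : ℝ → ℝ}, ContinuousOn g (Icc a b) → IntervalIntegrable g volume a b :=
    fun hg => ContinuousOn.intervalIntegrable (by rwa [uI])
  set m := (f b - f a) / (b - a) with hm
  have eIv : ∫ x in a..b, |v x| = ∫ x in a..b, |v a + s * (x - a)| :=
    intervalIntegral.integral_congr (by rw [uI]; intro x hx; simp only [hv x hx])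
  have hs := sq_mul_abs_slope_le hab.le (v a) s
  rw [← eIv] at hs
  set I := ∫ x in a..b, |v x| with hI
  have hI0 : 0 ≤ I := intervalIntegral.integral_nonneg hab.le fun x _ => abs_nonneg _
  -- bounds for the derivative of the error
  have l1 : ∀ x ∈ Icc a b, ∀ y ∈ Icc a b, |f' x - f' y| ≤ M * (b - a) := by
    intro x hx y hy
    refine (abs_sub_le_of_hasDerivWithinAt hf' b2 hy hx).trans
      (mul_le_mul_of_nonneg_left ?_ hM)
    rw [abs_le]; constructor <;> linarith [hx.1, hx.2, hy.1, hy.2]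
  have l2 : ∀ x ∈ Icc a b, |f' x - m| ≤ M * (b - a) := fun x hx =>
    abs_deriv_sub_slope_le hab hf (fun y hy => l1 y hy x hx)
  -- expansion of the derivative of the error
  have l3 : ∀ x ∈ Icc a b, |f' x - m - f'' a * (x - a - (b - a) / 2)| ≤ 2 * M * (b - a) ^ 2 := by
    have d1 : ∀ x ∈ Icc a b, |f'' x - f'' a| ≤ M * (b - a) := by
      intro x hx
      refine (abs_sub_le_of_hasDerivWithinAt hf'' b3 ma hx).trans
        (mul_le_mul_of_nonneg_left ?_ hM)
      rw [abs_le]; constructor <;> linarith [hx.1, hx.2]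
    -- With f'' frozen at `a`, f' - m is the linear function f''(a)(x - midpoint). `ψ` removes it,
    -- has chord slope zero, and has second derivative f'' - f''(a) = O(b - a), so ψ' = O((b - a)²).
    set ψ : ℝ → ℝ := fun x => f x - m * x - f'' a * ((x - a) ^ 2 / 2 - (b - a) / 2 * x) with hψ
    set ψ' : ℝ → ℝ := fun x => f' x - m - f'' a * (x - a - (b - a) / 2) with hψ'
    have dψ : ∀ x ∈ Icc a b, HasDerivWithinAt ψ (ψ' x) (Icc a b) x := by
      intro x hx
      have e1 : HasDerivWithinAt (fun x => (x - a) ^ 2 / 2 - (b - a) / 2 * x)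
          (x - a - (b - a) / 2) (Icc a b) x := by
        have := ((((hasDerivWithinAt_id x (Icc a b)).sub_const a).pow 2).div_const 2).sub
          ((hasDerivWithinAt_id x (Icc a b)).const_mul ((b - a) / 2))
        refine this.congr_deriv ?_
        simp
      have := ((hf x hx).sub ((hasDerivWithinAt_id x _).const_mul m)).sub (e1.const_mul (f'' a))
      refine this.congr_deriv ?_
      simp [hψ']
    have dψ' : ∀ x ∈ Icc a b, HasDerivWithinAt ψ' (f'' x - f'' a) (Icc a b) x := by
      intro x hx
      have := ((hf' x hx).sub_const m).sub
        ((((hasDerivWithinAt_id x (Icc a b)).sub_const a).sub_const ((b - a) / 2)).const_mul (f'' a))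
      refine this.congr_deriv ?_
      simp
    have e : (ψ b - ψ a) / (b - a) = 0 := by
      rw [div_eq_zero_iff]; left
      have : m * (b - a) = f b - f a := by rw [hm]; field_simp
      simp only [hψ]; linear_combination -this
    intro x hx
    have := abs_deriv_sub_slope_le hab dψ (y := x) (R := M * (b - a) * (b - a)) (fun y hy => by
      refine (abs_sub_le_of_hasDerivWithinAt dψ' d1 hx hy).trans
        (mul_le_mul_of_nonneg_left ?_ (mul_nonneg hM h0.le))
      rw [abs_le]; constructor <;> linarith [hx.1, hx.2, hy.1, hy.2])
    rw [e, sub_zero] at this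
    refine this.trans ?_
    nlinarith [mul_nonneg hM (sq_nonneg (b - a))]
  have ftc : ∫ x in a..b, (f' x - m) = 0 := by
    rw [intervalIntegral.integral_sub (ii cf') (by simp),
      intervalIntegral.integral_eq_sub_of_hasDerivAt_of_le hab.le
        (fun x hx => (hf x hx).continuousWithinAt)
        (fun x hx => (hf x (Ioo_subset_Icc_self hx)).hasDerivAt (Icc_mem_nhds hx.1 hx.2))
        (ii cf')]
    rw [intervalIntegral.integral_const, smul_eq_mul, hm]; field_simp; ring
  -- The 1/12 is the first moment of x - midpoint, namely (b - a)³/12.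
  have mom : |(∫ x in a..b, (f' x - m) * (x - a)) - f'' a * (b - a) ^ 3 / 12|
      ≤ 2 * M * (b - a) ^ 4 := by
    have e : ∫ x in a..b, f'' a * (x - a - (b - a) / 2) * (x - a) =
        f'' a * (b - a) ^ 3 / 12 := by
      have : ∀ x, f'' a * (x - a - (b - a) / 2) * (x - a) =
        f'' a * (x - a) ^ 2 - (f'' a * (b - a) / 2) * (x - a) ^ 1 := fun x => by ring
      simp only [this]
      rw [intervalIntegral.integral_sub,
        intervalIntegral.integral_const_mul, intervalIntegral.integral_const_mul,
        integral_sub_left_pow, integral_sub_left_pow]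
      · push_cast; ring
      all_goals exact Continuous.intervalIntegrable (by fun_prop) _ _
    rw [← e, ← intervalIntegral.integral_sub (ii (by fun_prop)) (ii (by fun_prop))]
    have := intervalIntegral.norm_integral_le_of_norm_le_const (a := a) (b := b)
      (f := fun x => (f' x - m) * (x - a) - f'' a * (x - a - (b - a) / 2) * (x - a))
      (C := 2 * M * (b - a) ^ 3) (fun x hx => by
        rw [uIoc_of_le hab.le] at hx
        have hx' := Ioc_subset_Icc_self hx
        rw [← sub_mul, Real.norm_eq_abs, abs_mul]
        have h5 : |x - a| ≤ b - a := by
          rw [abs_le]; constructor <;> linarith [hx.1, hx.2]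
        calc _ ≤ 2 * M * (b - a) ^ 2 * (b - a) := mul_le_mul (l3 x hx') h5 (abs_nonneg _)
              (by positivity)
          _ = _ := by ring)
    rw [Real.norm_eq_abs, abs_of_pos h0] at this
    refine this.trans (le_of_eq (by ring))
  -- splitting of the integral
  have split : ∫ x in a..b, w x * (f' x - m) * v x =
      (∫ x in a..b, (w x - w a) * (f' x - m) * v x) +
        w a * s * ∫ x in a..b, (f' x - m) * (x - a) := by
    -- Freeze `w` at `a` and write v = v(a) + s(x - a). The constant part of `v` drops out because
    -- f' - m has mean zero, and the slope meets the first moment `mom`.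
    have e1 : ∫ x in a..b, w x * (f' x - m) * v x = ∫ x in a..b,
        ((w x - w a) * (f' x - m) * v x +
          (w a * v a * (f' x - m) + w a * s * ((f' x - m) * (x - a)))) := by
      refine intervalIntegral.integral_congr (fun x hx => ?_)
      rw [uI] at hx
      linear_combination (w a * (f' x - m)) * hv x hx
    rw [e1, intervalIntegral.integral_add (ii (by fun_prop)) (ii (by fun_prop)),
      intervalIntegral.integral_add (ii (by fun_prop)) (ii (by fun_prop)),
      intervalIntegral.integral_const_mul, intervalIntegral.integral_const_mul, ftc]
    ring
  have p1 : |∫ x in a..b, (w x - w a) * (f' x - m) * v x| ≤ Λ * M * (b - a) ^ 2 * I := by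
    rw [hI, ← intervalIntegral.integral_const_mul]
    refine (intervalIntegral.abs_integral_le_integral_abs hab.le).trans ?_
    refine intervalIntegral.integral_mono_on hab.le (ii (by fun_prop)) (ii (by fun_prop))
      fun x hx => ?_
    rw [abs_mul, abs_mul]
    refine mul_le_mul_of_nonneg_right ?_ (abs_nonneg _)
    calc _ ≤ Λ * (b - a) * (M * (b - a)) := mul_le_mul (hΛ x hx) (l2 x hx) (abs_nonneg _)
            ((abs_nonneg _).trans (hΛ x hx))
      _ = _ := by ring
  have vb := hv b mb
  have B0 : 0 ≤ B := (abs_nonneg _).trans hB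
  have p2 : |w a * s * ((∫ x in a..b, (f' x - m) * (x - a)) - f'' a * (b - a) ^ 3 / 12)|
      ≤ 12 * B * M * (b - a) ^ 2 * I := by
    rw [abs_mul, abs_mul]
    calc _ ≤ B * |s| * (2 * M * (b - a) ^ 4) := by gcongr
      _ = 2 * B * M * (b - a) ^ 2 * ((b - a) ^ 2 * |s|) := by ring
      _ ≤ 2 * B * M * (b - a) ^ 2 * (6 * I) := by gcongr
      _ = _ := by ring
  have e : (∫ x in a..b, w x * (f' x - m) * v x) -
        (b - a) ^ 2 / 12 * (w a * f'' a * (v b - v a)) =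
      (∫ x in a..b, (w x - w a) * (f' x - m) * v x) +
      w a * s * ((∫ x in a..b, (f' x - m) * (x - a)) - f'' a * (b - a) ^ 3 / 12) := by
    rw [split, vb]; ring
  rw [e]
  refine (abs_add_le _ _).trans ((add_le_add p1 p2).trans (le_of_eq (by ring)))

end Interval

end Bakhvalov

namespace Bakhvalov

/-! ### Estimates on a horizontal line -/

lemma sum_Ico_mul_sub (G v : ℕ → ℝ) {n N : ℕ} (h : n ≤ N) :
    ∑ i ∈ Finset.Ico n N, G i * (v (i + 1) - v i) =
      G N * v N - G n * v n - ∑ i ∈ Finset.Ico n N, (G (i + 1) - G i) * v (i + 1) := by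
  induction N, h using Nat.le_induction with
  | base => simp
  | succ k hk ih => rw [Finset.sum_Ico_succ_top hk, Finset.sum_Ico_succ_top hk, ih]; ring

section Line

variable {t : ℕ → ℝ} {N n : ℕ}

lemma cell_subset (ht : ∀ i < N, t i < t (i + 1)) {i : ℕ} (hi : i < N) :
    Icc (t i) (t (i + 1)) ⊆ Icc (t 0) (t N) :=
  Icc_subset_Icc (mesh_le ht (Nat.zero_le i) hi.le) (mesh_le ht hi le_rfl)

lemma sum_integral_cells (ht : ∀ i < N, t i < t (i + 1)) {g : ℝ → ℝ}
    (hg : ContinuousOn g (Icc (t 0) (t N))) {m k : ℕ} (hmk : m ≤ k) (hk : k ≤ N) :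
    ∑ i ∈ Finset.Ico m k, ∫ x in t i..t (i + 1), g x = ∫ x in t m..t k, g x := by
  refine intervalIntegral.sum_integral_adjacent_intervals_Ico hmk fun i hi => ?_
  have hi' : i < N := by have := hi.2; omega
  refine ContinuousOn.intervalIntegrable ?_
  rw [uIcc_of_le (ht i hi').le]
  exact hg.mono (cell_subset ht hi')

lemma mul_abs_nodes_le (ht : ∀ i < N, t i < t (i + 1)) {v : ℝ → ℝ}
    (hv : ∀ i < N, ∃ s, ∀ x ∈ Icc (t i) (t (i + 1)), v x = v (t i) + s * (x - t i))
    {i : ℕ} (hi : i < N) :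
    (t (i + 1) - t i) * |v (t i)| ≤ 4 * (∫ x in t i..t (i + 1), |v x|) ∧
      (t (i + 1) - t i) * |v (t (i + 1))| ≤ 4 * ∫ x in t i..t (i + 1), |v x| := by
  obtain ⟨s, hs⟩ := hv i hi
  have h := (ht i hi).le
  have e : ∫ x in t i..t (i + 1), |v x| = ∫ x in t i..t (i + 1), |v (t i) + s * (x - t i)| :=
    intervalIntegral.integral_congr (by
      rw [uIcc_of_le h]; intro x hx; simp only [hs x hx])
  rw [e, hs (t (i + 1)) (right_mem_Icc.2 h)]
  exact mul_abs_ends_le h _ _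

/-- Below index `n` a first-order bound is enough. Above it, the common width `H` gives the leading
terms of `cell_estimate` the same factor H²/12, so summation by parts moves the difference from `v`
onto w f'', which is Lipschitz. The boundary term at t N vanishes with `v`; the one at t n survives,
and it is the term the interpolant `𝒫S` has to cancel. -/
lemma line_estimate (ht : ∀ i < N, t i < t (i + 1)) (hn : n ≤ N)
    {f f' f'' f''' w v : ℝ → ℝ} {M B Λ κ H : ℝ} (hM : 0 ≤ M) (hΛ0 : 0 ≤ Λ)
    (hκ : ∀ i < n, t (i + 1) - t i ≤ κ) (hstep : ∀ i, n ≤ i → i < N → t (i + 1) - t i = H)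
    (hf : ∀ x ∈ Icc (t 0) (t N), HasDerivWithinAt f (f' x) (Icc (t 0) (t N)) x)
    (hf' : ∀ x ∈ Icc (t 0) (t N), HasDerivWithinAt f' (f'' x) (Icc (t 0) (t N)) x)
    (hf'' : ∀ x ∈ Icc (t 0) (t N), HasDerivWithinAt f'' (f''' x) (Icc (t 0) (t N)) x)
    (b2 : ∀ x ∈ Icc (t 0) (t N), |f'' x| ≤ M) (b3 : ∀ x ∈ Icc (t 0) (t N), |f''' x| ≤ M)
    (hw : ContinuousOn w (Icc (t 0) (t N))) (hB : ∀ x ∈ Icc (t 0) (t N), |w x| ≤ B)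
    (hΛ : ∀ x ∈ Icc (t 0) (t N), ∀ y ∈ Icc (t 0) (t N), |w x - w y| ≤ Λ * |x - y|)
    (hvc : ContinuousOn v (Icc (t 0) (t N)))
    (hv : ∀ i < N, ∃ s, ∀ x ∈ Icc (t i) (t (i + 1)), v x = v (t i) + s * (x - t i))
    (hvN : v (t N) = 0) :
    |(∑ i ∈ Finset.range N, ∫ x in t i..t (i + 1),
        w x * (f' x - (f (t (i + 1)) - f (t i)) / (t (i + 1) - t i)) * v x) +
        H ^ 2 / 12 * (w (t n) * f'' (t n) * v (t n))|
      ≤ B * (M * κ) * (∫ x in t 0..t n, |v x|) +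
        (2 * Λ * M + 13 * B * M) * H ^ 2 * ∫ x in t n..t N, |v x| := by
  have sub : ∀ {i}, i < N → Icc (t i) (t (i + 1)) ⊆ Icc (t 0) (t N) := fun hi =>
    cell_subset ht hi
  have mem : ∀ {i}, i ≤ N → t i ∈ Icc (t 0) (t N) := fun hi =>
    ⟨mesh_le ht (Nat.zero_le _) hi, mesh_le ht hi le_rfl⟩
  have B0 : 0 ≤ B := (abs_nonneg _).trans (hB _ (mem (Nat.zero_le N)))
  have d : ∀ {g g' : ℝ → ℝ}, (∀ x ∈ Icc (t 0) (t N), HasDerivWithinAt g (g' x) (Icc (t 0) (t N)) x) →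
      ∀ {i}, i < N → ∀ x ∈ Icc (t i) (t (i + 1)), HasDerivWithinAt g (g' x) (Icc (t i) (t (i + 1))) x :=
    fun hg i hi x hx => (hg x (sub hi hx)).mono (sub hi)
  have cf' : ContinuousOn f' (Icc (t 0) (t N)) := fun x hx => (hf' x hx).continuousWithinAt
  set T : ℕ → ℝ := fun i => ∫ x in t i..t (i + 1),
    w x * (f' x - (f (t (i + 1)) - f (t i)) / (t (i + 1) - t i)) * v x with hT
  have fine : |∑ i ∈ Finset.Ico 0 n, T i| ≤ B * (M * κ) * ∫ x in t 0..t n, |v x| := by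
    rw [← sum_integral_cells ht hvc.abs (Nat.zero_le n) hn, Finset.mul_sum]
    refine (Finset.abs_sum_le_sum_abs _ _).trans (Finset.sum_le_sum fun i hi => ?_)
    have hin : i < n := (Finset.mem_Ico.1 hi).2
    have hi : i < N := by omega
    have hle := (ht i hi).le
    have ii : ∀ {g : ℝ → ℝ}, ContinuousOn g (Icc (t 0) (t N)) →
        IntervalIntegrable g volume (t i) (t (i + 1)) := fun hg =>
      ContinuousOn.intervalIntegrable (by rw [uIcc_of_le hle]; exact hg.mono (sub hi))
    rw [hT, ← intervalIntegral.integral_const_mul]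
    refine (intervalIntegral.abs_integral_le_integral_abs hle).trans ?_
    refine intervalIntegral.integral_mono_on hle (ii (by fun_prop)) (ii (by fun_prop))
      fun x hx => ?_
    rw [abs_mul, abs_mul]
    refine mul_le_mul_of_nonneg_right ?_ (abs_nonneg _)
    refine mul_le_mul (hB x (sub hi hx)) ?_ (abs_nonneg _) B0
    refine (abs_deriv_sub_slope_le (ht i hi) (d hf hi) (y := x)
      (R := M * (t (i + 1) - t i)) fun y hy => ?_).trans
      (mul_le_mul_of_nonneg_left (hκ i hin) hM)
    refine (abs_sub_le_of_hasDerivWithinAt (d hf' hi) (fun z hz => b2 z (sub hi hz)) hx hy).trans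
      (mul_le_mul_of_nonneg_left ?_ hM)
    rw [abs_le]; constructor <;> linarith [hx.1, hx.2, hy.1, hy.2]
  set G : ℕ → ℝ := fun i => w (t i) * f'' (t i) with hG
  have coarse : |(∑ i ∈ Finset.Ico n N, T i) -
      H ^ 2 / 12 * ∑ i ∈ Finset.Ico n N, G i * (v (t (i + 1)) - v (t i))| ≤
      (Λ * M + 12 * B * M) * H ^ 2 * ∫ x in t n..t N, |v x| := by
    rw [← sum_integral_cells ht hvc.abs hn le_rfl, Finset.mul_sum, Finset.mul_sum,
      ← Finset.sum_sub_distrib]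
    refine (Finset.abs_sum_le_sum_abs _ _).trans (Finset.sum_le_sum fun i hi => ?_)
    have hi' := Finset.mem_Ico.1 hi
    have hi : i < N := hi'.2
    obtain ⟨s, hs⟩ := hv i hi
    have := cell_estimate (ht i hi) hM (d hf hi) (d hf' hi) (d hf'' hi)
      (fun x hx => b2 x (sub hi hx)) (fun x hx => b3 x (sub hi hx)) (hw.mono (sub hi))
      (hB _ (mem hi.le)) (Λ := Λ) (fun x hx => by
        refine (hΛ x (sub hi hx) _ (mem hi.le)).trans (mul_le_mul_of_nonneg_left ?_ hΛ0)
        rw [abs_le]; constructor <;> linarith [hx.1, hx.2]) hs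
    rw [hT, hG]
    simp only []
    rw [hstep i hi'.1 hi] at this ⊢
    exact this
  have tail : |(∑ i ∈ Finset.Ico n N, G i * (v (t (i + 1)) - v (t i))) + G n * v (t n)| ≤
      4 * (Λ * M + B * M) * ∫ x in t n..t N, |v x| := by
    rw [sum_Ico_mul_sub G (fun i => v (t i)) hn, hvN, mul_zero,
      show ∀ p r : ℝ, 0 - p - r + p = -r from fun p r => by ring, abs_neg,
      ← sum_integral_cells ht hvc.abs hn le_rfl, Finset.mul_sum]
    refine (Finset.abs_sum_le_sum_abs _ _).trans (Finset.sum_le_sum fun i hi => ?_)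
    have hi' := Finset.mem_Ico.1 hi
    have hi : i < N := hi'.2
    have hst := hstep i hi'.1 hi
    -- The Lipschitz bound supplies a cell width, which `mul_abs_nodes_le` uses to convert the nodal
    -- value of `v` into an integral.
    have hG : |G (i + 1) - G i| ≤ (Λ * M + B * M) * (t (i + 1) - t i) := by
      have e : G (i + 1) - G i = (w (t (i + 1)) - w (t i)) * f'' (t (i + 1)) +
        w (t i) * (f'' (t (i + 1)) - f'' (t i)) := by simp only [hG]; ring
      rw [e]
      refine (abs_add_le _ _).trans ?_
      rw [abs_mul, abs_mul]
      have h1 := hΛ _ (mem hi) _ (mem hi.le)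
      have h2 := b2 _ (mem hi)
      have h3 := hB _ (mem hi.le)
      have h4 := abs_sub_le_of_hasDerivWithinAt hf'' b3 (mem hi.le) (mem hi)
      rw [abs_of_pos (sub_pos.2 (ht i hi))] at h1 h4
      calc _ ≤ Λ * (t (i + 1) - t i) * M + B * (M * (t (i + 1) - t i)) := by
            refine add_le_add (mul_le_mul h1 h2 (abs_nonneg _) ((abs_nonneg _).trans h1))
              (mul_le_mul h3 h4 (abs_nonneg _) B0)
        _ = _ := by ring
    have h5 := (mul_abs_nodes_le ht hv hi).2
    rw [abs_mul]
    calc _ ≤ (Λ * M + B * M) * (t (i + 1) - t i) * |v (t (i + 1))| := by gcongr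
      _ = (Λ * M + B * M) * ((t (i + 1) - t i) * |v (t (i + 1))|) := by ring
      _ ≤ (Λ * M + B * M) * (4 * ∫ x in t i..t (i + 1), |v x|) :=
          mul_le_mul_of_nonneg_left h5 (by positivity)
      _ = _ := by ring
  rw [Finset.range_eq_Ico, ← Finset.sum_Ico_consecutive T (Nat.zero_le n) hn]
  set s₁ := ∑ i ∈ Finset.Ico 0 n, T i
  set s₂ := ∑ i ∈ Finset.Ico n N, T i
  set s₃ := ∑ i ∈ Finset.Ico n N, G i * (v (t (i + 1)) - v (t i))
  have I0 : 0 ≤ ∫ x in t n..t N, |v x| :=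
    intervalIntegral.integral_nonneg (mesh_le ht hn le_rfl) fun x _ => abs_nonneg _
  have e : s₁ + s₂ + H ^ 2 / 12 * (w (t n) * f'' (t n) * v (t n)) =
    s₁ + ((s₂ - H ^ 2 / 12 * s₃) + H ^ 2 / 12 * (s₃ + G n * v (t n))) := by
    simp only [hG]; ring
  rw [e]
  refine (abs_add_le _ _).trans (add_le_add fine ((abs_add_le _ _).trans ?_))
  rw [abs_mul, abs_of_nonneg (by positivity : 0 ≤ H ^ 2 / 12)]
  set I := ∫ x in t n..t N, |v x|
  calc _ ≤ (Λ * M + 12 * B * M) * H ^ 2 * I + H ^ 2 / 12 * (4 * (Λ * M + B * M) * I) := by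
        gcongr
    _ ≤ _ := by
        have : 0 ≤ H ^ 2 * I * (Λ * M + B * M) := by positivity
        linarith

end Line

end Bakhvalov

namespace Bakhvalov

/-! ### Partial derivatives on the closed unit square -/

lemma mem_OmBar {x y : ℝ} (hx : x ∈ Icc (0 : ℝ) 1) (hy : y ∈ Icc (0 : ℝ) 1) : (x, y) ∈ OmBar :=
  ⟨hx, hy⟩

lemma uniqueDiffOn_OmBar : UniqueDiffOn ℝ OmBar :=
  (uniqueDiffOn_Icc zero_lt_one).prod (uniqueDiffOn_Icc zero_lt_one)

lemma hasDerivWithinAt_fst {w : ℝ × ℝ → ℝ} (hw : DifferentiableOn ℝ w OmBar) {p : ℝ × ℝ}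
    (hp : p ∈ OmBar) :
    HasDerivWithinAt (fun t => w (t, p.2)) (fderivWithin ℝ w OmBar p (1, 0)) (Icc 0 1) p.1 := by
  have h := (hw p hp).hasFDerivWithinAt
  have h2 : HasDerivWithinAt (fun t : ℝ => (t, p.2)) ((1 : ℝ), (0 : ℝ)) (Icc 0 1) p.1 :=
    (hasDerivWithinAt_id _ _).prodMk (hasDerivWithinAt_const _ _ _)
  exact HasFDerivWithinAt.comp_hasDerivWithinAt (t := OmBar) p.1 h h2
    (fun t ht => ⟨ht, hp.2⟩)

lemma hasDerivWithinAt_snd {w : ℝ × ℝ → ℝ} (hw : DifferentiableOn ℝ w OmBar) {p : ℝ × ℝ}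
    (hp : p ∈ OmBar) :
    HasDerivWithinAt (fun t => w (p.1, t)) (fderivWithin ℝ w OmBar p (0, 1)) (Icc 0 1) p.2 := by
  have h := (hw p hp).hasFDerivWithinAt
  have h2 : HasDerivWithinAt (fun t : ℝ => (p.1, t)) ((0 : ℝ), (1 : ℝ)) (Icc 0 1) p.2 :=
    (hasDerivWithinAt_const _ _ _).prodMk (hasDerivWithinAt_id _ _)
  exact HasFDerivWithinAt.comp_hasDerivWithinAt (t := OmBar) p.2 h h2
    (fun t ht => ⟨hp.1, ht⟩)

/-- This links slice derivatives to the Fréchet derivative on the square, so that smoothness passes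
to iterated partial derivatives. -/
lemma pdx_eq_fderivWithin {w : ℝ × ℝ → ℝ} (hw : DifferentiableOn ℝ w OmBar) {p : ℝ × ℝ}
    (hp : p ∈ OmBar) : pdx w p = fderivWithin ℝ w OmBar p (1, 0) :=
  (hasDerivWithinAt_fst hw hp).derivWithin (uniqueDiffOn_Icc zero_lt_one _ hp.1)

lemma pdy_eq_fderivWithin {w : ℝ × ℝ → ℝ} (hw : DifferentiableOn ℝ w OmBar) {p : ℝ × ℝ}
    (hp : p ∈ OmBar) : pdy w p = fderivWithin ℝ w OmBar p (0, 1) :=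
  (hasDerivWithinAt_snd hw hp).derivWithin (uniqueDiffOn_Icc zero_lt_one _ hp.2)

lemma hasDerivWithinAt_pdx {w : ℝ × ℝ → ℝ} (hw : DifferentiableOn ℝ w OmBar) {x y : ℝ}
    (hx : x ∈ Icc (0 : ℝ) 1) (hy : y ∈ Icc (0 : ℝ) 1) :
    HasDerivWithinAt (fun t => w (t, y)) (pdx w (x, y)) (Icc 0 1) x := by
  rw [pdx_eq_fderivWithin hw (mem_OmBar hx hy)]
  exact hasDerivWithinAt_fst hw (mem_OmBar hx hy)

lemma hasDerivWithinAt_pdy {w : ℝ × ℝ → ℝ} (hw : DifferentiableOn ℝ w OmBar) {x y : ℝ}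
    (hx : x ∈ Icc (0 : ℝ) 1) (hy : y ∈ Icc (0 : ℝ) 1) :
    HasDerivWithinAt (fun t => w (x, t)) (pdy w (x, y)) (Icc 0 1) y := by
  rw [pdy_eq_fderivWithin hw (mem_OmBar hx hy)]
  exact hasDerivWithinAt_snd hw (mem_OmBar hx hy)

lemma contDiffOn_pdx {w : ℝ × ℝ → ℝ} {n : ℕ} (hw : ContDiffOn ℝ (n + 1 : ℕ) w OmBar) :
    ContDiffOn ℝ n (pdx w) OmBar := by
  have h : ContDiffOn ℝ n (fderivWithin ℝ w OmBar) OmBar :=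
    hw.fderivWithin uniqueDiffOn_OmBar (by norm_cast)
  exact (h.clm_apply contDiffOn_const).congr fun p hp =>
    pdx_eq_fderivWithin (hw.differentiableOn (by simp)) hp

lemma contDiffOn_pdy {w : ℝ × ℝ → ℝ} {n : ℕ} (hw : ContDiffOn ℝ (n + 1 : ℕ) w OmBar) :
    ContDiffOn ℝ n (pdy w) OmBar := by
  have h : ContDiffOn ℝ n (fderivWithin ℝ w OmBar) OmBar :=
    hw.fderivWithin uniqueDiffOn_OmBar (by norm_cast)
  exact (h.clm_apply contDiffOn_const).congr fun p hp =>
    pdy_eq_fderivWithin (hw.differentiableOn (by simp)) hp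

/-- A function of class `C³` on the closed unit square whose derivatives up to order three
are bounded by `M`. -/
structure SmoothBound (M : ℝ) (S : ℝ × ℝ → ℝ) : Prop where
  smooth : ContDiffOn ℝ 3 S OmBar
  bound : ∀ m n : ℕ, m + n ≤ 3 → ∀ p ∈ OmBar, |pd m n S p| ≤ M

namespace SmoothBound

variable {M : ℝ} {S : ℝ × ℝ → ℝ}

lemma nonneg (h : SmoothBound M S) : 0 ≤ M :=
  (abs_nonneg _).trans (h.bound 0 0 (by norm_num) (0, 0) (by simp [OmBar]))

lemma smooth_pdx (h : SmoothBound M S) : ContDiffOn ℝ (2 : ℕ) (pdx S) OmBar :=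
  contDiffOn_pdx (n := 2) h.smooth

lemma smooth_pdx_pdx (h : SmoothBound M S) : ContDiffOn ℝ (1 : ℕ) (pd 2 0 S) OmBar :=
  contDiffOn_pdx (n := 1) h.smooth_pdx

lemma smooth_pdy (h : SmoothBound M S) : ContDiffOn ℝ (2 : ℕ) (pdy S) OmBar :=
  contDiffOn_pdy (n := 2) h.smooth

lemma smooth_pdy_pdy (h : SmoothBound M S) : ContDiffOn ℝ (1 : ℕ) (pdy (pdy S)) OmBar :=
  contDiffOn_pdy (n := 1) h.smooth_pdy

lemma hasDeriv_x (h : SmoothBound M S) {x y : ℝ} (hy : y ∈ Icc (0 : ℝ) 1)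
    (hx : x ∈ Icc (0 : ℝ) 1) :
    HasDerivWithinAt (fun t => S (t, y)) (pdx S (x, y)) (Icc 0 1) x :=
  hasDerivWithinAt_pdx (h.smooth.differentiableOn (by simp)) hx hy

lemma hasDeriv_xx (h : SmoothBound M S) {x y : ℝ} (hy : y ∈ Icc (0 : ℝ) 1)
    (hx : x ∈ Icc (0 : ℝ) 1) :
    HasDerivWithinAt (fun t => pdx S (t, y)) (pd 2 0 S (x, y)) (Icc 0 1) x :=
  hasDerivWithinAt_pdx (h.smooth_pdx.differentiableOn (by simp)) hx hy

lemma hasDeriv_xxx (h : SmoothBound M S) {x y : ℝ} (hy : y ∈ Icc (0 : ℝ) 1)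
    (hx : x ∈ Icc (0 : ℝ) 1) :
    HasDerivWithinAt (fun t => pd 2 0 S (t, y)) (pd 3 0 S (x, y)) (Icc 0 1) x := by
  have := hasDerivWithinAt_pdx (h.smooth_pdx_pdx.differentiableOn (by simp)) hx hy
  exact this

/-- The `y`-interpolation error of a difference quotient in the `x`-direction. -/
lemma interp_increment (h : SmoothBound M S) {x₁ x₂ y₁ y₂ y : ℝ} (hx₁ : x₁ ∈ Icc (0 : ℝ) 1)
    (hx₂ : x₂ ∈ Icc (0 : ℝ) 1) (hy₁ : 0 ≤ y₁) (hy₂ : y₂ ≤ 1) (hyy : y₁ < y₂)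
    (hy : y ∈ Icc y₁ y₂) :
    |(S (x₂, y) - S (x₁, y)) - ((S (x₂, y₁) - S (x₁, y₁)) * ((y₂ - y) / (y₂ - y₁)) +
        (S (x₂, y₂) - S (x₁, y₂)) * ((y - y₁) / (y₂ - y₁)))|
      ≤ M * |x₂ - x₁| * (y₂ - y₁) ^ 2 := by
  have hsub : Icc y₁ y₂ ⊆ Icc 0 1 := Icc_subset_Icc hy₁ hy₂
  have d1 : ∀ z ∈ Icc y₁ y₂, HasDerivWithinAt (fun z => S (x₂, z) - S (x₁, z))
      (pdy S (x₂, z) - pdy S (x₁, z)) (Icc y₁ y₂) z := fun z hz =>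
    ((hasDerivWithinAt_pdy (h.smooth.differentiableOn (by simp)) hx₂ (hsub hz)).sub
      (hasDerivWithinAt_pdy (h.smooth.differentiableOn (by simp)) hx₁ (hsub hz))).mono hsub
  have d2 : ∀ z ∈ Icc y₁ y₂, HasDerivWithinAt (fun z => pdy S (x₂, z) - pdy S (x₁, z))
      (pdy (pdy S) (x₂, z) - pdy (pdy S) (x₁, z)) (Icc y₁ y₂) z := fun z hz =>
    ((hasDerivWithinAt_pdy (h.smooth_pdy.differentiableOn (by simp)) hx₂ (hsub hz)).sub
      (hasDerivWithinAt_pdy (h.smooth_pdy.differentiableOn (by simp)) hx₁ (hsub hz))).mono hsub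
  -- The bound on S_xyy yields a factor |x₂ - x₁|. It later cancels the division by the cell width,
  -- so arbitrarily thin cells do no harm.
  have d3 : ∀ z ∈ Icc y₁ y₂, |pdy (pdy S) (x₂, z) - pdy (pdy S) (x₁, z)| ≤ M * |x₂ - x₁| :=
    fun z hz => abs_sub_le_of_hasDerivWithinAt (g := fun t => pdy (pdy S) (t, z))
      (g' := fun t => pd 1 2 S (t, z))
      (fun t ht => hasDerivWithinAt_pdx (h.smooth_pdy_pdy.differentiableOn (by simp)) ht (hsub hz))
      (fun t ht => h.bound 1 2 (by norm_num) _ (mem_OmBar ht (hsub hz))) hx₁ hx₂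
  have hM : 0 ≤ M * |x₂ - x₁| := mul_nonneg h.nonneg (abs_nonneg _)
  have := abs_sub_interp_le hyy d1 (R := M * |x₂ - x₁| * (y₂ - y₁)) (fun u hu z hz => by
    refine (abs_sub_le_of_hasDerivWithinAt d2 d3 hz hu).trans (mul_le_mul_of_nonneg_left ?_ hM)
    rw [abs_le]; constructor <;> linarith [hu.1, hu.2, hz.1, hz.2]) hy
  refine this.trans (le_of_eq (by ring))

end SmoothBound

lemma isCompact_OmBar : IsCompact OmBar := isCompact_Icc.prod isCompact_Icc

lemma exists_bound_lipschitz {b : ℝ × ℝ → ℝ} (hb : ContDiffOn ℝ 1 b OmBar) :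
    ∃ B Λ : ℝ, 0 ≤ B ∧ 0 ≤ Λ ∧ (∀ p ∈ OmBar, |b p| ≤ B) ∧
      ∀ x ∈ Icc (0 : ℝ) 1, ∀ y ∈ Icc (0 : ℝ) 1, ∀ x' ∈ Icc (0 : ℝ) 1, ∀ y' ∈ Icc (0 : ℝ) 1,
        |b (x, y) - b (x', y')| ≤ Λ * (|x - x'| + |y - y'|) := by
  obtain ⟨B, hB⟩ := isCompact_OmBar.exists_bound_of_continuousOn hb.continuousOn
  obtain ⟨K, hK⟩ := hb.exists_lipschitzOnWith (by simp)
    ((convex_Icc (0 : ℝ) 1).prod (convex_Icc (0 : ℝ) 1)) isCompact_OmBar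
  refine ⟨B, K, (norm_nonneg _).trans (hB (0, 0) (by simp [OmBar])), K.2, hB, ?_⟩
  intro x hx y hy x' hx' y' hy'
  have := hK.dist_le_mul (x, y) (mem_OmBar hx hy) (x', y') (mem_OmBar hx' hy')
  rw [Real.dist_eq, Prod.dist_eq, Real.dist_eq, Real.dist_eq] at this
  refine this.trans (mul_le_mul_of_nonneg_left ?_ K.2)
  exact max_le (le_add_of_nonneg_right (abs_nonneg _)) (le_add_of_nonneg_left (abs_nonneg _))

end Bakhvalov

namespace Bakhvalov

/-! ### Integrals over rectangles and strips -/

section Rect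

variable {a b c d : ℝ} {G g : ℝ × ℝ → ℝ}

lemma Ioo_prod_ae_eq_Ioc_prod :
    (Ioo a b ×ˢ Ioo c d : Set (ℝ × ℝ)) =ᵐ[volume] (Ioc a b ×ˢ Ioc c d : Set (ℝ × ℝ)) :=
  Measure.set_prod_ae_eq Ioo_ae_eq_Ioc Ioo_ae_eq_Ioc

lemma Ioo_prod_ae_eq_Icc_prod :
    (Ioo a b ×ˢ Ioo c d : Set (ℝ × ℝ)) =ᵐ[volume] (Icc a b ×ˢ Icc c d : Set (ℝ × ℝ)) :=
  Measure.set_prod_ae_eq Ioo_ae_eq_Icc Ioo_ae_eq_Icc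

lemma integrableOn_rect (hG : ContinuousOn G (Icc a b ×ˢ Icc c d)) :
    IntegrableOn G (Ioc a b ×ˢ Ioc c d) volume :=
  (hG.integrableOn_compact (isCompact_Icc.prod isCompact_Icc)).mono_set
    (prod_mono Ioc_subset_Icc_self Ioc_subset_Icc_self)

lemma intervalIntegrable_slice (hab : a ≤ b) (hcd : c ≤ d)
    (hG : ContinuousOn G (Icc a b ×ˢ Icc c d)) :
    IntervalIntegrable (fun y => ∫ x in a..b, G (x, y)) volume c d := by
  have h := integrableOn_rect hG
  rw [IntegrableOn, Measure.volume_eq_prod, ← Measure.prod_restrict] at h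
  rw [intervalIntegrable_iff_integrableOn_Ioc_of_le hcd]
  simp only [intervalIntegral.integral_of_le hab]
  exact h.integral_prod_right

/-- Agreement with a continuous function is required only in the open rectangle, because derivatives
of piecewise bilinear functions jump across mesh lines. -/
lemma integral_rect (hab : a ≤ b) (hcd : c ≤ d) (hG : ContinuousOn G (Icc a b ×ˢ Icc c d))
    (hg : ∀ p ∈ Ioo a b ×ˢ Ioo c d, g p = G p) :
    IntegrableOn g (Ioo a b ×ˢ Ioo c d) ∧
      ∫ p in Ioo a b ×ˢ Ioo c d, g p = ∫ y in c..d, ∫ x in a..b, G (x, y) := by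
  have hm : MeasurableSet (Ioo a b ×ˢ Ioo c d : Set (ℝ × ℝ)) :=
    measurableSet_Ioo.prod measurableSet_Ioo
  have h := integrableOn_rect hG
  constructor
  · rw [integrableOn_congr_fun hg hm]
    exact h.congr_set_ae Ioo_prod_ae_eq_Ioc_prod
  · rw [setIntegral_congr_fun hm hg, setIntegral_congr_set Ioo_prod_ae_eq_Ioc_prod]
    rw [IntegrableOn, Measure.volume_eq_prod, ← Measure.prod_restrict] at h
    rw [Measure.volume_eq_prod, ← Measure.prod_restrict, integral_prod_symm _ h]
    simp only [intervalIntegral.integral_of_le hab, intervalIntegral.integral_of_le hcd]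

lemma integral_rect_Icc (hab : a ≤ b) (hcd : c ≤ d) (hG : ContinuousOn G (Icc a b ×ˢ Icc c d))
    (hg : ∀ p ∈ Ioo a b ×ˢ Ioo c d, g p = G p) :
    ∫ p in Icc a b ×ˢ Icc c d, g p = ∫ y in c..d, ∫ x in a..b, G (x, y) := by
  rw [← (integral_rect hab hcd hG hg).2, setIntegral_congr_set Ioo_prod_ae_eq_Icc_prod]

end Rect

/-- Splitting of an integral over the unit square into integrals over vertical strips. -/
lemma integral_Om_eq_sum {t : ℕ → ℝ} {N : ℕ} (ht : ∀ i < N, t i < t (i + 1)) (h0 : t 0 = 0)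
    (hN : t N = 1) {g : ℝ × ℝ → ℝ}
    (hg : ∀ i < N, IntegrableOn g (Ioo (t i) (t (i + 1)) ×ˢ Ioo (0 : ℝ) 1)) :
    IntegrableOn g Om ∧
      ∫ p in Om, g p = ∑ i ∈ Finset.range N, ∫ p in Ioo (t i) (t (i + 1)) ×ˢ Ioo (0 : ℝ) 1, g p := by
  -- Half-open strips are pairwise disjoint and cover the square up to a null set.
  set U : ℕ → Set (ℝ × ℝ) := fun i => Ioc (t i) (t (i + 1)) ×ˢ Ioo (0 : ℝ) 1 with hU
  have hae : ∀ i, (Ioo (t i) (t (i + 1)) ×ˢ Ioo (0 : ℝ) 1 : Set (ℝ × ℝ)) =ᵐ[volume] U i :=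
    fun i => Measure.set_prod_ae_eq Ioo_ae_eq_Ioc (Filter.EventuallyEq.refl _ _)
  have hint : ∀ i ∈ Finset.range N, IntegrableOn g (U i) := fun i hi =>
    (hg i (Finset.mem_range.1 hi)).congr_set_ae (hae i).symm
  have hunion : ⋃ i ∈ Finset.range N, U i = Ioc (0 : ℝ) 1 ×ˢ Ioo (0 : ℝ) 1 := by
    ext p
    simp only [hU, mem_iUnion, Finset.mem_range, mem_prod, exists_prop]
    constructor
    · rintro ⟨i, hi, hp, hp'⟩
      refine ⟨⟨?_, ?_⟩, hp'⟩
      · rw [← h0]; exact (mesh_le ht (Nat.zero_le i) hi.le).trans_lt hp.1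
      · rw [← hN]; exact hp.2.trans (mesh_le ht hi le_rfl)
    · rintro ⟨hp, hp'⟩
      have key : ∀ k ≤ N, p.1 ∈ Ioc (t 0) (t k) → ∃ i < k, p.1 ∈ Ioc (t i) (t (i + 1)) := by
        intro k
        induction k with
        | zero => intro _ h; exact absurd (h.1.trans_le h.2) (lt_irrefl _)
        | succ k ih =>
          intro hk h
          by_cases hle : p.1 ≤ t k
          · obtain ⟨i, hi, h'⟩ := ih (by omega) ⟨h.1, hle⟩
            exact ⟨i, by omega, h'⟩
          · exact ⟨k, by omega, not_le.1 hle, h.2⟩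
      obtain ⟨i, hi, h'⟩ := key N le_rfl (by rw [h0, hN]; exact hp)
      exact ⟨i, hi, h', hp'⟩
  have hOm : Om =ᵐ[volume] ⋃ i ∈ Finset.range N, U i := by
    rw [hunion]
    exact Measure.set_prod_ae_eq Ioo_ae_eq_Ioc (Filter.EventuallyEq.refl _ _)
  have hdisj : Set.Pairwise (↑(Finset.range N)) (Function.onFun Disjoint U) := by
    have key : ∀ i j, i < j → j < N → Disjoint (U i) (U j) := by
      intro i j hij hj
      rw [Set.disjoint_left]
      rintro p ⟨hp, -⟩ ⟨hp', -⟩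
      have := mesh_le ht (Nat.succ_le_of_lt hij) hj.le
      exact absurd (hp.2.trans this) (not_le.2 hp'.1)
    intro i hi j hj hij
    simp only [Finset.coe_range, mem_Iio] at hi hj
    rcases lt_or_gt_of_ne hij with h | h
    · exact key i j h hj
    · exact (key j i h hi).symm
  constructor
  · exact ((integrableOn_finset_iUnion).2 hint).congr_set_ae hOm
  · rw [setIntegral_congr_set hOm, integral_biUnion_finset _
      (fun i _ => measurableSet_Ioc.prod measurableSet_Ioo) hdisj hint]
    exact Finset.sum_congr rfl fun i _ => (setIntegral_congr_set (hae i)).symm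

end Bakhvalov

namespace Bakhvalov

/-! ### The Bakhvalov-type mesh -/

/-- This follows from ln(A/A') ≤ A/A' - 1. It is applied with e = ε or √ε, which cancels the
prefactor of the mesh-generating logarithm. -/
lemma log_sub_log_bounds {A A' e δ : ℝ} (he : 0 < e) (h1 : e ≤ A') (h2 : A' < A)
    (h3 : A - A' ≤ δ) : 0 < Real.log A - Real.log A' ∧ Real.log A - Real.log A' ≤ δ / e := by
  have hA' : 0 < A' := he.trans_le h1
  refine ⟨sub_pos.2 (Real.log_lt_log hA' h2), ?_⟩
  rw [← Real.log_div (hA'.trans h2).ne' hA'.ne']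
  refine (Real.log_le_sub_one_of_pos (div_pos (hA'.trans h2) hA')).trans ?_
  have : A / A' - 1 = (A - A') / A' := by field_simp
  rw [this]
  exact div_le_div₀ ((sub_nonneg.2 h2.le).trans h3) h3 he h1

namespace IsAdmissible

variable {β ε : ℝ} {N : ℕ}

lemma cast_ge (h : IsAdmissible β ε N) : (4 : ℝ) ≤ N := by exact_mod_cast h.four_le

lemma cast_pos (h : IsAdmissible β ε N) : (0 : ℝ) < N := by linarith [h.cast_ge]

lemma cast_half (h : IsAdmissible β ε N) : ((N / 2 : ℕ) : ℝ) = N / 2 := by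
  have := h.four_dvd
  rw [Nat.cast_div (by omega) (by norm_num)]; norm_num

lemma cast_quarter (h : IsAdmissible β ε N) : ((N / 4 : ℕ) : ℝ) = N / 4 := by
  rw [Nat.cast_div h.four_dvd (by norm_num)]; norm_num

lemma cast_three_quarters (h : IsAdmissible β ε N) : ((3 * N / 4 : ℕ) : ℝ) = 3 * N / 4 := by
  have := h.four_dvd
  rw [Nat.cast_div (by omega) (by norm_num)]; norm_num

lemma eps_le_quarter (h : IsAdmissible β ε N) : ε ≤ 1 / 4 := by
  refine h.eps_le.trans ?_
  rw [inv_eq_one_div]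
  exact one_div_le_one_div_of_le (by norm_num) h.cast_ge

lemma sqrt_eps_pos (h : IsAdmissible β ε N) : 0 < √ε := Real.sqrt_pos.2 h.eps_pos

lemma sqrt_eps_le (h : IsAdmissible β ε N) : √ε ≤ 1 / 2 := by
  rw [Real.sqrt_le_left (by norm_num)]; linarith [h.eps_le_quarter]

lemma log_inv_pos (h : IsAdmissible β ε N) : 0 < Real.log (1 / ε) := by
  refine Real.log_pos ?_
  rw [lt_div_iff₀ h.eps_pos]; linarith [h.eps_le_quarter]

lemma transX_eq (_ : IsAdmissible β ε N) : transX β ε = 5 / (2 * β) * ε * Real.log (1 / ε) := by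
  rw [transX, σ, one_div, Real.log_inv]
  by_cases hβ : β = 0
  · simp [hβ]
  · field_simp

lemma transY_eq (h : IsAdmissible β ε N) : transY ε = 5 / 4 * √ε * Real.log (1 / ε) := by
  rw [transY, σ, one_div, Real.log_inv, Real.log_sqrt h.eps_pos.le]; ring

lemma transX_le (h : IsAdmissible β ε N) : transX β ε ≤ 1 / 2 := by
  have := h.transition_x
  rw [one_div, Real.log_inv] at this
  rw [transX]; linarith

lemma transY_pos (h : IsAdmissible β ε N) : 0 < transY ε := by
  have := h.log_inv_pos
  have := h.sqrt_eps_pos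
  rw [h.transY_eq]; positivity

lemma transY_le (h : IsAdmissible β ε N) : transY ε ≤ 1 / 8 := by
  have := h.transition_y
  rw [σ] at this
  rw [h.transY_eq]; linarith

lemma meshX_fine {i : ℕ} (hi : i ≤ N / 2) :
    meshX β ε N i = -(σ * ε / β) * Real.log (1 - 2 * (1 - ε) * ((i : ℝ) / N)) := if_pos hi

lemma meshX_half (h : IsAdmissible β ε N) : meshX β ε N (N / 2) = transX β ε := by
  rw [meshX_fine le_rfl, h.cast_half, transX]
  have := h.cast_pos.ne'
  congr 2
  field_simp; ring

lemma meshX_coarse (h : IsAdmissible β ε N) {i : ℕ} (hi : N / 2 ≤ i) :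
    meshX β ε N i = 1 - (1 - transX β ε) * (2 * ((N : ℝ) - i) / N) := by
  rcases hi.eq_or_lt with rfl | hi
  · rw [h.meshX_half, h.cast_half]
    have := h.cast_pos.ne'
    field_simp; ring
  · exact if_neg (by omega)

lemma meshX_zero : meshX β ε N 0 = 0 := by
  rw [meshX_fine (Nat.zero_le _)]; simp

lemma meshX_last (h : IsAdmissible β ε N) : meshX β ε N N = 1 := by
  rw [h.meshX_coarse (by omega)]; simp

lemma meshX_coarse_step (h : IsAdmissible β ε N) {i : ℕ} (hi : N / 2 ≤ i) :
    meshX β ε N (i + 1) - meshX β ε N i = 2 * (1 - transX β ε) / N := by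
  rw [h.meshX_coarse hi, h.meshX_coarse (by omega)]
  push_cast; ring

lemma meshX_step_eq (h : IsAdmissible β ε N) {i : ℕ} (hi : N / 2 ≤ i) :
    meshX β ε N (i + 1) - meshX β ε N i =
      meshX β ε N (N / 2 + 1) - meshX β ε N (N / 2) := by
  rw [h.meshX_coarse_step hi, h.meshX_coarse_step le_rfl]

/-- The logarithm's argument stays at least ε and moves by at most 2/N per step, and (σε/β)(2/N)/ε =
5/(βN). -/
lemma meshX_fine_step (h : IsAdmissible β ε N) (hβ : 0 < β) {i : ℕ} (hi : i < N / 2) :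
    0 < meshX β ε N (i + 1) - meshX β ε N i ∧
      meshX β ε N (i + 1) - meshX β ε N i ≤ 5 / β / N := by
  have hN := h.cast_pos
  have hε := h.eps_pos
  have hε4 := h.eps_le_quarter
  have hi2 : ((i : ℝ) + 1) ≤ N / 2 := by rw [← h.cast_half]; exact_mod_cast hi
  have key := log_sub_log_bounds (A := 1 - 2 * (1 - ε) * ((i : ℝ) / N))
    (A' := 1 - 2 * (1 - ε) * (((i + 1 : ℕ) : ℝ) / N)) (δ := 2 / N) h.eps_pos
    (by
      have h1 : ((i : ℝ) + 1) / N ≤ 1 / 2 := by rw [div_le_iff₀ hN]; linarith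
      have h2 := mul_le_mul_of_nonneg_left h1 (by linarith : 0 ≤ 2 * (1 - ε))
      push_cast; linarith)
    (by
      have : (0 : ℝ) < 2 * (1 - ε) * (1 / N) := mul_pos (by linarith) (by positivity)
      push_cast; rw [add_div, mul_add]; linarith)
    (by
      have : 2 * (1 - ε) * (1 / N) ≤ 2 * (1 / (N : ℝ)) :=
        mul_le_mul_of_nonneg_right (by linarith) (by positivity)
      push_cast; rw [add_div, mul_add]
      have e : (2 : ℝ) / N = 2 * (1 / N) := by ring
      linarith)
  rw [meshX_fine hi.le, meshX_fine (by omega : i + 1 ≤ N / 2)]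
  have hc : 0 < σ * ε / β := by rw [σ]; positivity
  constructor
  · have := mul_pos hc key.1
    linarith
  · have := mul_le_mul_of_nonneg_left key.2 hc.le
    have e : σ * ε / β * (2 / N / ε) = 5 / β / N := by rw [σ]; field_simp
    linarith

lemma coarse_width_ge (h : IsAdmissible β ε N) :
    1 / (N : ℝ) ≤ meshX β ε N (N / 2 + 1) - meshX β ε N (N / 2) := by
  rw [h.meshX_coarse_step le_rfl]
  exact div_le_div_of_nonneg_right (by linarith [h.transX_le]) h.cast_pos.le

lemma transX_nonneg (h : IsAdmissible β ε N) (hβ : 0 < β) : 0 ≤ transX β ε := by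
  have := h.log_inv_pos
  have := h.eps_pos
  rw [h.transX_eq]; positivity

lemma coarse_width_le (h : IsAdmissible β ε N) (hβ : 0 < β) :
    meshX β ε N (N / 2 + 1) - meshX β ε N (N / 2) ≤ 2 / N := by
  rw [h.meshX_coarse_step le_rfl]
  exact div_le_div_of_nonneg_right (by linarith [h.transX_nonneg hβ]) h.cast_pos.le

lemma meshX_lt (h : IsAdmissible β ε N) (hβ : 0 < β) :
    ∀ i < N, meshX β ε N i < meshX β ε N (i + 1) := by
  intro i _
  rcases lt_or_ge i (N / 2) with hi | hi
  · exact sub_pos.1 (h.meshX_fine_step hβ hi).1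
  · have := h.coarse_width_ge
    have h2 := h.meshX_step_eq hi
    have : 0 < 1 / (N : ℝ) := one_div_pos.2 h.cast_pos
    linarith

/-- At x_{N/2} the logarithm's argument is ε, but two nodes earlier it is already at least 1/N. So
ln N replaces ln(1/ε), which is the source of the factor ln^{1/2} N. -/
lemma meshX_two_before (h : IsAdmissible β ε N) (hβ : 0 < β) :
    meshX β ε N (N / 2 - 2) ≤ 5 / (2 * β) * ε * Real.log N := by
  have hN := h.cast_pos
  have hε := h.eps_pos
  have hN2 : 2 ≤ N / 2 := by have := h.four_le; omega
  rw [meshX_fine (Nat.sub_le _ _), Nat.cast_sub hN2, h.cast_half]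
  have e : 1 - 2 * (1 - ε) * (((N : ℝ) / 2 - (2 : ℕ)) / N) = ε + 4 * (1 - ε) / N := by
    push_cast; field_simp; ring
  rw [e]
  have h1 : 1 / (N : ℝ) ≤ ε + 4 * (1 - ε) / N := by
    have : 1 / (N : ℝ) ≤ 4 * (1 - ε) / N :=
      div_le_div_of_nonneg_right (by linarith [h.eps_le_quarter]) hN.le
    linarith
  have h2 := Real.log_le_log (by positivity) h1
  rw [one_div, Real.log_inv] at h2
  have hc : 0 < σ * ε / β := by rw [σ]; positivity
  have := mul_le_mul_of_nonneg_left h2 hc.le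
  have e2 : 5 / (2 * β) * ε * Real.log N = σ * ε / β * Real.log N := by rw [σ]; field_simp
  rw [e2]; linarith

lemma meshY_left {j : ℕ} (hj : j ≤ N / 4) :
    meshY ε N j = -(σ * √ε) * Real.log (1 - 4 * (1 - √ε) * ((j : ℝ) / N)) := if_pos hj

lemma meshY_right (h : IsAdmissible β ε N) {j : ℕ} (hj : 3 * N / 4 ≤ j) :
    meshY ε N j = 1 + σ * √ε * Real.log (1 - 4 * (1 - √ε) * (1 - (j : ℝ) / N)) := by
  have := h.four_le
  rw [meshY, if_neg (by omega), if_neg (by omega)]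

lemma meshY_quarter (h : IsAdmissible β ε N) : meshY ε N (N / 4) = transY ε := by
  rw [meshY_left le_rfl, h.cast_quarter, transY]
  have := h.cast_pos.ne'
  congr 2
  field_simp; ring

lemma meshY_three_quarters (h : IsAdmissible β ε N) :
    meshY ε N (3 * N / 4) = 1 - transY ε := by
  rw [h.meshY_right le_rfl, h.cast_three_quarters, transY]
  have := h.cast_pos.ne'
  have e : 1 - 4 * (1 - √ε) * (1 - 3 * (N : ℝ) / 4 / N) = √ε := by field_simp; ring
  rw [e]; ring

lemma meshY_middle (h : IsAdmissible β ε N) {j : ℕ} (hj : N / 4 ≤ j) (hj' : j ≤ 3 * N / 4) :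
    meshY ε N j =
      2 * (1 - transY ε) * ((j : ℝ) / N - 1 / 4) - 2 * transY ε * ((j : ℝ) / N - 3 / 4) := by
  have hN := h.cast_pos.ne'
  rcases hj.eq_or_lt with rfl | hj
  · rw [h.meshY_quarter, h.cast_quarter]; field_simp; ring
  rcases hj'.eq_or_lt with rfl | hj'
  · rw [h.meshY_three_quarters, h.cast_three_quarters]; field_simp; ring
  rw [meshY, if_neg (by omega), if_pos hj']

lemma meshY_zero : meshY ε N 0 = 0 := by
  rw [meshY_left (Nat.zero_le _)]; simp

lemma meshY_last (h : IsAdmissible β ε N) : meshY ε N N = 1 := by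
  have := h.four_le
  rw [h.meshY_right (by omega), div_self h.cast_pos.ne']; simp

lemma meshY_middle_step (h : IsAdmissible β ε N) {j : ℕ} (hj : N / 4 ≤ j) (hj' : j < 3 * N / 4) :
    meshY ε N (j + 1) - meshY ε N j = 2 * (1 - 2 * transY ε) / N := by
  rw [h.meshY_middle hj hj'.le, h.meshY_middle (by omega) hj']
  push_cast; ring

/-- As in `meshX_fine_step`, now with argument at least √ε and decrement at most 4/N: σ√ε (4/N)/√ε =
10/N. -/
lemma meshY_fine_step (h : IsAdmissible β ε N) {j : ℕ} (hj : j < N / 4) :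
    0 < meshY ε N (j + 1) - meshY ε N j ∧ meshY ε N (j + 1) - meshY ε N j ≤ 10 / N := by
  have hN := h.cast_pos
  have hε := h.sqrt_eps_pos
  have hε4 := h.sqrt_eps_le
  have hi2 : ((j : ℝ) + 1) ≤ N / 4 := by rw [← h.cast_quarter]; exact_mod_cast hj
  have key := log_sub_log_bounds (A := 1 - 4 * (1 - √ε) * ((j : ℝ) / N))
    (A' := 1 - 4 * (1 - √ε) * (((j + 1 : ℕ) : ℝ) / N)) (δ := 4 / N) hε
    (by
      have h1 : ((j : ℝ) + 1) / N ≤ 1 / 4 := by rw [div_le_iff₀ hN]; linarith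
      have h2 := mul_le_mul_of_nonneg_left h1 (by linarith : 0 ≤ 4 * (1 - √ε))
      push_cast; linarith)
    (by
      have : (0 : ℝ) < 4 * (1 - √ε) * (1 / N) := mul_pos (by linarith) (by positivity)
      push_cast; rw [add_div, mul_add]; linarith)
    (by
      have : 4 * (1 - √ε) * (1 / N) ≤ 4 * (1 / (N : ℝ)) :=
        mul_le_mul_of_nonneg_right (by linarith) (by positivity)
      push_cast; rw [add_div, mul_add]
      have e : (4 : ℝ) / N = 4 * (1 / N) := by ring
      linarith)
  rw [meshY_left hj.le, meshY_left (by omega : j + 1 ≤ N / 4)]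
  have hc : 0 < σ * √ε := by rw [σ]; positivity
  constructor
  · have := mul_pos hc key.1
    linarith
  · have := mul_le_mul_of_nonneg_left key.2 hc.le
    have e : σ * √ε * (4 / N / √ε) = 10 / N := by rw [σ]; field_simp; norm_num
    linarith

lemma meshY_reflect (h : IsAdmissible β ε N) {j : ℕ} (hj : 3 * N / 4 ≤ j) (hj' : j ≤ N) :
    meshY ε N j = 1 - meshY ε N (N - j) := by
  have := h.four_dvd
  rw [h.meshY_right hj, meshY_left (by omega : N - j ≤ N / 4), Nat.cast_sub hj', sub_div,
    div_self h.cast_pos.ne']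
  ring

lemma meshY_step (h : IsAdmissible β ε N) :
    ∀ j < N, 0 < meshY ε N (j + 1) - meshY ε N j ∧
      meshY ε N (j + 1) - meshY ε N j ≤ 10 / N := by
  intro j hj
  have := h.four_dvd
  rcases lt_or_ge j (N / 4) with h1 | h1
  · exact h.meshY_fine_step h1
  rcases lt_or_ge j (3 * N / 4) with h2 | h2
  · rw [h.meshY_middle_step h1 h2]
    have ht := h.transY_le
    have ht' := h.transY_pos
    exact ⟨div_pos (by linarith) h.cast_pos,
      div_le_div_of_nonneg_right (by linarith) h.cast_pos.le⟩
  · have := h.meshY_fine_step (j := N - (j + 1)) (by omega)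
    rw [show N - (j + 1) + 1 = N - j by omega] at this
    rw [h.meshY_reflect h2 hj.le, h.meshY_reflect (by omega) (by omega : j + 1 ≤ N)]
    exact ⟨by linarith [this.1], by linarith [this.2]⟩

lemma meshY_lt (h : IsAdmissible β ε N) : ∀ j < N, meshY ε N j < meshY ε N (j + 1) :=
  fun j hj => sub_pos.1 (h.meshY_step j hj).1

lemma middle_width_ge (h : IsAdmissible β ε N) : 1 / (N : ℝ) ≤ 2 * (1 - 2 * transY ε) / N :=
  div_le_div_of_nonneg_right (by linarith [h.transY_le]) h.cast_pos.le

lemma middle_width_le (h : IsAdmissible β ε N) : 2 * (1 - 2 * transY ε) / N ≤ 2 / (N : ℝ) :=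
  div_le_div_of_nonneg_right (by linarith [h.transY_pos]) h.cast_pos.le

/-! ### Asymptotic relations between `ε` and `N` -/

/-- With e = ε^{1/12} all the powers of ε needed become integer powers of e. Moreover ln(1/ε) = 12
ln(1/e) ≤ 12/e ≤ 12/e², where the square makes the later square roots explicit. -/
lemma root_facts (h : IsAdmissible β ε N) :
    ∃ e : ℝ, 0 < e ∧ e ≤ 1 ∧ e ^ 12 = ε ∧ e ^ 6 = √ε ∧ e ^ 3 = ε ^ (1 / 4 : ℝ) ∧
      Real.log (1 / ε) ≤ 12 / e ^ 2 := by
  have hε := h.eps_pos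
  have hε1 : ε ≤ 1 := by linarith [h.eps_le_quarter]
  refine ⟨ε ^ (1 / 12 : ℝ), Real.rpow_pos_of_pos hε _,
    Real.rpow_le_one hε.le hε1 (by norm_num), ?_, ?_, ?_, ?_⟩
  · rw [← Real.rpow_natCast, ← Real.rpow_mul hε.le]; norm_num
  · rw [← Real.rpow_natCast, ← Real.rpow_mul hε.le, Real.sqrt_eq_rpow]; norm_num
  · rw [← Real.rpow_natCast, ← Real.rpow_mul hε.le]; norm_num
  · set e := ε ^ (1 / 12 : ℝ) with he
    have he0 : 0 < e := Real.rpow_pos_of_pos hε _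
    have he1 : e ≤ 1 := Real.rpow_le_one hε.le hε1 (by norm_num)
    have e12 : ε = e ^ 12 := by
      rw [he, ← Real.rpow_natCast, ← Real.rpow_mul hε.le]; norm_num
    have h1 : Real.log (1 / ε) = 12 * Real.log (1 / e) := by
      rw [e12, one_div, one_div, Real.log_inv, Real.log_inv, Real.log_pow]; push_cast; ring
    have h2 := Real.log_le_sub_one_of_pos (one_div_pos.2 he0)
    have h3 : 1 / e ≤ 1 / e ^ 2 := by
      apply one_div_le_one_div_of_le (by positivity)
      nlinarith
    rw [h1]
    have : 12 / e ^ 2 = 12 * (1 / e ^ 2) := by ring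
    linarith

/-- Here x_{N/2} = O(e^{10}) and √(x_{N/2}/ε) = O(1/e), so their product is O(e⁹) = O(ε^{1/4} √ε),
and √ε ≤ N^{-1/2} gives the rate. The y-transition point is O(e⁴), so its product with x_{N/2}/ε is
O(e²). -/
lemma transition_bounds (h : IsAdmissible β ε N) (hβ : 0 < β) :
    (N : ℝ)⁻¹ * (transX β ε * √(transX β ε / ε)) ≤
        (30 / β) * √(30 / β) * (ε ^ (1 / 4 : ℝ) * (N : ℝ) ^ (-(3 / 2) : ℝ)) ∧
      transX β ε * √(transX β ε / ε) ≤ (30 / β) * √(30 / β) ∧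
      √(transY ε) * √(transX β ε / ε) ≤ √(450 / β) := by
  obtain ⟨e, he0, he1, e12, e6, e3, hl⟩ := h.root_facts
  have hN := h.cast_pos
  have hε := h.eps_pos
  have hlog := h.log_inv_pos
  have hX0 := h.transX_nonneg hβ
  have hq : transX β ε / ε ≤ 30 / β / e ^ 2 := by
    rw [h.transX_eq]
    have : 5 / (2 * β) * ε * Real.log (1 / ε) / ε = 5 / (2 * β) * Real.log (1 / ε) := by
      field_simp
    rw [this]
    calc _ ≤ 5 / (2 * β) * (12 / e ^ 2) := by gcongr
      _ = _ := by field_simp; norm_num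
  have hX : transX β ε ≤ 30 / β * e ^ 10 := by
    refine ((div_le_iff₀ hε).1 hq).trans (le_of_eq ?_)
    rw [← e12]
    field_simp
  have hs : √(transX β ε / ε) ≤ √(30 / β) / e := by
    refine (Real.sqrt_le_sqrt hq).trans (le_of_eq ?_)
    rw [Real.sqrt_div (by positivity), Real.sqrt_sq he0.le]
  have main : transX β ε * √(transX β ε / ε) ≤ (30 / β) * √(30 / β) * e ^ 9 := by
    calc _ ≤ 30 / β * e ^ 10 * (√(30 / β) / e) := by gcongr
      _ = _ := by field_simp
  refine ⟨?_, ?_, ?_⟩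
  · have h6 : e ^ 6 ≤ (N : ℝ) ^ (-(1 / 2) : ℝ) := by
      rw [e6, Real.rpow_neg hN.le, ← Real.sqrt_eq_rpow, ← Real.sqrt_inv]
      exact Real.sqrt_le_sqrt h.eps_le
    have e32 : (N : ℝ) ^ (-(3 / 2) : ℝ) = (N : ℝ)⁻¹ * (N : ℝ) ^ (-(1 / 2) : ℝ) := by
      rw [← Real.rpow_neg_one, ← Real.rpow_add hN]; norm_num
    rw [← e3, e32]
    calc _ ≤ (N : ℝ)⁻¹ * ((30 / β) * √(30 / β) * e ^ 9) := by gcongr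
      _ = (N : ℝ)⁻¹ * (30 / β) * √(30 / β) * e ^ 3 * e ^ 6 := by ring
      _ ≤ (N : ℝ)⁻¹ * (30 / β) * √(30 / β) * e ^ 3 * (N : ℝ) ^ (-(1 / 2) : ℝ) := by gcongr
      _ = _ := by ring
  · refine main.trans (mul_le_of_le_one_right (by positivity) (pow_le_one₀ he0.le he1))
  · have hY : transY ε ≤ 15 * e ^ 4 := by
      rw [h.transY_eq, ← e6]
      calc _ ≤ 5 / 4 * e ^ 6 * (12 / e ^ 2) := by gcongr
        _ = _ := by field_simp; norm_num
    rw [← Real.sqrt_mul h.transY_pos.le]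
    refine Real.sqrt_le_sqrt ?_
    calc _ ≤ 15 * e ^ 4 * (30 / β / e ^ 2) := by gcongr
      _ = 450 / β * e ^ 2 := by field_simp; norm_num
      _ ≤ _ := mul_le_of_le_one_right (by positivity) (pow_le_one₀ he0.le he1)

lemma one_le_sqrt_log (h : IsAdmissible β ε N) : 1 ≤ Real.log N ^ (1 / 2 : ℝ) := by
  refine Real.one_le_rpow ?_ (by norm_num)
  rw [Real.le_log_iff_exp_le h.cast_pos]
  linarith [Real.exp_one_lt_d9, h.cast_ge]

lemma sqrt_two_before (h : IsAdmissible β ε N) (hβ : 0 < β) :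
    √(meshX β ε N (N / 2 - 2) / ε) ≤ √(5 / (2 * β)) * Real.log N ^ (1 / 2 : ℝ) := by
  rw [← Real.sqrt_eq_rpow, ← Real.sqrt_mul (by positivity)]
  refine Real.sqrt_le_sqrt ?_
  rw [div_le_iff₀ h.eps_pos]
  exact (h.meshX_two_before hβ).trans (le_of_eq (by ring))

end IsAdmissible

end Bakhvalov

namespace Bakhvalov

/-! ### The finite element space -/

/-- Cauchy–Schwarz in variance form: expand 0 ≤ ∫ (m|g| - A)² and divide by the total mass m,
treating m = 0 apart. -/
lemma sq_integral_abs_le {α : Type*} [MeasurableSpace α] (μ : Measure α) [IsFiniteMeasure μ]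
    {g : α → ℝ} (hg : Integrable g μ) (hg2 : Integrable (fun x => g x ^ 2) μ) :
    (∫ x, |g x| ∂μ) ^ 2 ≤ μ.real univ * ∫ x, g x ^ 2 ∂μ := by
  set A := ∫ x, |g x| ∂μ
  set m := μ.real univ
  have hm : 0 ≤ m := measureReal_nonneg
  have h : 0 ≤ ∫ x, (m * |g x| - A) ^ 2 ∂μ := integral_nonneg fun x => sq_nonneg _
  have e : ∀ x, (m * |g x| - A) ^ 2 = m ^ 2 * g x ^ 2 - 2 * m * A * |g x| + A ^ 2 := fun x => by
    rw [← sq_abs (g x)]; ring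
  simp only [e] at h
  rw [integral_add (by fun_prop) (by fun_prop), integral_sub (by fun_prop) (by fun_prop),
    integral_const_mul, integral_const_mul, integral_const, smul_eq_mul] at h
  change 0 ≤ m ^ 2 * (∫ x, g x ^ 2 ∂μ) - 2 * m * A * A + m * A ^ 2 at h
  rcases hm.eq_or_lt with h0 | h0
  · have hz : μ = 0 := by
      have : μ.real univ = 0 := h0.symm
      rwa [measureReal_eq_zero_iff, Measure.measure_univ_eq_zero] at this
    have : A = 0 := by simp only [A, hz, integral_zero_measure]
    rw [this, ← h0]; simp
  · refine le_of_mul_le_mul_left ?_ h0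
    linarith

lemma integral_abs_le_sqrt {c d : ℝ} (hcd : c ≤ d) {g : ℝ → ℝ} (hg : ContinuousOn g (Icc c d)) :
    ∫ y in c..d, |g y| ≤ √(d - c) * √(∫ y in c..d, g y ^ 2) := by
  have h1 : IntegrableOn g (Ioc c d) := hg.integrableOn_Icc.mono_set Ioc_subset_Icc_self
  have h2 : IntegrableOn (fun y => g y ^ 2) (Ioc c d) :=
    (hg.pow 2).integrableOn_Icc.mono_set Ioc_subset_Icc_self
  have := sq_integral_abs_le (volume.restrict (Ioc c d)) h1 h2
  rw [measureReal_restrict_apply_univ, Real.volume_real_Ioc_of_le hcd,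
    ← intervalIntegral.integral_of_le hcd, ← intervalIntegral.integral_of_le hcd] at this
  rw [← Real.sqrt_mul (by linarith)]
  exact Real.le_sqrt_of_sq_le this

namespace IsAdmissible

variable {β ε : ℝ} {N : ℕ}

lemma meshX_mem (h : IsAdmissible β ε N) (hβ : 0 < β) {i : ℕ} (hi : i ≤ N) :
    meshX β ε N i ∈ Icc (0 : ℝ) 1 := by
  constructor
  · rw [← meshX_zero (β := β) (ε := ε) (N := N)]
    exact mesh_le (h.meshX_lt hβ) (Nat.zero_le i) hi
  · rw [← h.meshX_last]; exact mesh_le (h.meshX_lt hβ) hi le_rfl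

lemma meshY_mem (h : IsAdmissible β ε N) {i : ℕ} (hi : i ≤ N) :
    meshY ε N i ∈ Icc (0 : ℝ) 1 := by
  constructor
  · rw [← meshY_zero (ε := ε) (N := N)]
    exact mesh_le h.meshY_lt (Nat.zero_le i) hi
  · rw [← h.meshY_last]; exact mesh_le h.meshY_lt hi le_rfl

lemma cellX_subset (h : IsAdmissible β ε N) (hβ : 0 < β) {i : ℕ} (hi : i < N) :
    Icc (meshX β ε N i) (meshX β ε N (i + 1)) ⊆ Icc (0 : ℝ) 1 :=
  Icc_subset_Icc (h.meshX_mem hβ hi.le).1 (h.meshX_mem hβ hi).2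

lemma cellY_subset (h : IsAdmissible β ε N) {i : ℕ} (hi : i < N) :
    Icc (meshY ε N i) (meshY ε N (i + 1)) ⊆ Icc (0 : ℝ) 1 :=
  Icc_subset_Icc (h.meshY_mem hi.le).1 (h.meshY_mem hi).2

lemma exists_cellX (h : IsAdmissible β ε N) {x : ℝ} (hx : x ∈ Icc (0 : ℝ) 1) :
    ∃ i < N, x ∈ Icc (meshX β ε N i) (meshX β ε N (i + 1)) := by
  rw [← meshX_zero (β := β) (ε := ε) (N := N), ← h.meshX_last] at hx
  obtain ⟨i, -, hi, hxi⟩ := exists_cell (by have := h.four_le; omega) hx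
  exact ⟨i, hi, hxi⟩

lemma exists_cellY (h : IsAdmissible β ε N) {y : ℝ} (hy : y ∈ Icc (0 : ℝ) 1) :
    ∃ j < N, y ∈ Icc (meshY ε N j) (meshY ε N (j + 1)) := by
  rw [← meshY_zero (ε := ε) (N := N), ← h.meshY_last] at hy
  obtain ⟨i, -, hi, hxi⟩ := exists_cell (by have := h.four_le; omega) hy
  exact ⟨i, hi, hxi⟩

end IsAdmissible

section Fem

variable {β ε : ℝ} {N : ℕ} {v : ℝ × ℝ → ℝ}

lemma fem_linear_x (h : IsAdmissible β ε N) (hβ : 0 < β) (hv : v ∈ femSpace β ε N) {y : ℝ}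
    (hy : y ∈ Icc (0 : ℝ) 1) {i : ℕ} (hi : i < N) :
    ∃ s, ∀ x ∈ Icc (meshX β ε N i) (meshX β ε N (i + 1)),
      v (x, y) = v (meshX β ε N i, y) + s * (x - meshX β ε N i) := by
  obtain ⟨j, hj, hyj⟩ := h.exists_cellY hy
  obtain ⟨a, b, c, d, habcd⟩ := hv.2.2 i hi j hj
  refine ⟨b + d * y, fun x hx => ?_⟩
  rw [habcd (x, y) ⟨hx, hyj⟩,
    habcd (meshX β ε N i, y) ⟨left_mem_Icc.2 (h.meshX_lt hβ i hi).le, hyj⟩]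
  ring

lemma fem_linear_y (h : IsAdmissible β ε N) (hv : v ∈ femSpace β ε N) {x : ℝ}
    (hx : x ∈ Icc (0 : ℝ) 1) {j : ℕ} (hj : j < N) :
    ∃ s, ∀ y ∈ Icc (meshY ε N j) (meshY ε N (j + 1)),
      v (x, y) = v (x, meshY ε N j) + s * (y - meshY ε N j) := by
  obtain ⟨i, hi, hxi⟩ := h.exists_cellX hx
  obtain ⟨a, b, c, d, habcd⟩ := hv.2.2 i hi j hj
  refine ⟨c + d * x, fun y hy => ?_⟩
  rw [habcd (x, y) ⟨hxi, hy⟩,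
    habcd (x, meshY ε N j) ⟨hxi, left_mem_Icc.2 (h.meshY_lt j hj).le⟩]
  ring

lemma fem_left (hv : v ∈ femSpace β ε N) {y : ℝ} (hy : y ∈ Icc (0 : ℝ) 1) : v (0, y) = 0 :=
  hv.2.1 (0, y) ⟨by simp, hy⟩ (by simp [Om])

lemma fem_right (hv : v ∈ femSpace β ε N) {y : ℝ} (hy : y ∈ Icc (0 : ℝ) 1) : v (1, y) = 0 :=
  hv.2.1 (1, y) ⟨by simp, hy⟩ (by simp [Om])

lemma continuousOn_slice_x {w : ℝ × ℝ → ℝ} (hw : ContinuousOn w OmBar) {y : ℝ}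
    (hy : y ∈ Icc (0 : ℝ) 1) : ContinuousOn (fun x => w (x, y)) (Icc 0 1) :=
  hw.comp (by fun_prop) fun x hx => ⟨hx, hy⟩

lemma continuousOn_slice_y {w : ℝ × ℝ → ℝ} (hw : ContinuousOn w OmBar) {x : ℝ}
    (hx : x ∈ Icc (0 : ℝ) 1) : ContinuousOn (fun y => w (x, y)) (Icc 0 1) :=
  hw.comp (by fun_prop) fun y hy => ⟨hx, hy⟩

/-- The slope of `v` in the `x`-direction on the strip `i`. -/
noncomputable def stripSlope (β ε : ℝ) (N : ℕ) (v : ℝ × ℝ → ℝ) (i : ℕ) (y : ℝ) : ℝ :=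
  (v (meshX β ε N (i + 1), y) - v (meshX β ε N i, y)) / (meshX β ε N (i + 1) - meshX β ε N i)

lemma derivWithin_of_affine {a b p s x : ℝ} {g : ℝ → ℝ} (hab : Icc a b ⊆ Icc (0 : ℝ) 1)
    (hx : x ∈ Ioo a b) (hg : ∀ z ∈ Icc a b, g z = p + s * (z - a)) :
    derivWithin g (Icc 0 1) x = (g b - g a) / (b - a) := by
  have hlt := hx.1.trans hx.2
  have hx' : Icc a b ∈ nhds x := Icc_mem_nhds hx.1 hx.2
  have hd : HasDerivAt g s x := by
    have h1 : HasDerivAt (fun z => p + s * (z - a)) s x := by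
      simpa using (((hasDerivAt_id x).sub_const a).const_mul s).const_add p
    exact h1.congr_of_eventuallyEq (Filter.eventually_of_mem hx' hg)
  rw [hd.hasDerivWithinAt.derivWithin
    (uniqueDiffOn_Icc zero_lt_one x (hab (Ioo_subset_Icc_self hx))),
    hg b (right_mem_Icc.2 hlt.le), hg a (left_mem_Icc.2 hlt.le)]
  have := (sub_pos.2 hlt).ne'
  field_simp; ring

lemma pdx_fem (h : IsAdmissible β ε N) (hβ : 0 < β) (hv : v ∈ femSpace β ε N) {i : ℕ}
    (hi : i < N) {p : ℝ × ℝ}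
    (hp : p ∈ Ioo (meshX β ε N i) (meshX β ε N (i + 1)) ×ˢ Ioo (0 : ℝ) 1) :
    pdx v p = stripSlope β ε N v i p.2 := by
  obtain ⟨s, hs⟩ := fem_linear_x h hβ hv (Ioo_subset_Icc_self hp.2) hi
  exact derivWithin_of_affine (h.cellX_subset hβ hi) hp.1 hs

lemma continuousOn_stripSlope (h : IsAdmissible β ε N) (hβ : 0 < β) (hv : v ∈ femSpace β ε N)
    {i : ℕ} (hi : i < N) : ContinuousOn (stripSlope β ε N v i) (Icc 0 1) := by
  unfold stripSlope
  have h1 := continuousOn_slice_y hv.1 (h.meshX_mem hβ hi.le)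
  have h2 := continuousOn_slice_y hv.1 (h.meshX_mem hβ (Nat.succ_le_of_lt hi))
  exact (h2.sub h1).div_const _

lemma integral_pdx_sq (h : IsAdmissible β ε N) (hβ : 0 < β) (hv : v ∈ femSpace β ε N) :
    IntegrableOn (fun p => pdx v p ^ 2) Om ∧
      ∫ p in Om, pdx v p ^ 2 = ∑ i ∈ Finset.range N,
        (meshX β ε N (i + 1) - meshX β ε N i) * ∫ y in (0 : ℝ)..1, stripSlope β ε N v i y ^ 2 := by
  have key : ∀ i < N, _ := fun i hi => integral_rect (h.meshX_lt hβ i hi).le zero_le_one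
    (G := fun p => stripSlope β ε N v i p.2 ^ 2) (g := fun p => pdx v p ^ 2)
    (((continuousOn_stripSlope h hβ hv hi).comp continuousOn_snd fun p hp => hp.2).pow 2)
    (fun p hp => by rw [pdx_fem h hβ hv hi hp])
  have := integral_Om_eq_sum (h.meshX_lt hβ) IsAdmissible.meshX_zero h.meshX_last (fun i hi => (key i hi).1)
  refine ⟨this.1, this.2.trans (Finset.sum_congr rfl fun i hi => ?_)⟩
  rw [(key i (Finset.mem_range.1 hi)).2]
  simp only [intervalIntegral.integral_const, smul_eq_mul]
  rw [intervalIntegral.integral_const_mul]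

/-- Without this integrability, the integral of the sum in `energyNorm` could not be split. Swapping
the coordinates reduces the claim to vertical strips. -/
lemma integrableOn_pdy_sq (h : IsAdmissible β ε N) (hv : v ∈ femSpace β ε N) :
    IntegrableOn (fun p => pdy v p ^ 2) Om := by
  have hsw : MeasurePreserving (Prod.swap : ℝ × ℝ → ℝ × ℝ) volume volume :=
    Measure.measurePreserving_swap
  have hpre : (Prod.swap : ℝ × ℝ → ℝ × ℝ) ⁻¹' Om = Om := by
    ext p; simp [Om]
  rw [← hsw.integrableOn_comp_preimage MeasurableEquiv.prodComm.measurableEmbedding, hpre]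
  refine (integral_Om_eq_sum h.meshY_lt IsAdmissible.meshY_zero h.meshY_last fun j hj => ?_).1
  set G : ℝ × ℝ → ℝ := fun p => ((v (p.2, meshY ε N (j + 1)) - v (p.2, meshY ε N j)) /
    (meshY ε N (j + 1) - meshY ε N j)) ^ 2
  refine (integral_rect (h.meshY_lt j hj).le zero_le_one (G := G) ?_ fun p hp => ?_).1
  · have h1 := continuousOn_slice_x hv.1 (h.meshY_mem hj.le)
    have h2 := continuousOn_slice_x hv.1 (h.meshY_mem (Nat.succ_le_of_lt hj))
    exact ((((h2.sub h1).div_const (meshY ε N (j + 1) - meshY ε N j)).pow 2).comp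
      continuousOn_snd fun p hp => hp.2)
  · obtain ⟨s, hs⟩ := fem_linear_y h hv (Ioo_subset_Icc_self hp.2) hj
    have := derivWithin_of_affine (h.cellY_subset hj) hp.1 hs
    simp only [Function.comp, G, ← this]
    rfl

lemma energy_facts (h : IsAdmissible β ε N) (hβ : 0 < β) (hv : v ∈ femSpace β ε N) :
    ε * (∫ p in Om, pdx v p ^ 2) ≤ energyNorm ε v ^ 2 ∧
      ∫ p in Om, v p ^ 2 ≤ energyNorm ε v ^ 2 := by
  have hx : 0 ≤ ∫ p in Om, pdx v p ^ 2 := integral_nonneg fun p => sq_nonneg _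
  have hy : 0 ≤ ∫ p in Om, pdy v p ^ 2 := integral_nonneg fun p => sq_nonneg _
  have h0 : 0 ≤ ∫ p in Om, v p ^ 2 := integral_nonneg fun p => sq_nonneg _
  have hε := h.eps_pos
  have hx' := mul_nonneg hε.le hx
  have hy' := mul_nonneg hε.le hy
  rw [energyNorm, integral_add (integral_pdx_sq h hβ hv).1 (integrableOn_pdy_sq h hv),
    Real.sq_sqrt (by positivity)]
  constructor <;> linarith

/-- Trace inequality on a vertical mesh line, from the boundary `x = 0`. -/
lemma trace_from_boundary (h : IsAdmissible β ε N) (hβ : 0 < β) (hv : v ∈ femSpace β ε N)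
    {m : ℕ} (hm : m ≤ N) :
    ∫ y in (0 : ℝ)..1, v (meshX β ε N m, y) ^ 2 ≤
      meshX β ε N m / ε * energyNorm ε v ^ 2 := by
  set X := meshX β ε N
  have hXm := h.meshX_mem hβ hm
  have hX : ∀ i < N, 0 ≤ X (i + 1) - X i := fun i hi => (sub_pos.2 (h.meshX_lt hβ i hi)).le
  have ii : ∀ i < N, IntervalIntegrable (fun y => stripSlope β ε N v i y ^ 2) volume 0 1 :=
    fun i hi => ContinuousOn.intervalIntegrable (by
      rw [uIcc_of_le zero_le_one]; exact (continuousOn_stripSlope h hβ hv hi).pow 2)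
  have tel : ∀ k ≤ N, ∑ i ∈ Finset.range k, (X (i + 1) - X i) = X k := fun k _ => by
    rw [Finset.sum_range_sub]; simp [X, IsAdmissible.meshX_zero]
  have pt : ∀ y ∈ Icc (0 : ℝ) 1, v (X m, y) ^ 2 ≤
      X m * ∑ i ∈ Finset.range m, (X (i + 1) - X i) * stripSlope β ε N v i y ^ 2 := by
    intro y hy
    have e : v (X m, y) = ∑ i ∈ Finset.range m, (X (i + 1) - X i) * stripSlope β ε N v i y := by
      have : ∀ i ∈ Finset.range m, (X (i + 1) - X i) * stripSlope β ε N v i y =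
          v (X (i + 1), y) - v (X i, y) := fun i hi => by
        have := (sub_pos.2 (h.meshX_lt hβ i
          ((Finset.mem_range.1 hi).trans_le hm))).ne'
        rw [stripSlope]; exact mul_div_cancel₀ _ this
      rw [Finset.sum_congr rfl this, Finset.sum_range_sub (fun i => v (X i, y))]
      have h0 : X 0 = 0 := IsAdmissible.meshX_zero
      rw [h0, fem_left hv hy, sub_zero]
    rw [e]
    -- Weighted Cauchy–Schwarz, with the cell widths as weights; they sum to x_m.
    conv_rhs => rw [← tel m hm]
    refine Finset.sum_sq_le_sum_mul_sum_of_sq_le_mul _ (fun i hi => hX i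
      ((Finset.mem_range.1 hi).trans_le hm)) (fun i hi => mul_nonneg (hX i
      ((Finset.mem_range.1 hi).trans_le hm)) (sq_nonneg _)) fun i _ => le_of_eq (by ring)
  have hsum : ∫ y in (0 : ℝ)..1, v (X m, y) ^ 2 ≤ X m * ∑ i ∈ Finset.range m,
      (X (i + 1) - X i) * ∫ y in (0 : ℝ)..1, stripSlope β ε N v i y ^ 2 := by
    have hii : ∀ i ∈ Finset.range m, IntervalIntegrable
        (fun y => (X (i + 1) - X i) * stripSlope β ε N v i y ^ 2) volume 0 1 := fun i hi =>
      (ii i ((Finset.mem_range.1 hi).trans_le hm)).const_mul _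
    simp only [← intervalIntegral.integral_const_mul]
    rw [← intervalIntegral.integral_finsetSum (by
      simpa using hii), ← intervalIntegral.integral_const_mul]
    refine intervalIntegral.integral_mono_on zero_le_one ?_ ?_ pt
    · refine ContinuousOn.intervalIntegrable ?_
      rw [uIcc_of_le zero_le_one]
      exact (continuousOn_slice_y hv.1 hXm).pow 2
    · refine IntervalIntegrable.const_mul ?_ _
      have e : (fun y => ∑ i ∈ Finset.range m, (X (i + 1) - X i) * stripSlope β ε N v i y ^ 2) =
          ∑ i ∈ Finset.range m, fun y => (X (i + 1) - X i) * stripSlope β ε N v i y ^ 2 := by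
        ext y; simp
      rw [e]
      exact IntervalIntegrable.sum (Finset.range m) hii
  have hmono : ∑ i ∈ Finset.range m,
      (X (i + 1) - X i) * (∫ y in (0 : ℝ)..1, stripSlope β ε N v i y ^ 2) ≤
      ∫ p in Om, pdx v p ^ 2 := by
    rw [(integral_pdx_sq h hβ hv).2]
    refine Finset.sum_le_sum_of_subset_of_nonneg
      (fun i hi => by simp only [Finset.mem_range] at hi ⊢; omega) fun i hi _ => ?_
    exact mul_nonneg (hX i (Finset.mem_range.1 hi))
      (intervalIntegral.integral_nonneg zero_le_one fun y _ => sq_nonneg _)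
  calc _ ≤ X m * ∫ p in Om, pdx v p ^ 2 := hsum.trans (mul_le_mul_of_nonneg_left hmono hXm.1)
    _ = X m / ε * (ε * ∫ p in Om, pdx v p ^ 2) := by
        have := h.eps_pos.ne'
        field_simp
    _ ≤ _ := mul_le_mul_of_nonneg_left (energy_facts h hβ hv).1
        (div_nonneg hXm.1 h.eps_pos.le)

lemma energyNorm_nonneg : 0 ≤ energyNorm ε v := Real.sqrt_nonneg _

lemma integral_sq_mono {g : ℝ → ℝ} (hg : ContinuousOn g (Icc 0 1)) {c d : ℝ} (hc : 0 ≤ c)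
    (hcd : c ≤ d) (hd : d ≤ 1) : ∫ y in c..d, g y ^ 2 ≤ ∫ y in (0 : ℝ)..1, g y ^ 2 := by
  refine intervalIntegral.integral_mono_interval hc hcd hd
    (Filter.Eventually.of_forall fun y => sq_nonneg _) (ContinuousOn.intervalIntegrable ?_)
  rw [uIcc_of_le zero_le_one]; exact hg.pow 2

/-- The factor √(d - c) is kept for the thin strips next to y = 0 and y = 1. -/
lemma trace_L1 (h : IsAdmissible β ε N) (hβ : 0 < β) (hv : v ∈ femSpace β ε N)
    {m : ℕ} (hm : m ≤ N) {c d : ℝ} (hc : 0 ≤ c) (hcd : c ≤ d) (hd : d ≤ 1) :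
    ∫ y in c..d, |v (meshX β ε N m, y)| ≤
      √(d - c) * √(meshX β ε N m / ε) * energyNorm ε v := by
  have hcont := continuousOn_slice_y hv.1 (h.meshX_mem hβ hm)
  refine (integral_abs_le_sqrt hcd (hcont.mono (Icc_subset_Icc hc hd))).trans ?_
  rw [mul_assoc]
  refine mul_le_mul_of_nonneg_left ?_ (Real.sqrt_nonneg _)
  rw [← Real.sqrt_sq (energyNorm_nonneg (ε := ε) (v := v)),
    ← Real.sqrt_mul (div_nonneg (h.meshX_mem hβ hm).1 h.eps_pos.le)]
  exact Real.sqrt_le_sqrt ((integral_sq_mono hcont hc hcd hd).trans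
    (trace_from_boundary h hβ hv hm))

/-- On each cell |v| is at most the sum of its two end values. Every vertical mesh line in the layer
satisfies the trace bound, and the widths sum to x_{N/2}. -/
lemma integral_fine_le (h : IsAdmissible β ε N) (hβ : 0 < β) (hv : v ∈ femSpace β ε N) :
    ∫ y in (0 : ℝ)..1, ∫ x in (0 : ℝ)..transX β ε, |v (x, y)| ≤
      2 * (transX β ε * √(transX β ε / ε)) * energyNorm ε v := by
  set X := meshX β ε N
  have hn : N / 2 ≤ N := Nat.div_le_self _ _
  have hX0 : X 0 = 0 := IsAdmissible.meshX_zero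
  have hXn : X (N / 2) = transX β ε := h.meshX_half
  have hXN : X N = 1 := h.meshX_last
  have pt : ∀ y ∈ Icc (0 : ℝ) 1, ∫ x in (0 : ℝ)..transX β ε, |v (x, y)| ≤
      ∑ i ∈ Finset.Ico 0 (N / 2), (X (i + 1) - X i) * (|v (X i, y)| + |v (X (i + 1), y)|) := by
    intro y hy
    have hc := (continuousOn_slice_x hv.1 hy).abs
    have hc' := hc
    rw [← hX0, ← hXN] at hc'
    rw [← hXn, ← hX0, ← sum_integral_cells (h.meshX_lt hβ) hc' (Nat.zero_le _) hn]
    refine Finset.sum_le_sum fun i hi => ?_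
    have hi : i < N := (Finset.mem_Ico.1 hi).2.trans_le hn
    obtain ⟨s, hs⟩ := fem_linear_x h hβ hv hy hi
    have hlt := h.meshX_lt hβ i hi
    have h0 := sub_pos.2 hlt
    calc _ ≤ ∫ x in X i..X (i + 1), (|v (X i, y)| + |v (X (i + 1), y)|) := by
          refine intervalIntegral.integral_mono_on hlt.le ?_ (by simp) fun x hx => ?_
          · refine ContinuousOn.intervalIntegrable ?_
            rw [uIcc_of_le hlt.le]; exact hc.mono (h.cellX_subset hβ hi)
          · have e1 := hs x hx
            have e2 := hs _ (right_mem_Icc.2 hlt.le)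
            set r := (x - X i) / (X (i + 1) - X i) with hr
            have hr0 : 0 ≤ r := div_nonneg (by linarith [hx.1]) h0.le
            have hr1 : r ≤ 1 := (div_le_one h0).2 (by linarith [hx.2])
            have e3 : v (x, y) = (1 - r) * v (X i, y) + r * v (X (i + 1), y) := by
              have : r * (X (i + 1) - X i) = x - X i := div_mul_cancel₀ _ h0.ne'
              rw [e1, e2]; linear_combination (-s) * this
            rw [e3]
            refine (abs_add_le _ _).trans ?_
            rw [abs_mul, abs_mul, abs_of_nonneg hr0, abs_of_nonneg (by linarith : 0 ≤ 1 - r)]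
            have g1 := mul_le_of_le_one_left (abs_nonneg (v (X i, y))) (by linarith : 1 - r ≤ 1)
            have g2 := mul_le_of_le_one_left (abs_nonneg (v (X (i + 1), y))) hr1
            exact add_le_add g1 g2
      _ = _ := by rw [intervalIntegral.integral_const, smul_eq_mul]
  have ci : ∀ i ≤ N, IntervalIntegrable (fun y => |v (X i, y)|) volume 0 1 := fun i hi => by
    refine ContinuousOn.intervalIntegrable ?_
    rw [uIcc_of_le zero_le_one]
    exact (continuousOn_slice_y hv.1 (h.meshX_mem hβ hi)).abs
  have cs : ∀ i ∈ Finset.Ico 0 (N / 2), IntervalIntegrable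
      (fun y => (X (i + 1) - X i) * (|v (X i, y)| + |v (X (i + 1), y)|)) volume 0 1 := fun i hi => by
    have hi : i < N := (Finset.mem_Ico.1 hi).2.trans_le hn
    exact ((ci i hi.le).add (ci (i + 1) hi)).const_mul _
  have htX := h.meshX_mem hβ hn
  rw [h.meshX_half] at htX
  calc _ ≤ ∫ y in (0 : ℝ)..1, ∑ i ∈ Finset.Ico 0 (N / 2),
        (X (i + 1) - X i) * (|v (X i, y)| + |v (X (i + 1), y)|) := by
        refine intervalIntegral.integral_mono_on zero_le_one ?_ ?_ pt
        · refine intervalIntegrable_slice htX.1 zero_le_one (G := fun p => |v p|) ?_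
          exact (hv.1.mono (prod_mono (Icc_subset_Icc le_rfl htX.2) Subset.rfl)).abs
        · have e : (fun y => ∑ i ∈ Finset.Ico 0 (N / 2),
                (X (i + 1) - X i) * (|v (X i, y)| + |v (X (i + 1), y)|)) =
              ∑ i ∈ Finset.Ico 0 (N / 2), fun y =>
                (X (i + 1) - X i) * (|v (X i, y)| + |v (X (i + 1), y)|) := by
            ext y; simp
          rw [e]
          exact IntervalIntegrable.sum (Finset.Ico 0 (N / 2)) cs
    _ = ∑ i ∈ Finset.Ico 0 (N / 2), (X (i + 1) - X i) *
        ((∫ y in (0 : ℝ)..1, |v (X i, y)|) + ∫ y in (0 : ℝ)..1, |v (X (i + 1), y)|) := by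
        rw [intervalIntegral.integral_finsetSum cs]
        refine Finset.sum_congr rfl fun i hi => ?_
        have hi : i < N := (Finset.mem_Ico.1 hi).2.trans_le hn
        rw [intervalIntegral.integral_const_mul,
          intervalIntegral.integral_add (ci i hi.le) (ci (i + 1) hi)]
    _ ≤ ∑ i ∈ Finset.Ico 0 (N / 2), (X (i + 1) - X i) *
        (2 * (√(transX β ε / ε) * energyNorm ε v)) := by
        refine Finset.sum_le_sum fun i hi => ?_
        have hin := (Finset.mem_Ico.1 hi).2
        have hi : i < N := hin.trans_le hn
        have tr : ∀ m ≤ N / 2, ∫ y in (0 : ℝ)..1, |v (X m, y)| ≤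
            √(transX β ε / ε) * energyNorm ε v := fun m hm => by
          refine (trace_L1 h hβ hv (hm.trans hn) le_rfl zero_le_one le_rfl).trans ?_
          rw [sub_zero, Real.sqrt_one, one_mul]
          refine mul_le_mul_of_nonneg_right (Real.sqrt_le_sqrt ?_) energyNorm_nonneg
          refine div_le_div_of_nonneg_right ?_ h.eps_pos.le
          rw [← hXn]; exact mesh_le (h.meshX_lt hβ) hm hn
        refine mul_le_mul_of_nonneg_left ?_ (sub_pos.2 (h.meshX_lt hβ i hi)).le
        linarith [tr i hin.le, tr (i + 1) hin]
    _ = _ := by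
        rw [← Finset.sum_mul, ← Finset.range_eq_Ico, Finset.sum_range_sub, hX0, hXn]; ring

lemma integrableOn_Om {w : ℝ × ℝ → ℝ} (hw : ContinuousOn w OmBar) : IntegrableOn w Om :=
  (hw.integrableOn_compact isCompact_OmBar).mono_set
    (prod_mono Ioo_subset_Icc_self Ioo_subset_Icc_self)

lemma integral_abs_le_energy (h : IsAdmissible β ε N) (hβ : 0 < β) (hv : v ∈ femSpace β ε N) :
    ∫ y in (0 : ℝ)..1, ∫ x in (0 : ℝ)..1, |v (x, y)| ≤ energyNorm ε v := by
  have e := (integral_rect zero_le_one zero_le_one (G := fun p => |v p|) (g := fun p => |v p|)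
    hv.1.abs (fun _ _ => rfl)).2
  rw [← e]
  have hvol : (volume.restrict Om).real univ = 1 := by
    rw [measureReal_restrict_apply_univ, Om, Measure.volume_eq_prod, measureReal_prod_prod]
    simp
  have : IsFiniteMeasure (volume.restrict Om) := ⟨by
    rw [Measure.restrict_apply_univ, Om, Measure.volume_eq_prod, Measure.prod_prod]
    simp⟩
  have h1 := sq_integral_abs_le (volume.restrict Om) (integrableOn_Om hv.1)
    (integrableOn_Om (hv.1.pow 2))
  rw [hvol, one_mul] at h1
  exact le_of_sq_le_sq (h1.trans (energy_facts h hβ hv).2) energyNorm_nonneg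

/-- Trace inequality on the line `x = x_{N/2}`, from the coarse side. -/
lemma trace_from_coarse (h : IsAdmissible β ε N) (hβ : 0 < β) (hv : v ∈ femSpace β ε N) :
    ∫ y in (0 : ℝ)..1, v (transX β ε, y) ^ 2 ≤ 4 * N * energyNorm ε v ^ 2 := by
  set X := meshX β ε N
  have hn : N / 2 < N := by have := h.four_le; omega
  have hlt := h.meshX_lt hβ _ hn
  have hXn : X (N / 2) = transX β ε := h.meshX_half
  have hsub : Icc (X (N / 2)) (X (N / 2 + 1)) ×ˢ Icc (0 : ℝ) 1 ⊆ OmBar :=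
    prod_mono (h.cellX_subset hβ hn) Subset.rfl
  have e := (integral_rect hlt.le zero_le_one (G := fun p => v p ^ 2) (g := fun p => v p ^ 2)
    ((hv.1.mono hsub).pow 2) (fun _ _ => rfl)).2
  have hOm : ∫ p in Ioo (X (N / 2)) (X (N / 2 + 1)) ×ˢ Ioo (0 : ℝ) 1, v p ^ 2 ≤
      ∫ p in Om, v p ^ 2 := by
    refine setIntegral_mono_set (integrableOn_Om (hv.1.pow 2))
      (Filter.Eventually.of_forall fun p => sq_nonneg _) (Filter.Eventually.of_forall ?_)
    exact prod_mono (Ioo_subset_Ioo (h.meshX_mem hβ hn.le).1 (h.meshX_mem hβ hn).2) Subset.rfl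
  have pt : ∀ y ∈ Icc (0 : ℝ) 1, v (transX β ε, y) ^ 2 ≤
      4 * N * ∫ x in X (N / 2)..X (N / 2 + 1), v (x, y) ^ 2 := by
    intro y hy
    obtain ⟨s, hs⟩ := fem_linear_x h hβ hv hy hn
    have e1 : ∫ x in X (N / 2)..X (N / 2 + 1), v (x, y) ^ 2 =
        ∫ x in X (N / 2)..X (N / 2 + 1), (v (X (N / 2), y) + s * (x - X (N / 2))) ^ 2 :=
      intervalIntegral.integral_congr (by
        rw [uIcc_of_le hlt.le]; intro x hx; simp only [hs x hx, X])
    -- Inverse inequality on the first coarse cell, whose width is at least 1/N; this yields the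
    -- factor 4N.
    have h1 := mul_sq_left_le hlt.le (v (X (N / 2), y)) s
    rw [← e1] at h1
    have h3 := mul_le_mul_of_nonneg_right h.coarse_width_ge (sq_nonneg (v (X (N / 2), y)))
    have h4 := h3.trans h1
    rw [one_div, inv_mul_le_iff₀ h.cast_pos] at h4
    rw [← hXn]
    linarith
  calc _ ≤ ∫ y in (0 : ℝ)..1, 4 * N * ∫ x in X (N / 2)..X (N / 2 + 1), v (x, y) ^ 2 := by
        refine intervalIntegral.integral_mono_on zero_le_one ?_ ?_ pt
        · refine ContinuousOn.intervalIntegrable ?_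
          rw [uIcc_of_le zero_le_one, ← hXn]
          exact (continuousOn_slice_y hv.1 (h.meshX_mem hβ hn.le)).pow 2
        · exact (intervalIntegrable_slice hlt.le zero_le_one (G := fun p => v p ^ 2)
            ((hv.1.mono hsub).pow 2)).const_mul _
    _ = 4 * N * ∫ p in Ioo (X (N / 2)) (X (N / 2 + 1)) ×ˢ Ioo (0 : ℝ) 1, v p ^ 2 := by
        rw [intervalIntegral.integral_const_mul, e]
    _ ≤ _ := by
        have := h.cast_pos
        exact mul_le_mul_of_nonneg_left (hOm.trans (energy_facts h hβ hv).2) (by positivity)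

/-- The alternative to `trace_L1` on the transition line: it costs √N instead of √(x_{N/2}/ε),
independently of ε. -/
lemma trace_L1_coarse (h : IsAdmissible β ε N) (hβ : 0 < β) (hv : v ∈ femSpace β ε N)
    {c d : ℝ} (hc : 0 ≤ c) (hcd : c ≤ d) (hd : d ≤ 1) :
    ∫ y in c..d, |v (transX β ε, y)| ≤ √(d - c) * (2 * √N) * energyNorm ε v := by
  have hm := h.meshX_mem hβ (Nat.div_le_self N 2)
  rw [h.meshX_half] at hm
  have hcont := continuousOn_slice_y hv.1 hm
  refine (integral_abs_le_sqrt hcd (hcont.mono (Icc_subset_Icc hc hd))).trans ?_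
  rw [mul_assoc]
  refine mul_le_mul_of_nonneg_left ?_ (Real.sqrt_nonneg _)
  refine (Real.sqrt_le_sqrt ((integral_sq_mono hcont hc hcd hd).trans
    (trace_from_coarse h hβ hv))).trans (le_of_eq ?_)
  have := h.cast_pos
  rw [Real.sqrt_mul (by positivity), Real.sqrt_mul (by norm_num), Real.sqrt_sq energyNorm_nonneg,
    show (4 : ℝ) = 2 ^ 2 by norm_num, Real.sqrt_sq (by norm_num)]

end Fem

end Bakhvalov

namespace Bakhvalov

/-! ### The interpolant `𝒫S`: representation by a correction of the Lagrange interpolant -/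

section Transition

/-- The piecewise linear interpolant of `S(x_i, ·)` on the mesh in the `y`-direction. -/
noncomputable def nodal (β ε : ℝ) (N : ℕ) (S : ℝ × ℝ → ℝ) (i : ℕ) : ℝ → ℝ :=
  pl (meshY ε N) N fun j => S (meshX β ε N i, meshY ε N j)

/-- The nodal values of `S - P` on the line `x = x_{N/2-1}`, in the interior nodes. -/
noncomputable def corr (β ε : ℝ) (N : ℕ) (S P : ℝ × ℝ → ℝ) (j : ℕ) : ℝ :=
  if N / 4 < j ∧ j < 3 * N / 4 then
    S (meshX β ε N (N / 2 - 1), meshY ε N j) - P (meshX β ε N (N / 2 - 1), meshY ε N j)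
  else 0

/-- The weighted mean over the strip `N/2 - 1` of the error of the Lagrange interpolant. -/
noncomputable def stripMean (β ε : ℝ) (N : ℕ) (S : ℝ × ℝ → ℝ) (y : ℝ) : ℝ :=
  ∫ x in meshX β ε N (N / 2 - 1)..meshX β ε N (N / 2),
    (pdx S (x, y) - (nodal β ε N S (N / 2) y - nodal β ε N S (N / 2 - 1) y) /
        (meshX β ε N (N / 2) - meshX β ε N (N / 2 - 1))) *
      ((x - meshX β ε N (N / 2 - 1)) / (meshX β ε N (N / 2) - meshX β ε N (N / 2 - 1)))

variable {β ε M : ℝ} {N : ℕ} {S P : ℝ × ℝ → ℝ}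

lemma IsAdmissible.pl_continuousOn (h : IsAdmissible β ε N) (c : ℕ → ℝ) :
    ContinuousOn (pl (meshY ε N) N c) (Icc 0 1) := by
  have := Bakhvalov.pl_continuousOn h.meshY_lt c le_rfl
  rwa [IsAdmissible.meshY_zero, h.meshY_last] at this

lemma hat_eq_pl {t : ℕ → ℝ} {j : ℕ} (hj : j ≤ N) : hat t j = pl t N (Pi.single j 1) := by
  ext s
  rw [pl, Finset.sum_eq_single j]
  · simp
  · intro a _ ha; simp [ha]
  · intro hj'; simp at hj'; omega

lemma IsAdmissible.hat_continuousOn (h : IsAdmissible β ε N) {j : ℕ} (hj : j ≤ N) :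
    ContinuousOn (hat (meshY ε N) j) (Icc 0 1) := by
  rw [hat_eq_pl hj]; exact h.pl_continuousOn _

lemma IsAdmissible.abs_hat_le (h : IsAdmissible β ε N) {j : ℕ} (hj : j ≤ N) {y : ℝ}
    (hy : y ∈ Icc (0 : ℝ) 1) : |hat (meshY ε N) j y| ≤ 1 := by
  rw [hat_eq_pl hj]
  rw [← IsAdmissible.meshY_zero (ε := ε) (N := N), ← h.meshY_last] at hy
  refine abs_pl_le h.meshY_lt (by have := h.four_le; omega) (fun i _ => ?_) hy
  by_cases hi : i = j
  · subst hi; simp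
  · simp [hi]

lemma nodal_increment (h : IsAdmissible β ε N) (hβ : 0 < β) (hS : SmoothBound M S) {i : ℕ}
    (hi : i < N) {y : ℝ} (hy : y ∈ Icc (0 : ℝ) 1) :
    |(S (meshX β ε N (i + 1), y) - S (meshX β ε N i, y)) -
        (nodal β ε N S (i + 1) y - nodal β ε N S i y)|
      ≤ M * (10 / N) ^ 2 * (meshX β ε N (i + 1) - meshX β ε N i) := by
  obtain ⟨j, hj, hyj⟩ := h.exists_cellY hy
  have hx := sub_pos.2 (h.meshX_lt hβ i hi)
  have := hS.interp_increment (h.meshX_mem hβ hi.le) (h.meshX_mem hβ (Nat.succ_le_of_lt hi))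
    (h.meshY_mem hj.le).1 (h.meshY_mem (Nat.succ_le_of_lt hj)).2 (h.meshY_lt j hj) hyj
  rw [nodal, nodal, pl_eq h.meshY_lt hj hyj, pl_eq h.meshY_lt hj hyj]
  have hk := h.meshY_step j hj
  have hM := hS.nonneg
  rw [abs_of_pos hx] at this
  calc _ = _ := by congr 1; ring
    _ ≤ _ := this
    _ ≤ M * (meshX β ε N (i + 1) - meshX β ε N i) * (10 / N) ^ 2 := by
        refine mul_le_mul_of_nonneg_left (pow_le_pow_left₀ hk.1.le hk.2 2) (by positivity)
    _ = _ := by ring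

/-- Bound for the derivative of the error of the Lagrange interpolant. -/
lemma abs_deriv_error_le (h : IsAdmissible β ε N) (hβ : 0 < β) (hS : SmoothBound M S) {i : ℕ}
    (hi : i < N) {x y : ℝ} (hx : x ∈ Icc (meshX β ε N i) (meshX β ε N (i + 1)))
    (hy : y ∈ Icc (0 : ℝ) 1) :
    |pdx S (x, y) - (nodal β ε N S (i + 1) y - nodal β ε N S i y) /
        (meshX β ε N (i + 1) - meshX β ε N i)|
      ≤ M * (meshX β ε N (i + 1) - meshX β ε N i) + M * (10 / N) ^ 2 := by
  set a := meshX β ε N i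
  set b := meshX β ε N (i + 1)
  have hab : a < b := h.meshX_lt hβ i hi
  have h0 := sub_pos.2 hab
  have hsub : Icc a b ⊆ Icc 0 1 := h.cellX_subset hβ hi
  have e1 := abs_deriv_sub_slope_le hab (g := fun t => S (t, y)) (g' := fun t => pdx S (t, y))
    (fun t ht => (hS.hasDeriv_x hy (hsub ht)).mono hsub) (y := x) (R := M * (b - a)) (fun t ht => by
      refine (abs_sub_le_of_hasDerivWithinAt (g := fun t => pdx S (t, y))
        (fun t ht => (hS.hasDeriv_xx hy (hsub ht)).mono hsub)
        (fun t ht => hS.bound 2 0 (by norm_num) _ (mem_OmBar (hsub ht) hy)) hx ht).trans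
        (mul_le_mul_of_nonneg_left ?_ hS.nonneg)
      rw [abs_le]; constructor <;> linarith [hx.1, hx.2, ht.1, ht.2])
  have e2 := nodal_increment h hβ hS hi hy
  rw [← div_le_iff₀ h0, ← abs_of_pos h0, ← abs_div] at e2
  refine le_trans (le_of_eq ?_) ((abs_add_le _ _).trans (add_le_add e1 e2))
  congr 1
  field_simp; ring

/-- Between t q and t r only nodes in that index range matter, so a truncated sum may be completed
by arbitrary nodal values. -/
lemma sum_hat_eq_pl {t : ℕ → ℝ} (ht : ∀ i < N, t i < t (i + 1)) {q r : ℕ} (hr : r ≤ N)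
    (hqr : q < r) {c c' : ℕ → ℝ} (hc : ∀ j ∈ Finset.Icc q r, c j = c' j) {y : ℝ}
    (hy : y ∈ Icc (t q) (t r)) :
    ∑ j ∈ Finset.Icc q r, c j * hat t j y = pl t N c' y := by
  obtain ⟨j, h1, h2, hyj⟩ := exists_cell hqr hy
  have m1 : j ∈ Finset.Icc q r := Finset.mem_Icc.2 ⟨h1, h2.le⟩
  have m2 : j + 1 ∈ Finset.Icc q r := Finset.mem_Icc.2 ⟨by omega, h2⟩
  rw [sum_hat ht (by omega) hyj _ (fun a ha => by simp at ha; omega) m1 m2,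
    pl_eq ht (by omega) hyj, hc j m1, hc _ m2]

lemma IsAdmissible.index_facts (h : IsAdmissible β ε N) :
    N / 2 - 1 + 1 = N / 2 ∧ 0 < N / 2 - 1 ∧ N / 2 < N ∧ 0 < N / 4 ∧ N / 4 < 3 * N / 4 ∧
      3 * N / 4 < N ∧ N / 4 + 1 < 3 * N / 4 := by
  have := h.four_le
  have := h.four_dvd
  omega

/-- On the strip, `P` is the Lagrange interpolant with its left nodal values lowered by `corr`. The
conditions on `P` are listed without the moments, because the existence proof needs the formula
before the moments are known. -/
lemma transition_formula (h : IsAdmissible β ε N)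
    (hexp : ∀ p, P p = ∑ i ∈ Finset.Icc (N / 2 - 1) (N / 2),
      ∑ j ∈ Finset.Icc (N / 4) (3 * N / 4),
        P (meshX β ε N i, meshY ε N j) * theta β ε N i j p) (hβ : 0 < β)
    (hends : ∀ j ∈ ({N / 4, 3 * N / 4} : Finset ℕ),
      P (meshX β ε N (N / 2 - 1), meshY ε N j) = S (meshX β ε N (N / 2 - 1), meshY ε N j))
    (hright : ∀ j ∈ Finset.Icc (N / 4) (3 * N / 4),
      P (meshX β ε N (N / 2), meshY ε N j) = S (meshX β ε N (N / 2), meshY ε N j))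
    {x y : ℝ} (hx : x ∈ Icc (meshX β ε N (N / 2 - 1)) (meshX β ε N (N / 2)))
    (hy : y ∈ Icc (meshY ε N (N / 4)) (meshY ε N (3 * N / 4))) :
    P (x, y) =
      (nodal β ε N S (N / 2 - 1) y - pl (meshY ε N) N (corr β ε N S P) y) *
          ((meshX β ε N (N / 2) - x) / (meshX β ε N (N / 2) - meshX β ε N (N / 2 - 1))) +
        nodal β ε N S (N / 2) y * ((x - meshX β ε N (N / 2 - 1)) /
          (meshX β ε N (N / 2) - meshX β ε N (N / 2 - 1))) := by
  obtain ⟨hm, hm0, hn, hq, hqr, hr, -⟩ := h.index_facts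
  have inner : ∀ i, ∑ j ∈ Finset.Icc (N / 4) (3 * N / 4),
      P (meshX β ε N i, meshY ε N j) * theta β ε N i j (x, y) =
      (∑ j ∈ Finset.Icc (N / 4) (3 * N / 4), P (meshX β ε N i, meshY ε N j) *
        hat (meshY ε N) j y) * hat (meshX β ε N) i x := fun i => by
    rw [Finset.sum_mul]
    refine Finset.sum_congr rfl fun j _ => ?_
    simp only [theta]; ring
  have hx' : x ∈ Icc (meshX β ε N (N / 2 - 1)) (meshX β ε N (N / 2 - 1 + 1)) := by rwa [hm]
  rw [hexp, Finset.sum_congr rfl fun i _ => inner i,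
    sum_hat (h.meshX_lt hβ) (by omega : N / 2 - 1 < N) hx' _ (fun a ha => by simp at ha; omega)
      (by simp) (by simp; omega), hm,
    sum_hat_eq_pl h.meshY_lt hr.le hqr hright hy, nodal, nodal, ← pl_sub,
    sum_hat_eq_pl h.meshY_lt hr.le hqr _ hy]
  intro j hj
  rw [Finset.mem_Icc] at hj
  by_cases hj' : N / 4 < j ∧ j < 3 * N / 4
  · rw [corr, if_pos hj']; ring
  · rw [corr, if_neg hj', hends j (by simp; omega), sub_zero]

end Transition

end Bakhvalov

/-! ### Reduction of the moment conditions to one-dimensional integrals -/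

namespace Bakhvalov

section Moments

variable {β ε M : ℝ} {N : ℕ} {S P : ℝ × ℝ → ℝ}

lemma pdx_sub_of_affine (hS : SmoothBound M S) {Q : ℝ × ℝ → ℝ} {a b A B x y : ℝ}
    (hab : Icc a b ⊆ Icc (0 : ℝ) 1) (hx : x ∈ Ioo a b) (hy : y ∈ Icc (0 : ℝ) 1)
    (hQ : ∀ z ∈ Ioo a b, Q (z, y) = A * ((b - z) / (b - a)) + B * ((z - a) / (b - a))) :
    pdx (S - Q) (x, y) = pdx S (x, y) - (B - A) / (b - a) := by
  have hx01 := hab (Ioo_subset_Icc_self hx)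
  have hd : HasDerivAt (fun z => Q (z, y)) ((B - A) / (b - a)) x := by
    have h1 : HasDerivAt (fun z => A * ((b - z) / (b - a)) + B * ((z - a) / (b - a)))
        ((B - A) / (b - a)) x := by
      have := ((((hasDerivAt_id x).const_sub b).div_const (b - a)).const_mul A).add
        ((((hasDerivAt_id x).sub_const a).div_const (b - a)).const_mul B)
      refine this.congr_deriv ?_
      ring
    exact h1.congr_of_eventuallyEq (Filter.eventually_of_mem (Ioo_mem_nhds hx.1 hx.2) hQ)
  exact ((hS.hasDeriv_x hy hx01).sub hd.hasDerivWithinAt).derivWithin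
    (uniqueDiffOn_Icc zero_lt_one x hx01)

lemma integral_linear_weight {a b : ℝ} (hab : a < b) :
    ∫ x in a..b, (x - a) / (b - a) = (b - a) / 2 := by
  have h0 := (sub_pos.2 hab).ne'
  have : ∀ x, (x - a) / (b - a) = (1 / (b - a)) * (x - a) ^ 1 := fun x => by ring
  simp only [this]
  rw [intervalIntegral.integral_const_mul, integral_sub_left_pow]
  field_simp; norm_num

lemma continuousOn_error (h : IsAdmissible β ε N) (hβ : 0 < β) (hS : SmoothBound M S) {i : ℕ}
    (hi : i < N) : ContinuousOn (fun p : ℝ × ℝ => pdx S p -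
      (nodal β ε N S (i + 1) p.2 - nodal β ε N S i p.2) /
        (meshX β ε N (i + 1) - meshX β ε N i))
      (Icc (meshX β ε N i) (meshX β ε N (i + 1)) ×ˢ Icc (0 : ℝ) 1) := by
  have hc : ∀ k, ContinuousOn (fun p : ℝ × ℝ => nodal β ε N S k p.2)
      (Icc (meshX β ε N i) (meshX β ε N (i + 1)) ×ˢ Icc (0 : ℝ) 1) := fun k =>
    (h.pl_continuousOn _).comp continuousOn_snd fun p hp => hp.2
  exact ((hS.smooth_pdx.continuousOn).mono (prod_mono (h.cellX_subset hβ hi) Subset.rfl)).sub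
    (((hc _).sub (hc _)).div_const _)

lemma continuousOn_stripMean_integrand (h : IsAdmissible β ε N) (hβ : 0 < β)
    (hS : SmoothBound M S) : ContinuousOn (fun p : ℝ × ℝ => (pdx S p -
      (nodal β ε N S (N / 2) p.2 - nodal β ε N S (N / 2 - 1) p.2) /
        (meshX β ε N (N / 2) - meshX β ε N (N / 2 - 1))) *
      ((p.1 - meshX β ε N (N / 2 - 1)) / (meshX β ε N (N / 2) - meshX β ε N (N / 2 - 1))))
      (Icc (meshX β ε N (N / 2 - 1)) (meshX β ε N (N / 2)) ×ˢ Icc (0 : ℝ) 1) := by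
  obtain ⟨hm, hm0, hn, hq, hqr, hr, -⟩ := h.index_facts
  have := continuousOn_error h hβ hS (i := N / 2 - 1) (by omega)
  rw [hm] at this
  exact this.mul (by fun_prop)

lemma intervalIntegrable_stripMean (h : IsAdmissible β ε N) (hβ : 0 < β) (hS : SmoothBound M S)
    {c d : ℝ} (hc : 0 ≤ c) (hcd : c ≤ d) (hd : d ≤ 1) :
    IntervalIntegrable (stripMean β ε N S) volume c d := by
  obtain ⟨hm, hm0, hn, hq, hqr, hr, -⟩ := h.index_facts
  have hlt := h.meshX_lt hβ (N / 2 - 1) (by omega)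
  rw [hm] at hlt
  exact intervalIntegrable_slice hlt.le hcd
    ((continuousOn_stripMean_integrand h hβ hS).mono
      (prod_mono Subset.rfl (Icc_subset_Icc hc hd)))

/-- Inside the strip (S - P)_x is the derivative of the Lagrange error minus D(y)/width. The
x-factor of the basis function integrates to width/2, so D enters as D/2 however thin the strip is.
-/
lemma moment_cell (h : IsAdmissible β ε N) (hβ : 0 < β) (hS : SmoothBound M S)
    (hexp : ∀ p, P p = ∑ i ∈ Finset.Icc (N / 2 - 1) (N / 2),
      ∑ j ∈ Finset.Icc (N / 4) (3 * N / 4),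
        P (meshX β ε N i, meshY ε N j) * theta β ε N i j p)
    (hends : ∀ j ∈ ({N / 4, 3 * N / 4} : Finset ℕ),
      P (meshX β ε N (N / 2 - 1), meshY ε N j) = S (meshX β ε N (N / 2 - 1), meshY ε N j))
    (hright : ∀ j ∈ Finset.Icc (N / 4) (3 * N / 4),
      P (meshX β ε N (N / 2), meshY ε N j) = S (meshX β ε N (N / 2), meshY ε N j))
    {j l : ℕ} (hj : N / 4 ≤ j) (hj' : j < 3 * N / 4) (hl : l ≤ N) :
    ∫ p in cell β ε N (N / 2 - 1) j, pdx (S - P) p * theta β ε N (N / 2) l p =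
      ∫ y in meshY ε N j..meshY ε N (j + 1),
        (stripMean β ε N S y - pl (meshY ε N) N (corr β ε N S P) y / 2) * hat (meshY ε N) l y := by
  obtain ⟨hm, hm0, hn, hq, hqr, hr, -⟩ := h.index_facts
  have hjN : j < N := by omega
  have hsubX := h.cellX_subset hβ (i := N / 2 - 1) (by omega)
  have hlt := h.meshX_lt hβ (N / 2 - 1) (by omega)
  have hcE := continuousOn_error h hβ hS (i := N / 2 - 1) (by omega)
  have hhat : ∀ x ∈ Icc (meshX β ε N (N / 2 - 1)) (meshX β ε N (N / 2)),
      hat (meshX β ε N) (N / 2) x = (x - meshX β ε N (N / 2 - 1)) /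
        (meshX β ε N (N / 2) - meshX β ε N (N / 2 - 1)) := fun x hx => by
    have := hat_right (t := meshX β ε N) (j := N / 2 - 1) (s := x) (by rwa [hm])
    rwa [hm] at this
  have hform := fun x hx y hy => transition_formula h hexp hβ hends hright (x := x) (y := y) hx hy
  rw [cell]
  rw [hm] at hsubX hlt hcE ⊢
  simp only [stripMean]
  set a := meshX β ε N (N / 2 - 1)
  set b := meshX β ε N (N / 2)
  have h0 := sub_pos.2 hlt
  have hsubY := h.cellY_subset hjN
  have hsubY' : Icc (meshY ε N j) (meshY ε N (j + 1)) ⊆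
      Icc (meshY ε N (N / 4)) (meshY ε N (3 * N / 4)) :=
    Icc_subset_Icc (mesh_le h.meshY_lt hj hjN.le) (mesh_le h.meshY_lt hj' hr.le)
  set D := pl (meshY ε N) N (corr β ε N S P)
  have hDc : ContinuousOn D (Icc 0 1) := h.pl_continuousOn _
  have hφc := h.hat_continuousOn hl
  set E : ℝ × ℝ → ℝ := fun p => pdx S p -
    (nodal β ε N S (N / 2) p.2 - nodal β ε N S (N / 2 - 1) p.2) / (b - a) with hE
  set G : ℝ × ℝ → ℝ := fun p => (E p - D p.2 / (b - a)) * ((p.1 - a) / (b - a)) *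
    hat (meshY ε N) l p.2
  have hsub2 : Icc a b ×ˢ Icc (meshY ε N j) (meshY ε N (j + 1)) ⊆ Icc a b ×ˢ Icc (0 : ℝ) 1 :=
    prod_mono Subset.rfl hsubY
  have hGc : ContinuousOn G (Icc a b ×ˢ Icc (meshY ε N j) (meshY ε N (j + 1))) := by
    have h1 : ContinuousOn (fun p : ℝ × ℝ => D p.2)
        (Icc a b ×ˢ Icc (meshY ε N j) (meshY ε N (j + 1))) :=
      hDc.comp continuousOn_snd fun p hp => hsubY hp.2
    have h2 : ContinuousOn (fun p : ℝ × ℝ => hat (meshY ε N) l p.2)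
        (Icc a b ×ˢ Icc (meshY ε N j) (meshY ε N (j + 1))) :=
      hφc.comp continuousOn_snd fun p hp => hsubY hp.2
    exact (((hcE.mono hsub2).sub (h1.div_const _)).mul (by fun_prop)).mul h2
  rw [integral_rect_Icc hlt.le (h.meshY_lt j hjN).le hGc]
  · refine intervalIntegral.integral_congr fun y hy => ?_
    rw [uIcc_of_le (h.meshY_lt j hjN).le] at hy
    have hEy : ContinuousOn (fun x => E (x, y)) (Icc a b) :=
      hcE.comp (by fun_prop) fun x hx => ⟨hx, hsubY hy⟩
    have e : ∀ x, G (x, y) = (E (x, y) * ((x - a) / (b - a)) -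
        D y / (b - a) * ((x - a) / (b - a))) * hat (meshY ε N) l y := fun x => by
      simp only [G]; ring
    simp only [e]
    rw [intervalIntegral.integral_mul_const, intervalIntegral.integral_sub,
      intervalIntegral.integral_const_mul, integral_linear_weight hlt]
    · congr 2
      field_simp
    · refine ContinuousOn.intervalIntegrable ?_
      rw [uIcc_of_le hlt.le]
      exact hEy.mul (by fun_prop)
    · exact Continuous.intervalIntegrable (by fun_prop) _ _
  · rintro ⟨x, y⟩ ⟨hx, hy⟩
    have hy' := Ioo_subset_Icc_self hy
    have := pdx_sub_of_affine hS hsubX hx (hsubY hy') (Q := P)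
      (fun z hz => hform z (Ioo_subset_Icc_self hz) y (hsubY' hy'))
    rw [this, theta, hhat x (Ioo_subset_Icc_self hx)]
    simp only [G, hE, D]
    ring

/-- The integrals of a piecewise linear function against the hat functions of a uniform mesh. -/
lemma integral_pl_mul_hat {t : ℕ → ℝ} (ht : ∀ i < N, t i < t (i + 1)) {j : ℕ} (hj : j + 1 < N)
    {k : ℝ} (h1 : t (j + 1) - t j = k) (h2 : t (j + 1 + 1) - t (j + 1) = k) (c : ℕ → ℝ) :
    (∫ y in t j..t (j + 1), pl t N c y * hat t (j + 1) y) +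
      (∫ y in t (j + 1)..t (j + 1 + 1), pl t N c y * hat t (j + 1) y) =
      k / 6 * (c j + 4 * c (j + 1) + c (j + 1 + 1)) := by
  have l1 := ht j (by omega)
  have l2 := ht (j + 1) hj
  have k0 : k ≠ 0 := by rw [← h1]; exact (sub_pos.2 l1).ne'
  have e1 : ∫ y in t j..t (j + 1), pl t N c y * hat t (j + 1) y =
      ∫ y in t j..t (j + 1), ((c (j + 1) - c j) / k ^ 2 * (y - t j) ^ 2 +
        c j / k * (y - t j) ^ 1) := by
    refine intervalIntegral.integral_congr fun y hy => ?_
    rw [uIcc_of_le l1.le] at hy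
    simp only [pl_eq ht (by omega : j < N) hy c, hat_right hy, h1]
    have : t (j + 1) = t j + k := by linarith
    rw [this]; field_simp; ring
  have e2 : ∫ y in t (j + 1)..t (j + 1 + 1), pl t N c y * hat t (j + 1) y =
      ∫ y in t (j + 1)..t (j + 1 + 1),
        (-(c (j + 1 + 1) - c (j + 1)) / k ^ 2 * (y - t (j + 1)) ^ 2 +
          (c (j + 1 + 1) - 2 * c (j + 1)) / k * (y - t (j + 1)) ^ 1 +
            c (j + 1) * (y - t (j + 1)) ^ 0) := by
    refine intervalIntegral.integral_congr fun y hy => ?_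
    rw [uIcc_of_le l2.le] at hy
    simp only [pl_eq ht hj hy c, hat_left ht hj hy, h2]
    have : t (j + 1 + 1) = t (j + 1) + k := by linarith
    rw [this]; field_simp; ring
  rw [e1, e2, intervalIntegral.integral_add, intervalIntegral.integral_add,
    intervalIntegral.integral_add]
  · simp only [intervalIntegral.integral_const_mul, integral_sub_left_pow, h1, h2]
    push_cast
    field_simp; ring
  all_goals exact Continuous.intervalIntegrable (by fun_prop) _ _

end Moments

end Bakhvalov

/-! ### Existence, uniqueness and size of the transition interpolant -/

namespace Bakhvalov

section Existence

variable {β ε M : ℝ} {N : ℕ} {S P : ℝ × ℝ → ℝ}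

/-- The right-hand side of the tridiagonal system for the corrections. -/
noncomputable def momentRhs (β ε : ℝ) (N : ℕ) (S : ℝ × ℝ → ℝ) (j : ℕ) : ℝ :=
  (∫ y in meshY ε N (j - 1)..meshY ε N j, stripMean β ε N S y * hat (meshY ε N) j y) +
    (∫ y in meshY ε N j..meshY ε N (j + 1), stripMean β ε N S y * hat (meshY ε N) j y) -
    (meshX β ε N (N / 2 + 1) - meshX β ε N (N / 2)) ^ 2 / 12 *
      ((∫ y in meshY ε N (j - 1)..meshY ε N j,
          pd 2 0 S (meshX β ε N (N / 2), y) * hat (meshY ε N) j y) +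
        ∫ y in meshY ε N j..meshY ε N (j + 1),
          pd 2 0 S (meshX β ε N (N / 2), y) * hat (meshY ε N) j y)

lemma theta_transition (h : IsAdmissible β ε N) (hβ : 0 < β) (j : ℕ) (y : ℝ) :
    theta β ε N (N / 2) j (meshX β ε N (N / 2), y) = hat (meshY ε N) j y := by
  obtain ⟨hm, hm0, hn, hq, hqr, hr, -⟩ := h.index_facts
  rw [theta, hat_node (h.meshX_lt hβ) (by omega) hn.le hn.le, if_pos rfl, one_mul]

lemma intervalIntegrable_mul_hat (h : IsAdmissible β ε N) {g : ℝ → ℝ} {i j : ℕ} (hj : j ≤ N)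
    (hi : i < N) (hg : IntervalIntegrable g volume (meshY ε N i) (meshY ε N (i + 1))) :
    IntervalIntegrable (fun y => g y * hat (meshY ε N) j y) volume
      (meshY ε N i) (meshY ε N (i + 1)) := by
  refine hg.mul_continuousOn ?_
  rw [uIcc_of_le (h.meshY_lt i hi).le]
  exact (h.hat_continuousOn hj).mono (h.cellY_subset hi)

lemma intervalIntegrable_cellY (h : IsAdmissible β ε N) {g : ℝ → ℝ} {i : ℕ} (hi : i < N)
    (hg : ContinuousOn g (Icc 0 1)) :
    IntervalIntegrable g volume (meshY ε N i) (meshY ε N (i + 1)) := by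
  refine ContinuousOn.intervalIntegrable ?_
  rw [uIcc_of_le (h.meshY_lt i hi).le]
  exact hg.mono (h.cellY_subset hi)

/-- By `moment_cell` the unknown enters as -½ ∫ D · hat. On the uniform middle mesh of width k the
mass matrix has stencil (k/6)(1, 4, 1), whence k/12. -/
lemma moment_iff (h : IsAdmissible β ε N) (hβ : 0 < β) (hS : SmoothBound M S)
    (hexp : ∀ p, P p = ∑ i ∈ Finset.Icc (N / 2 - 1) (N / 2),
      ∑ j ∈ Finset.Icc (N / 4) (3 * N / 4),
        P (meshX β ε N i, meshY ε N j) * theta β ε N i j p)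
    (hends : ∀ j ∈ ({N / 4, 3 * N / 4} : Finset ℕ),
      P (meshX β ε N (N / 2 - 1), meshY ε N j) = S (meshX β ε N (N / 2 - 1), meshY ε N j))
    (hright : ∀ j ∈ Finset.Icc (N / 4) (3 * N / 4),
      P (meshX β ε N (N / 2), meshY ε N j) = S (meshX β ε N (N / 2), meshY ε N j))
    {j : ℕ} (hj : N / 4 < j) (hj' : j < 3 * N / 4) :
    ((∫ p in cell β ε N (N / 2 - 1) (j - 1), pdx (S - P) p * theta β ε N (N / 2) j p) +
      (∫ p in cell β ε N (N / 2 - 1) j, pdx (S - P) p * theta β ε N (N / 2) j p) =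
    (meshX β ε N (N / 2 + 1) - meshX β ε N (N / 2)) ^ 2 / 12 *
      ((∫ y in meshY ε N (j - 1)..meshY ε N j,
          pd 2 0 S (meshX β ε N (N / 2), y) *
            theta β ε N (N / 2) j (meshX β ε N (N / 2), y)) +
        ∫ y in meshY ε N j..meshY ε N (j + 1),
          pd 2 0 S (meshX β ε N (N / 2), y) *
            theta β ε N (N / 2) j (meshX β ε N (N / 2), y))) ↔
      2 * (1 - 2 * transY ε) / N / 12 * (corr β ε N S P (j - 1) + 4 * corr β ε N S P j +
        corr β ε N S P (j + 1)) = momentRhs β ε N S j := by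
  obtain ⟨hm, hm0, hn, hq, hqr, hr, -⟩ := h.index_facts
  simp only [theta_transition h hβ]
  rw [momentRhs]
  obtain ⟨i, rfl⟩ : ∃ i, j = i + 1 := ⟨j - 1, by omega⟩
  rw [Nat.add_sub_cancel, moment_cell h hβ hS hexp hends hright (by omega) (by omega) (by omega),
    moment_cell h hβ hS hexp hends hright (by omega) (by omega) (by omega)]
  have key := integral_pl_mul_hat h.meshY_lt (by omega : i + 1 < N)
    (h.meshY_middle_step (by omega) (by omega : i < 3 * N / 4))
    (h.meshY_middle_step (by omega) hj') (corr β ε N S P)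
  have split : ∀ i' < N, ∫ y in meshY ε N i'..meshY ε N (i' + 1),
      (stripMean β ε N S y - pl (meshY ε N) N (corr β ε N S P) y / 2) *
        hat (meshY ε N) (i + 1) y =
      (∫ y in meshY ε N i'..meshY ε N (i' + 1),
        stripMean β ε N S y * hat (meshY ε N) (i + 1) y) -
      (1 / 2) * ∫ y in meshY ε N i'..meshY ε N (i' + 1),
        pl (meshY ε N) N (corr β ε N S P) y * hat (meshY ε N) (i + 1) y := by
    intro i' hi'
    rw [← intervalIntegral.integral_const_mul, ← intervalIntegral.integral_sub]
    · refine intervalIntegral.integral_congr fun y _ => ?_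
      ring
    · exact intervalIntegrable_mul_hat h (by omega) hi' (intervalIntegrable_stripMean h hβ hS
        (h.meshY_mem hi'.le).1 (h.meshY_lt i' hi').le (h.meshY_mem hi').2)
    · exact (intervalIntegrable_mul_hat h (by omega) hi'
        (intervalIntegrable_cellY h hi' (h.pl_continuousOn _))).const_mul _
  rw [split i (by omega), split (i + 1) (by omega)]
  constructor <;> intro he <;> linarith

lemma corr_interior {j : ℕ} (hj : N / 4 < j) (hj' : j < 3 * N / 4) :
    corr β ε N S P j = S (meshX β ε N (N / 2 - 1), meshY ε N j) -
      P (meshX β ε N (N / 2 - 1), meshY ε N j) := if_pos ⟨hj, hj'⟩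

lemma corr_exterior {j : ℕ} (hj : ¬ (N / 4 < j ∧ j < 3 * N / 4)) :
    corr β ε N S P j = 0 := if_neg hj

lemma IsTransitionInterp.system (h : IsAdmissible β ε N) (hβ : 0 < β) (hS : SmoothBound M S)
    (hP : IsTransitionInterp β ε N S P) {j : ℕ} (hj : N / 4 < j) (hj' : j < 3 * N / 4) :
    2 * (1 - 2 * transY ε) / N / 12 * (corr β ε N S P (j - 1) + 4 * corr β ε N S P j +
        corr β ε N S P (j + 1)) = momentRhs β ε N S j :=
  (moment_iff h hβ hS hP.expansion hP.ends hP.right hj hj').1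
    (hP.moments j (Finset.mem_Icc.2 ⟨hj, by omega⟩))

lemma IsAdmissible.middle_width_pos (h : IsAdmissible β ε N) :
    0 < 2 * (1 - 2 * transY ε) / N :=
  lt_of_lt_of_le (one_div_pos.2 h.cast_pos) h.middle_width_ge

/-- All nodal values except the interior ones on x = x_{N/2-1} are prescribed, and the system of
`moment_iff` determines those. -/
theorem existsUnique_transitionInterp (h : IsAdmissible β ε N) (hβ : 0 < β)
    (hS : SmoothBound M S) : ∃! P : ℝ × ℝ → ℝ, IsTransitionInterp β ε N S P := by
  obtain ⟨hm, hm0, hn, hq, hqr, hr, -⟩ := h.index_facts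
  have hk := h.middle_width_pos
  set k := 2 * (1 - 2 * transY ε) / N with hkdef
  refine existsUnique_of_exists_of_unique ?_ ?_
  · obtain ⟨d, hd0, hd⟩ := tridiag_exists (N / 4) (3 * N / 4)
      (fun j => momentRhs β ε N S j / (k / 12))
    set Q : ℕ → ℕ → ℝ := fun i j => if i = N / 2 then S (meshX β ε N (N / 2), meshY ε N j)
      else S (meshX β ε N (N / 2 - 1), meshY ε N j) - d j with hQ
    set P : ℝ × ℝ → ℝ := fun p => ∑ i ∈ Finset.Icc (N / 2 - 1) (N / 2),
      ∑ j ∈ Finset.Icc (N / 4) (3 * N / 4), Q i j * theta β ε N i j p with hPdef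
    -- The field `expansion` refers to the nodal values of `P` itself, so `P` must first be shown to
    -- take the chosen coefficients at the nodes.
    have hnode : ∀ i ∈ Finset.Icc (N / 2 - 1) (N / 2), ∀ j ∈ Finset.Icc (N / 4) (3 * N / 4),
        P (meshX β ε N i, meshY ε N j) = Q i j := by
      intro i hi j hj
      have hi' := Finset.mem_Icc.1 hi
      have hj' := Finset.mem_Icc.1 hj
      simp only [hPdef, theta]
      rw [Finset.sum_eq_single i, Finset.sum_eq_single j]
      · rw [hat_node (h.meshX_lt hβ) (by omega) (by omega) (by omega), if_pos rfl,
          hat_node h.meshY_lt (by omega) (by omega) (by omega), if_pos rfl]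
        ring
      · intro a ha haj
        rw [Finset.mem_Icc] at ha
        rw [hat_node h.meshY_lt (by omega) (by omega) (by omega : a ≤ N), if_neg haj]
        ring
      · exact fun hj' => absurd hj hj'
      · intro a ha hai
        rw [Finset.mem_Icc] at ha
        refine Finset.sum_eq_zero fun b _ => ?_
        rw [hat_node (h.meshX_lt hβ) (by omega) (by omega) (by omega : a ≤ N), if_neg hai]
        ring
      · exact fun hi' => absurd hi hi'
    have mm : N / 2 - 1 ∈ Finset.Icc (N / 2 - 1) (N / 2) := by simp
    have mn : N / 2 ∈ Finset.Icc (N / 2 - 1) (N / 2) := by simp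
    have hexp : ∀ p, P p = ∑ i ∈ Finset.Icc (N / 2 - 1) (N / 2),
        ∑ j ∈ Finset.Icc (N / 4) (3 * N / 4),
          P (meshX β ε N i, meshY ε N j) * theta β ε N i j p := fun p =>
      Finset.sum_congr rfl fun i hi => Finset.sum_congr rfl fun j hj => by rw [hnode i hi j hj]
    have hleft : ∀ j ∈ Finset.Icc (N / 4) (3 * N / 4),
        P (meshX β ε N (N / 2 - 1), meshY ε N j) =
          S (meshX β ε N (N / 2 - 1), meshY ε N j) - d j := fun j hj => by
      rw [hnode _ mm j hj, hQ]
      exact if_neg (by omega)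
    have hends : ∀ j ∈ ({N / 4, 3 * N / 4} : Finset ℕ),
        P (meshX β ε N (N / 2 - 1), meshY ε N j) =
          S (meshX β ε N (N / 2 - 1), meshY ε N j) := fun j hj => by
      simp only [Finset.mem_insert, Finset.mem_singleton] at hj
      rw [hleft j (Finset.mem_Icc.2 (by omega)), hd0 j (by omega), sub_zero]
    have hright : ∀ j ∈ Finset.Icc (N / 4) (3 * N / 4),
        P (meshX β ε N (N / 2), meshY ε N j) = S (meshX β ε N (N / 2), meshY ε N j) :=
      fun j hj => by
        rw [hnode _ mn j hj, hQ]
        exact if_pos rfl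
    have hcorr : corr β ε N S P = d := by
      ext j
      by_cases hj : N / 4 < j ∧ j < 3 * N / 4
      · rw [corr_interior hj.1 hj.2, hleft j (Finset.mem_Icc.2 (by omega))]; ring
      · rw [corr_exterior hj, hd0 j hj]
    refine ⟨P, hexp, fun j hj => ?_, hends, hright⟩
    rw [Finset.mem_Icc] at hj
    refine (moment_iff h hβ hS hexp hends hright (by omega) (by omega)).2 ?_
    rw [hcorr, hd j (by omega) (by omega), ← hkdef]
    exact mul_div_cancel₀ _ (by positivity)
  · intro P P' hP hP'
    have hc : ∀ j ∈ Finset.Icc (N / 4) (3 * N / 4), corr β ε N S P j = corr β ε N S P' j := by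
      intro j hj
      -- The difference of two corrections solves the homogeneous system.
      have := tridiag_bound (l := N / 4) (r := 3 * N / 4)
        (a := fun j => corr β ε N S P j - corr β ε N S P' j) le_rfl
        (by simp [corr]) (by simp [corr]) (fun i h1 h2 => by
          have e1 := hP.system h hβ hS h1 h2
          have e2 := hP'.system h hβ hS h1 h2
          rw [← e2] at e1
          have e3 := mul_left_cancel₀ (by positivity) e1
          rw [abs_nonpos_iff]; linarith) hj
      simpa [sub_eq_zero] using this
    ext p
    rw [hP.expansion, hP'.expansion]
    refine Finset.sum_congr rfl fun i hi => Finset.sum_congr rfl fun j hj => ?_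
    congr 1
    have hi' := Finset.mem_Icc.1 hi
    have hj' := Finset.mem_Icc.1 hj
    rcases (by omega : i = N / 2 - 1 ∨ i = N / 2) with rfl | rfl
    · by_cases hjj : N / 4 < j ∧ j < 3 * N / 4
      · have := hc j hj
        rw [corr_interior hjj.1 hjj.2, corr_interior hjj.1 hjj.2] at this
        linarith
      · have : j ∈ ({N / 4, 3 * N / 4} : Finset ℕ) := by simp; omega
        rw [hP.ends j this, hP'.ends j this]
    · rw [hP.right j hj, hP'.right j hj]

/-- The constant in the bound of the weighted mean. -/
noncomputable def meanConst (β M : ℝ) : ℝ := 5 / β * (5 / β * M + 25 * M)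

lemma meanConst_nonneg (hβ : 0 < β) (hM : 0 ≤ M) : 0 ≤ meanConst β M := by
  rw [meanConst]; positivity

lemma error_bound_fine (h : IsAdmissible β ε N) (hβ : 0 < β) (hM : 0 ≤ M) {i : ℕ}
    (hi : i < N / 2) :
    M * (meshX β ε N (i + 1) - meshX β ε N i) + M * (10 / N) ^ 2 ≤ (5 / β * M + 25 * M) / N := by
  have h1 := mul_le_mul_of_nonneg_left (h.meshX_fine_step hβ hi).2 hM
  have hN := h.cast_pos
  -- N ≥ 4 gives 100/N² ≤ 25/N.
  have h2 : (10 / (N : ℝ)) ^ 2 ≤ 25 / N := by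
    rw [div_pow, div_le_div_iff₀ (by positivity) hN]
    nlinarith [h.cast_ge]
  have h3 := mul_le_mul_of_nonneg_left h2 hM
  calc _ ≤ M * (5 / β / N) + M * (25 / N) := add_le_add h1 h3
    _ = _ := by ring

/-- The weighted mean is small relative to the width of the strip. -/
lemma abs_stripMean_le (h : IsAdmissible β ε N) (hβ : 0 < β) (hS : SmoothBound M S) {y : ℝ}
    (hy : y ∈ Icc (0 : ℝ) 1) :
    |stripMean β ε N S y| ≤ (5 / β * M + 25 * M) / N *
      (meshX β ε N (N / 2) - meshX β ε N (N / 2 - 1)) := by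
  obtain ⟨hm, hm0, hn, hq, hqr, hr, -⟩ := h.index_facts
  have hlt := h.meshX_lt hβ (N / 2 - 1) (by omega)
  have hb := fun x hx => abs_deriv_error_le h hβ hS (by omega : N / 2 - 1 < N) (x := x) hx hy
  have hb2 := error_bound_fine h hβ hS.nonneg (by omega : N / 2 - 1 < N / 2)
  rw [hm] at hlt hb hb2
  have h0 := sub_pos.2 hlt
  have := intervalIntegral.norm_integral_le_of_norm_le_const
    (a := meshX β ε N (N / 2 - 1)) (b := meshX β ε N (N / 2))
    (f := fun x => (pdx S (x, y) - (nodal β ε N S (N / 2) y - nodal β ε N S (N / 2 - 1) y) /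
        (meshX β ε N (N / 2) - meshX β ε N (N / 2 - 1))) *
      ((x - meshX β ε N (N / 2 - 1)) / (meshX β ε N (N / 2) - meshX β ε N (N / 2 - 1))))
    (C := (5 / β * M + 25 * M) / N) (fun x hx => by
      rw [uIoc_of_le hlt.le] at hx
      have hx' := Ioc_subset_Icc_self hx
      rw [Real.norm_eq_abs, abs_mul, abs_of_nonneg (a := (x - _) / _)
        (div_nonneg (by linarith [hx.1]) h0.le)]
      have : (x - meshX β ε N (N / 2 - 1)) / (meshX β ε N (N / 2) - meshX β ε N (N / 2 - 1)) ≤ 1 :=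
        (div_le_one h0).2 (by linarith [hx.2])
      exact (mul_le_of_le_one_right (abs_nonneg _) this).trans ((hb x hx').trans hb2))
  rwa [Real.norm_eq_abs, abs_of_pos h0] at this

lemma abs_integral_mul_hat_le (h : IsAdmissible β ε N) {g : ℝ → ℝ} {K : ℝ} {i j : ℕ}
    (hi : i < N) (hj : j ≤ N) (hg : ∀ y ∈ Icc (0 : ℝ) 1, |g y| ≤ K) :
    |∫ y in meshY ε N i..meshY ε N (i + 1), g y * hat (meshY ε N) j y| ≤
      K * (meshY ε N (i + 1) - meshY ε N i) := by
  have hlt := h.meshY_lt i hi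
  have := intervalIntegral.norm_integral_le_of_norm_le_const
    (a := meshY ε N i) (b := meshY ε N (i + 1)) (f := fun y => g y * hat (meshY ε N) j y)
    (C := K) (fun y hy => by
      rw [uIoc_of_le hlt.le] at hy
      have hy' := h.cellY_subset hi (Ioc_subset_Icc_self hy)
      rw [Real.norm_eq_abs, abs_mul]
      exact (mul_le_of_le_one_right (abs_nonneg _) (h.abs_hat_le hj hy')).trans (hg y hy'))
  rwa [Real.norm_eq_abs, abs_of_pos (sub_pos.2 hlt)] at this

/-- The constant in the bound of the corrections. -/
noncomputable def corrConst (β M : ℝ) : ℝ := 12 * meanConst β M + 4 * M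

lemma corrConst_nonneg (hβ : 0 < β) (hM : 0 ≤ M) : 0 ≤ corrConst β M := by
  have := meanConst_nonneg hβ hM
  rw [corrConst]; positivity

/-- The right-hand side of the system is O(k N^{-2}): the strip N/2 - 1 still belongs to the fine
mesh and has width O(1/N), which makes the mean O(N^{-2}), and H = O(1/N). Division by k/12 and
diagonal dominance finish. -/
theorem abs_corr_le (h : IsAdmissible β ε N) (hβ : 0 < β) (hS : SmoothBound M S)
    (hP : IsTransitionInterp β ε N S P) (j : ℕ) :
    |corr β ε N S P j| ≤ corrConst β M / N ^ 2 := by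
  obtain ⟨hm, hm0, hn, hq, hqr, hr, -⟩ := h.index_facts
  have hk := h.middle_width_pos
  have hN := h.cast_pos
  have hM := hS.nonneg
  by_cases hj : N / 4 < j ∧ j < 3 * N / 4
  swap
  · rw [corr_exterior hj, abs_zero]
    exact div_nonneg (corrConst_nonneg hβ hM) (by positivity)
  have hmean : ∀ y ∈ Icc (0 : ℝ) 1, |stripMean β ε N S y| ≤ meanConst β M / N ^ 2 := by
    intro y hy
    refine (abs_stripMean_le h hβ hS hy).trans ?_
    have h1 := (h.meshX_fine_step hβ (by omega : N / 2 - 1 < N / 2)).2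
    rw [hm] at h1
    calc _ ≤ (5 / β * M + 25 * M) / N * (5 / β / N) :=
          mul_le_mul_of_nonneg_left h1 (by positivity)
      _ = _ := by rw [meanConst]; field_simp
  have hxx : ∀ y ∈ Icc (0 : ℝ) 1, |pd 2 0 S (meshX β ε N (N / 2), y)| ≤ M := fun y hy =>
    hS.bound 2 0 (by norm_num) _ (mem_OmBar (h.meshX_mem hβ hn.le) hy)
  have hH : (meshX β ε N (N / 2 + 1) - meshX β ε N (N / 2)) ^ 2 / 12 ≤ 1 / 3 / N ^ 2 := by
    have h1 := h.coarse_width_le hβ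
    have h0 := (sub_pos.2 (h.meshX_lt hβ _ hn)).le
    calc _ ≤ (2 / (N : ℝ)) ^ 2 / 12 := by gcongr
      _ = _ := by field_simp; norm_num
  set k := 2 * (1 - 2 * transY ε) / N with hkdef
  -- The value of `corrConst` comes from 2m + (2/3)M = (1/12) · 2(12m + 4M), with m = `meanConst β
  -- M`; `tridiag_bound` then removes the factor 2.
  have hrhs : ∀ i, N / 4 < i → i < 3 * N / 4 → |momentRhs β ε N S i| ≤
      k / 12 * (2 * corrConst β M / N ^ 2) := by
    intro i h1 h2
    obtain ⟨l, rfl⟩ : ∃ l, i = l + 1 := ⟨i - 1, by omega⟩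
    rw [momentRhs, Nat.add_sub_cancel]
    have s1 := h.meshY_middle_step (by omega) (by omega : l < 3 * N / 4)
    have s2 := h.meshY_middle_step (by omega) h2
    have a1 := abs_integral_mul_hat_le h (by omega : l < N) (by omega : l + 1 ≤ N) hmean
    have a2 := abs_integral_mul_hat_le h (by omega : l + 1 < N) (by omega : l + 1 ≤ N) hmean
    have a3 := abs_integral_mul_hat_le h (by omega : l < N) (by omega : l + 1 ≤ N) hxx
    have a4 := abs_integral_mul_hat_le h (by omega : l + 1 < N) (by omega : l + 1 ≤ N) hxx
    rw [s1, ← hkdef] at a1 a3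
    rw [s2, ← hkdef] at a2 a4
    refine (abs_sub _ _).trans ?_
    rw [abs_mul, abs_of_nonneg (by positivity : 0 ≤
      (meshX β ε N (N / 2 + 1) - meshX β ε N (N / 2)) ^ 2 / 12)]
    calc _ ≤ (meanConst β M / N ^ 2 * k + meanConst β M / N ^ 2 * k) +
          1 / 3 / N ^ 2 * (M * k + M * k) := by
          refine add_le_add ((abs_add_le _ _).trans (add_le_add a1 a2)) ?_
          exact mul_le_mul hH ((abs_add_le _ _).trans (add_le_add a3 a4)) (abs_nonneg _)
            (by positivity)
      _ = _ := by rw [corrConst]; field_simp; ring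
  have := tridiag_bound (l := N / 4) (r := 3 * N / 4) (a := corr β ε N S P)
    (K := 2 * corrConst β M / N ^ 2)
    (div_nonneg (mul_nonneg zero_le_two (corrConst_nonneg hβ hM)) (by positivity))
    (by simp [corr]) (by simp [corr]) (fun i h1 h2 => by
      have e1 := hP.system h hβ hS h1 h2
      have e2 := hrhs i h1 h2
      rw [← e1, abs_mul, abs_of_pos (by positivity)] at e2
      exact le_of_mul_le_mul_left e2 (by positivity)) (Finset.mem_Icc.2 ⟨hj.1.le, hj.2.le⟩)
  refine this.trans (le_of_eq (by ring))

end Existence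

end Bakhvalov

namespace Bakhvalov

/-! ### The interpolant `ΠS` on the vertical strips -/

section NewInterp

variable {β ε M : ℝ} {N : ℕ} {S P v b : ℝ × ℝ → ℝ}

/-- The piecewise linear function with nodal values `(S - P)(x_{N/2-1}, y_j)`. -/
noncomputable def corrFun (β ε : ℝ) (N : ℕ) (S P : ℝ × ℝ → ℝ) : ℝ → ℝ :=
  pl (meshY ε N) N (corr β ε N S P)

/-- The correction of the Lagrange interpolant on the vertical mesh line `i`. -/
noncomputable def lineCorr (β ε : ℝ) (N : ℕ) (S P : ℝ × ℝ → ℝ) (i : ℕ) (y : ℝ) : ℝ :=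
  if i = N / 2 - 1 then corrFun β ε N S P y else 0

lemma corrFun_exterior (h : IsAdmissible β ε N) {y : ℝ} (hy : y ∈ Icc (0 : ℝ) 1)
    (hy' : y ∉ Icc (meshY ε N (N / 4)) (meshY ε N (3 * N / 4))) : corrFun β ε N S P y = 0 := by
  obtain ⟨hm, hm0, hn, hq, hqr, hr, -⟩ := h.index_facts
  obtain ⟨j, hj, hyj⟩ := h.exists_cellY hy
  have hcase : j < N / 4 ∨ 3 * N / 4 ≤ j := by
    by_contra! hcon
    exact hy' ⟨(mesh_le h.meshY_lt hcon.1 hj.le).trans hyj.1,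
      hyj.2.trans (mesh_le h.meshY_lt (Nat.succ_le_of_lt hcon.2) hr.le)⟩
  rw [corrFun, pl_eq h.meshY_lt hj hyj, corr_exterior (by omega), corr_exterior (by omega)]
  ring

lemma lagrange_eq (h : IsAdmissible β ε N) (hβ : 0 < β) {i : ℕ} (hi : i < N) {x y : ℝ}
    (hx : x ∈ Icc (meshX β ε N i) (meshX β ε N (i + 1))) :
    lagrange β ε N S (x, y) =
      nodal β ε N S i y * ((meshX β ε N (i + 1) - x) / (meshX β ε N (i + 1) - meshX β ε N i)) +
      nodal β ε N S (i + 1) y *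
        ((x - meshX β ε N i) / (meshX β ε N (i + 1) - meshX β ε N i)) := by
  have inner : ∀ i, ∑ j ∈ Finset.range (N + 1),
      S (meshX β ε N i, meshY ε N j) * theta β ε N i j (x, y) =
      nodal β ε N S i y * hat (meshX β ε N) i x := fun i => by
    rw [nodal, pl, Finset.sum_mul]
    refine Finset.sum_congr rfl fun j _ => ?_
    simp only [theta]; ring
  rw [lagrange, Finset.sum_congr rfl fun i _ => inner i]
  exact pl_eq (h.meshX_lt hβ) hi hx (fun i => nodal β ε N S i y)

lemma linkInterp_eq (h : IsAdmissible β ε N) (hβ : 0 < β)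
    (hP : IsTransitionInterp β ε N S P) {x y : ℝ}
    (hx : x ∈ Icc (meshX β ε N (N / 2 - 2)) (meshX β ε N (N / 2 - 1)))
    (hy : y ∈ Icc (meshY ε N (N / 4)) (meshY ε N (3 * N / 4))) :
    linkInterp β ε N S P (x, y) =
      nodal β ε N S (N / 2 - 2) y * ((meshX β ε N (N / 2 - 1) - x) /
          (meshX β ε N (N / 2 - 1) - meshX β ε N (N / 2 - 2))) +
      (nodal β ε N S (N / 2 - 1) y - corrFun β ε N S P y) *
        ((x - meshX β ε N (N / 2 - 2)) /
          (meshX β ε N (N / 2 - 1) - meshX β ε N (N / 2 - 2))) := by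
  obtain ⟨hm, hm0, hn, hq, hqr, hr, -⟩ := h.index_facts
  have hm2 : N / 2 - 2 + 1 = N / 2 - 1 := by omega
  have hl := hat_left (h.meshX_lt hβ) (by omega : N / 2 - 2 < N) (s := x) (by rwa [hm2])
  have hrr := hat_right (t := meshX β ε N) (j := N / 2 - 2) (s := x) (by rwa [hm2])
  rw [hm2] at hl hrr
  have e : linkInterp β ε N S P (x, y) =
      (∑ j ∈ Finset.Icc (N / 4) (3 * N / 4),
        P (meshX β ε N (N / 2 - 1), meshY ε N j) * hat (meshY ε N) j y) *
          hat (meshX β ε N) (N / 2 - 1) x +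
      (∑ j ∈ Finset.Icc (N / 4) (3 * N / 4),
        S (meshX β ε N (N / 2 - 2), meshY ε N j) * hat (meshY ε N) j y) *
          hat (meshX β ε N) (N / 2 - 2) x := by
    rw [linkInterp, Finset.sum_mul, Finset.sum_mul, ← Finset.sum_add_distrib]
    refine Finset.sum_congr rfl fun j _ => ?_
    simp only [theta]; ring
  have e1 : ∑ j ∈ Finset.Icc (N / 4) (3 * N / 4),
      P (meshX β ε N (N / 2 - 1), meshY ε N j) * hat (meshY ε N) j y =
      nodal β ε N S (N / 2 - 1) y - corrFun β ε N S P y := by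
    rw [corrFun, nodal, ← pl_sub]
    refine sum_hat_eq_pl h.meshY_lt hr.le hqr (fun j hj => ?_) hy
    rw [Finset.mem_Icc] at hj
    by_cases hj' : N / 4 < j ∧ j < 3 * N / 4
    · rw [corr, if_pos hj']; ring
    · rw [corr, if_neg hj', hP.ends j (by simp; omega), sub_zero]
  have e2 : ∑ j ∈ Finset.Icc (N / 4) (3 * N / 4),
      S (meshX β ε N (N / 2 - 2), meshY ε N j) * hat (meshY ε N) j y =
      nodal β ε N S (N / 2 - 2) y := sum_hat_eq_pl h.meshY_lt hr.le hqr (fun _ _ => rfl) hy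
  rw [e, hl, hrr, e1, e2]
  ring

/-- One formula covers the three branches of `newInterp`, since they differ only in nodal values on
the line N/2 - 1 and `corrFun` vanishes outside the middle range of y. Taking `x` in the open cell
makes the applicable branch unambiguous. -/
lemma newInterp_eq (h : IsAdmissible β ε N) (hβ : 0 < β)
    (hP : IsTransitionInterp β ε N S P) {i : ℕ} (hi : i < N) {x y : ℝ}
    (hx : x ∈ Ioo (meshX β ε N i) (meshX β ε N (i + 1))) (hy : y ∈ Icc (0 : ℝ) 1) :
    newInterp β ε N S P (x, y) =
      (nodal β ε N S i y - lineCorr β ε N S P i y) *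
        ((meshX β ε N (i + 1) - x) / (meshX β ε N (i + 1) - meshX β ε N i)) +
      (nodal β ε N S (i + 1) y - lineCorr β ε N S P (i + 1) y) *
        ((x - meshX β ε N i) / (meshX β ε N (i + 1) - meshX β ε N i)) := by
  obtain ⟨hm, hm0, hn, hq, hqr, hr, -⟩ := h.index_facts
  have hlt := h.meshX_lt hβ
  have hx' := Ioo_subset_Icc_self hx
  have out : ∀ k, k + 1 ≤ N → i ≠ k → x ∉ Icc (meshX β ε N k) (meshX β ε N (k + 1)) := by
    intro k hk hik hxk
    rcases lt_or_gt_of_ne hik with h1 | h1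
    · exact absurd (hxk.1.trans_lt hx.2) (not_lt.2 (mesh_le hlt h1 (by omega)))
    · exact absurd (hx.1.trans_le hxk.2) (not_lt.2 (mesh_le hlt h1 (by omega)))
  by_cases hyy : y ∈ Icc (meshY ε N (N / 4)) (meshY ε N (3 * N / 4))
  · by_cases h1 : i = N / 2 - 1
    · subst h1
      rw [hm] at hx hx' ⊢
      rw [newInterp, if_pos ⟨hx', hyy⟩, transition_formula h hP.expansion hβ hP.ends hP.right
        hx' hyy, lineCorr, lineCorr, if_pos rfl, if_neg (by omega), sub_zero, corrFun]
    · have o1 := out (N / 2 - 1) (by omega) h1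
      rw [hm] at o1
      rw [newInterp, if_neg (fun hp => o1 hp.1)]
      by_cases h2 : i = N / 2 - 2
      · have hm2 : N / 2 - 2 + 1 = N / 2 - 1 := by omega
        subst h2
        rw [hm2] at hx hx' ⊢
        rw [if_pos ⟨hx', hyy⟩, linkInterp_eq h hβ hP hx' hyy, lineCorr, lineCorr,
          if_neg (by omega), if_pos rfl, sub_zero]
      · have o2 := out (N / 2 - 2) (by omega) h2
        rw [show N / 2 - 2 + 1 = N / 2 - 1 by omega] at o2
        rw [if_neg (fun hp => o2 hp.1), lagrange_eq h hβ hi hx', lineCorr, lineCorr,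
          if_neg h1, if_neg (by omega), sub_zero, sub_zero]
  · have h0 : ∀ k, lineCorr β ε N S P k y = 0 := fun k => by
      rw [lineCorr, corrFun_exterior h hy hyy, ite_self]
    rw [newInterp, if_neg (fun hp => hyy hp.2), if_neg (fun hp => hyy hp.2),
      lagrange_eq h hβ hi hx', h0, h0, sub_zero, sub_zero]

/-- The derivative of `S - ΠS` on the strip `i`. -/
noncomputable def stripError (β ε : ℝ) (N : ℕ) (S P : ℝ × ℝ → ℝ) (i : ℕ) (p : ℝ × ℝ) : ℝ :=
  pdx S p - (nodal β ε N S (i + 1) p.2 - nodal β ε N S i p.2) /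
      (meshX β ε N (i + 1) - meshX β ε N i) +
    (lineCorr β ε N S P (i + 1) p.2 - lineCorr β ε N S P i p.2) /
      (meshX β ε N (i + 1) - meshX β ε N i)

lemma pdx_sub_newInterp (h : IsAdmissible β ε N) (hβ : 0 < β) (hS : SmoothBound M S)
    (hP : IsTransitionInterp β ε N S P) {i : ℕ} (hi : i < N) {p : ℝ × ℝ}
    (hp : p ∈ Ioo (meshX β ε N i) (meshX β ε N (i + 1)) ×ˢ Ioo (0 : ℝ) 1) :
    pdx (S - newInterp β ε N S P) p = stripError β ε N S P i p := by
  have hy := Ioo_subset_Icc_self hp.2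
  rw [show p = (p.1, p.2) from rfl, pdx_sub_of_affine hS (h.cellX_subset hβ hi) hp.1 hy
    (fun z hz => newInterp_eq h hβ hP hi hz hy), stripError]
  ring

lemma continuousOn_lineCorr (h : IsAdmissible β ε N) (i : ℕ) :
    ContinuousOn (lineCorr β ε N S P i) (Icc 0 1) := by
  unfold lineCorr
  split_ifs
  · exact h.pl_continuousOn _
  · exact continuousOn_const

lemma continuousOn_stripError (h : IsAdmissible β ε N) (hβ : 0 < β) (hS : SmoothBound M S) {i : ℕ}
    (hi : i < N) : ContinuousOn (stripError β ε N S P i)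
      (Icc (meshX β ε N i) (meshX β ε N (i + 1)) ×ˢ Icc (0 : ℝ) 1) := by
  have hc : ∀ k, ContinuousOn (fun p : ℝ × ℝ => lineCorr β ε N S P k p.2)
      (Icc (meshX β ε N i) (meshX β ε N (i + 1)) ×ˢ Icc (0 : ℝ) 1) := fun k =>
    (continuousOn_lineCorr h k).comp continuousOn_snd fun p hp => hp.2
  exact (continuousOn_error h hβ hS hi).add (((hc _).sub (hc _)).div_const _)

/-- The inner integral of the convection term over the horizontal line at height `y`. -/
noncomputable def lineIntegral (β ε : ℝ) (N : ℕ) (S P b v : ℝ × ℝ → ℝ) (y : ℝ) : ℝ :=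
  ∑ i ∈ Finset.range N, ∫ x in meshX β ε N i..meshX β ε N (i + 1),
    b (x, y) * stripError β ε N S P i (x, y) * v (x, y)

lemma continuousOn_line_integrand (h : IsAdmissible β ε N) (hβ : 0 < β) (hS : SmoothBound M S)
    (hb : ContinuousOn b OmBar) (hv : v ∈ femSpace β ε N) {i : ℕ} (hi : i < N) :
    ContinuousOn (fun p => b p * stripError β ε N S P i p * v p)
      (Icc (meshX β ε N i) (meshX β ε N (i + 1)) ×ˢ Icc (0 : ℝ) 1) := by
  have hsub : Icc (meshX β ε N i) (meshX β ε N (i + 1)) ×ˢ Icc (0 : ℝ) 1 ⊆ OmBar :=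
    prod_mono (h.cellX_subset hβ hi) Subset.rfl
  exact ((hb.mono hsub).mul (continuousOn_stripError h hβ hS hi)).mul (hv.1.mono hsub)

lemma integral_convection (h : IsAdmissible β ε N) (hβ : 0 < β) (hS : SmoothBound M S)
    (hP : IsTransitionInterp β ε N S P) (hb : ContinuousOn b OmBar)
    (hv : v ∈ femSpace β ε N) :
    IntervalIntegrable (lineIntegral β ε N S P b v) volume 0 1 ∧
      ∫ p in Om, -b p * pdx (S - newInterp β ε N S P) p * v p =
        -∫ y in (0 : ℝ)..1, lineIntegral β ε N S P b v y := by
  have hc : ∀ i < N, _ := fun i hi =>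
    continuousOn_line_integrand (P := P) h hβ hS hb hv hi
  have hsl : ∀ i ∈ Finset.range N, IntervalIntegrable (fun y =>
      ∫ x in meshX β ε N i..meshX β ε N (i + 1),
        b (x, y) * stripError β ε N S P i (x, y) * v (x, y)) volume 0 1 := fun i hi =>
    intervalIntegrable_slice (h.meshX_lt hβ i (Finset.mem_range.1 hi)).le zero_le_one
      (hc i (Finset.mem_range.1 hi))
  have key : ∀ i < N, _ := fun i hi => integral_rect (h.meshX_lt hβ i hi).le zero_le_one
    (G := fun p => -(b p * stripError β ε N S P i p * v p))
    (g := fun p => -b p * pdx (S - newInterp β ε N S P) p * v p) (hc i hi).neg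
    (fun p hp => by rw [pdx_sub_newInterp h hβ hS hP hi hp]; ring)
  have hfun : lineIntegral β ε N S P b v = ∑ i ∈ Finset.range N, fun y =>
      ∫ x in meshX β ε N i..meshX β ε N (i + 1),
        b (x, y) * stripError β ε N S P i (x, y) * v (x, y) := by
    ext y; simp [lineIntegral]
  constructor
  · rw [hfun]; exact IntervalIntegrable.sum _ hsl
  · rw [(integral_Om_eq_sum (h.meshX_lt hβ) IsAdmissible.meshX_zero h.meshX_last
      (fun i hi => (key i hi).1)).2]
    simp only [lineIntegral]
    rw [intervalIntegral.integral_finsetSum hsl, ← Finset.sum_neg_distrib]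
    refine Finset.sum_congr rfl fun i hi => ?_
    rw [(key i (Finset.mem_range.1 hi)).2]
    simp only [intervalIntegral.integral_neg]

end NewInterp

end Bakhvalov

namespace Bakhvalov

/-! ### The convection term on a horizontal line -/

lemma abs_affine_le {a c s x : ℝ} {g : ℝ → ℝ} (hac : a < c)
    (hg : ∀ z ∈ Icc a c, g z = g a + s * (z - a)) (hx : x ∈ Icc a c) :
    |g x| ≤ |g a| + |g c| := by
  have h0 := sub_pos.2 hac
  have e1 := hg x hx
  have e2 := hg _ (right_mem_Icc.2 hac.le)
  set r := (x - a) / (c - a) with hr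
  have hr0 : 0 ≤ r := div_nonneg (by linarith [hx.1]) h0.le
  have hr1 : r ≤ 1 := (div_le_one h0).2 (by linarith [hx.2])
  have e3 : g x = (1 - r) * g a + r * g c := by
    have : r * (c - a) = x - a := div_mul_cancel₀ _ h0.ne'
    rw [e1, e2]; linear_combination (-s) * this
  rw [e3]
  refine (abs_add_le _ _).trans ?_
  rw [abs_mul, abs_mul, abs_of_nonneg hr0, abs_of_nonneg (by linarith : 0 ≤ 1 - r)]
  exact add_le_add (mul_le_of_le_one_left (abs_nonneg _) (by linarith))
    (mul_le_of_le_one_left (abs_nonneg _) hr1)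

/-- The mean of an affine function is the average of its end values; freezing `g` costs `R`. It
serves for the means of b v over the two strips next to the corrected line. -/
lemma mean_mul_affine {a c s g₀ R : ℝ} {g w : ℝ → ℝ} (hac : a < c)
    (hw : ∀ z ∈ Icc a c, w z = w a + s * (z - a)) (hg : ContinuousOn g (Icc a c))
    (hR : ∀ x ∈ Icc a c, |g x - g₀| ≤ R) :
    |(∫ x in a..c, g x * w x) / (c - a) - g₀ * ((w a + w c) / 2)| ≤ R * (|w a| + |w c|) := by
  have h0 := sub_pos.2 hac
  have uI : uIcc a c = Icc a c := uIcc_of_le hac.le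
  have cw : ContinuousOn w (Icc a c) :=
    ContinuousOn.congr (f := fun x => w a + s * (x - a)) (by fun_prop) hw
  have ii : ∀ {f : ℝ → ℝ}, ContinuousOn f (Icc a c) → IntervalIntegrable f volume a c :=
    fun hf => ContinuousOn.intervalIntegrable (by rwa [uI])
  have e1 : ∫ x in a..c, w x = (c - a) * ((w a + w c) / 2) := by
    have : ∫ x in a..c, w x = ∫ x in a..c, (w a * (x - a) ^ 0 + s * (x - a) ^ 1) :=
      intervalIntegral.integral_congr (by
        rw [uI]; intro x hx; simp only [hw x hx]; ring)
    rw [this, intervalIntegral.integral_add, intervalIntegral.integral_const_mul,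
      intervalIntegral.integral_const_mul, integral_sub_left_pow, integral_sub_left_pow,
      hw c (right_mem_Icc.2 hac.le)]
    · push_cast; ring
    all_goals exact Continuous.intervalIntegrable (by fun_prop) _ _
  have e2 : ∫ x in a..c, g x * w x =
      (∫ x in a..c, (g x - g₀) * w x) + g₀ * ∫ x in a..c, w x := by
    rw [← intervalIntegral.integral_const_mul, ← intervalIntegral.integral_add
      (ii (by fun_prop)) (ii (by fun_prop))]
    refine intervalIntegral.integral_congr fun x _ => ?_
    ring
  have e3 := intervalIntegral.norm_integral_le_of_norm_le_const (a := a) (b := c)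
    (f := fun x => (g x - g₀) * w x) (C := R * (|w a| + |w c|)) (fun x hx => by
      rw [uIoc_of_le hac.le] at hx
      have hx' := Ioc_subset_Icc_self hx
      rw [Real.norm_eq_abs, abs_mul]
      exact mul_le_mul (hR x hx') (abs_affine_le hac hw hx') (abs_nonneg _)
        ((abs_nonneg _).trans (hR x hx')))
  rw [Real.norm_eq_abs, abs_of_pos h0] at e3
  have e4 : (∫ x in a..c, g x * w x) / (c - a) - g₀ * ((w a + w c) / 2) =
      (∫ x in a..c, (g x - g₀) * w x) / (c - a) := by
    rw [e2, e1]; field_simp; ring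
  rw [e4, abs_div, abs_of_pos h0, div_le_iff₀ h0]
  exact e3

section Line

variable {β ε M B Λ : ℝ} {N : ℕ} {S P v b : ℝ × ℝ → ℝ}

/-- The density on the line `x = x_{N/2}` whose moments are controlled by the construction
of `𝒫S`. -/
noncomputable def residual (β ε : ℝ) (N : ℕ) (S P : ℝ × ℝ → ℝ) (y : ℝ) : ℝ :=
  (meshX β ε N (N / 2 + 1) - meshX β ε N (N / 2)) ^ 2 / 12 * pd 2 0 S (transX β ε, y) +
    corrFun β ε N S P y / 2

lemma abs_corrFun_le (h : IsAdmissible β ε N) (hβ : 0 < β) (hS : SmoothBound M S)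
    (hP : IsTransitionInterp β ε N S P) {y : ℝ} (hy : y ∈ Icc (0 : ℝ) 1) :
    |corrFun β ε N S P y| ≤ corrConst β M / N ^ 2 := by
  rw [← IsAdmissible.meshY_zero (ε := ε) (N := N), ← h.meshY_last] at hy
  exact abs_pl_le h.meshY_lt (by have := h.four_le; omega)
    (fun j _ => abs_corr_le h hβ hS hP j) hy

/-- The error splits into T (interpolation in x), δ (interpolation of x-increments in y) and the
correction z. The boundary term left by `line_estimate` and the half of the correction sitting at
x_{N/2} together form b · `residual` · v, which is moved to the left side; all the rest is small. -/
lemma lineIntegral_bound (h : IsAdmissible β ε N) (hβ : 0 < β) (hS : SmoothBound M S)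
    (hP : IsTransitionInterp β ε N S P) (hv : v ∈ femSpace β ε N)
    (hb : ContinuousOn b OmBar) (hB : ∀ p ∈ OmBar, |b p| ≤ B) (hΛ0 : 0 ≤ Λ)
    (hΛ : ∀ x ∈ Icc (0 : ℝ) 1, ∀ y ∈ Icc (0 : ℝ) 1, ∀ x' ∈ Icc (0 : ℝ) 1,
      ∀ y' ∈ Icc (0 : ℝ) 1, |b (x, y) - b (x', y')| ≤ Λ * (|x - x'| + |y - y'|))
    {y : ℝ} (hy : y ∈ Icc (0 : ℝ) 1) :
    |lineIntegral β ε N S P b v y +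
        b (transX β ε, y) * residual β ε N S P y * v (transX β ε, y)| ≤
      B * (M * (5 / β / N)) * (∫ x in (0 : ℝ)..transX β ε, |v (x, y)|) +
      (4 * (2 * Λ * M + 13 * B * M) + 100 * M * B) / N ^ 2 * (∫ x in (0 : ℝ)..1, |v (x, y)|) +
      corrConst β M / N ^ 2 * (B * |v (meshX β ε N (N / 2 - 2), y)| +
        Λ * transX β ε * (|v (meshX β ε N (N / 2 - 2), y)| +
          2 * |v (meshX β ε N (N / 2 - 1), y)| + |v (transX β ε, y)|)) := by
  obtain ⟨hm, hm0, hn, hq, hqr, hr, -⟩ := h.index_facts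
  have hM := hS.nonneg
  have hN := h.cast_pos
  have hlt := h.meshX_lt hβ
  set X := meshX β ε N with hX
  have X0 : X 0 = 0 := IsAdmissible.meshX_zero
  have XN : X N = 1 := h.meshX_last
  have Xn : X (N / 2) = transX β ε := h.meshX_half
  have hmem : ∀ i ≤ N, X i ∈ Icc (0 : ℝ) 1 := fun i hi => h.meshX_mem hβ hi
  have hsub : ∀ i < N, Icc (X i) (X (i + 1)) ⊆ Icc (0 : ℝ) 1 := fun i hi =>
    h.cellX_subset hβ hi
  have cv := continuousOn_slice_x hv.1 hy
  have cb := continuousOn_slice_x hb hy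
  have cS := continuousOn_slice_x hS.smooth_pdx.continuousOn hy
  have B0 : 0 ≤ B := (abs_nonneg _).trans (hB (0, 0) (by simp [OmBar]))
  have hlin := fun i (hi : i < N) => fem_linear_x h hβ hv hy hi
  set D := corrFun β ε N S P y with hD
  set V₁ := ∫ x in (0 : ℝ)..1, |v (x, y)| with hV₁
  set Vf := ∫ x in (0 : ℝ)..transX β ε, |v (x, y)| with hVf
  have V₁0 : 0 ≤ V₁ := intervalIntegral.integral_nonneg zero_le_one fun x _ => abs_nonneg _
  set H := X (N / 2 + 1) - X (N / 2) with hH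
  have H0 : 0 < H := sub_pos.2 (hlt _ hn)
  have HN : H ^ 2 ≤ 4 / N ^ 2 := by
    calc H ^ 2 ≤ (2 / (N : ℝ)) ^ 2 := pow_le_pow_left₀ H0.le (h.coarse_width_le hβ) 2
      _ = _ := by rw [div_pow]; norm_num
  -- splitting of the integrals over the strips
  set I : ℕ → ℝ := fun i => ∫ x in X i..X (i + 1), b (x, y) * v (x, y) with hI
  set T : ℕ → ℝ := fun i => ∫ x in X i..X (i + 1), b (x, y) * (pdx S (x, y) -
    (S (X (i + 1), y) - S (X i, y)) / (X (i + 1) - X i)) * v (x, y) with hT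
  set δ : ℕ → ℝ := fun i => ((S (X (i + 1), y) - S (X i, y)) -
    (nodal β ε N S (i + 1) y - nodal β ε N S i y)) / (X (i + 1) - X i) with hδ
  set z : ℕ → ℝ := fun i => lineCorr β ε N S P i y with hz
  have split : lineIntegral β ε N S P b v y = (∑ i ∈ Finset.range N, T i) +
      (∑ i ∈ Finset.range N, δ i * I i) +
      ∑ i ∈ Finset.range N, (z (i + 1) - z i) / (X (i + 1) - X i) * I i := by
    rw [lineIntegral, ← Finset.sum_add_distrib, ← Finset.sum_add_distrib]
    refine Finset.sum_congr rfl fun i hi => ?_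
    have hi := Finset.mem_range.1 hi
    have ii : ∀ {g : ℝ → ℝ}, ContinuousOn g (Icc 0 1) →
        IntervalIntegrable g volume (X i) (X (i + 1)) := fun hg =>
      ContinuousOn.intervalIntegrable (by
        rw [uIcc_of_le (hlt i hi).le]; exact hg.mono (hsub i hi))
    have cT : ContinuousOn (fun x => b (x, y) * (pdx S (x, y) -
        (S (X (i + 1), y) - S (X i, y)) / (X (i + 1) - X i)) * v (x, y)) (Icc 0 1) :=
      (cb.mul (cS.sub continuousOn_const)).mul cv
    have cc : ∀ r : ℝ, ContinuousOn (fun x => r * (b (x, y) * v (x, y))) (Icc 0 1) :=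
      fun r => continuousOn_const.mul (cb.mul cv)
    have cTc : ∀ r : ℝ, ContinuousOn (fun x => b (x, y) * (pdx S (x, y) -
        (S (X (i + 1), y) - S (X i, y)) / (X (i + 1) - X i)) * v (x, y) +
        r * (b (x, y) * v (x, y))) (Icc 0 1) := fun r => cT.add (cc r)
    simp only [hT, hI]
    rw [← intervalIntegral.integral_const_mul, ← intervalIntegral.integral_const_mul,
      ← intervalIntegral.integral_add (ii cT) (ii (cc _)),
      ← intervalIntegral.integral_add (ii (cTc _)) (ii (cc _))]
    refine intervalIntegral.integral_congr fun x _ => ?_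
    simp only [stripError, hδ, hz, ← hX]
    ring
  -- the interpolation error in the `x`-direction
  have p1 : |(∑ i ∈ Finset.range N, T i) +
      H ^ 2 / 12 * (b (transX β ε, y) * pd 2 0 S (transX β ε, y) * v (transX β ε, y))| ≤
      B * (M * (5 / β / N)) * Vf + 4 * (2 * Λ * M + 13 * B * M) / N ^ 2 * V₁ := by
    have d1 : ∀ {g g' : ℝ → ℝ}, (∀ x ∈ Icc (0 : ℝ) 1, HasDerivWithinAt g (g' x) (Icc 0 1) x) →
        ∀ x ∈ Icc (X 0) (X N), HasDerivWithinAt g (g' x) (Icc (X 0) (X N)) x := by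
      rw [X0, XN]; exact fun hg => hg
    have hle := line_estimate hlt hn.le (f := fun x => S (x, y)) (f' := fun x => pdx S (x, y))
      (f'' := fun x => pd 2 0 S (x, y)) (f''' := fun x => pd 3 0 S (x, y))
      (w := fun x => b (x, y)) (v := fun x => v (x, y)) (M := M) (B := B) (Λ := Λ)
      (κ := 5 / β / N) (H := H) hM hΛ0
      (fun i hi => (h.meshX_fine_step hβ hi).2) (fun i hi _ => h.meshX_step_eq hi)
      (d1 fun x hx => hS.hasDeriv_x hy hx) (d1 fun x hx => hS.hasDeriv_xx hy hx)
      (d1 fun x hx => hS.hasDeriv_xxx hy hx)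
      (by rw [X0, XN]; exact fun x hx => hS.bound 2 0 (by norm_num) _ (mem_OmBar hx hy))
      (by rw [X0, XN]; exact fun x hx => hS.bound 3 0 (by norm_num) _ (mem_OmBar hx hy))
      (by rw [X0, XN]; exact cb)
      (by rw [X0, XN]; exact fun x hx => hB _ (mem_OmBar hx hy))
      (by
        rw [X0, XN]; intro x hx x' hx'
        have := hΛ x hx y hy x' hx' y hy
        rwa [sub_self, abs_zero, add_zero] at this)
      (by rw [X0, XN]; exact cv) hlin (by rw [XN]; exact fem_right hv hy)
    rw [X0, XN, Xn] at hle
    refine hle.trans (add_le_add le_rfl ?_)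
    have hV : ∫ x in transX β ε..1, |v (x, y)| ≤ V₁ := by
      have hm := hmem _ hn.le
      rw [Xn] at hm
      refine intervalIntegral.integral_mono_interval hm.1 hm.2 le_rfl
        (Filter.Eventually.of_forall fun x => abs_nonneg _) (ContinuousOn.intervalIntegrable ?_)
      rw [uIcc_of_le zero_le_one]; exact cv.abs
    have hV0 : 0 ≤ ∫ x in transX β ε..1, |v (x, y)| := by
      have hm := hmem _ hn.le
      rw [Xn] at hm
      exact intervalIntegral.integral_nonneg hm.2 fun x _ => abs_nonneg _
    calc _ ≤ (2 * Λ * M + 13 * B * M) * (4 / N ^ 2) * V₁ := by gcongr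
      _ = _ := by ring
  -- the interpolation error in the `y`-direction
  have p2 : |∑ i ∈ Finset.range N, δ i * I i| ≤ 100 * M * B / N ^ 2 * V₁ := by
    have cv' : ContinuousOn (fun x => v (x, y)) (Icc (X 0) (X N)) := by rw [X0, XN]; exact cv
    have hVsum := sum_integral_cells hlt cv'.abs (Nat.zero_le N) le_rfl
    rw [X0, XN, ← Finset.range_eq_Ico] at hVsum
    rw [hV₁, ← hVsum, Finset.mul_sum]
    refine (Finset.abs_sum_le_sum_abs _ _).trans (Finset.sum_le_sum fun i hi => ?_)
    have hi := Finset.mem_range.1 hi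
    have h0 := sub_pos.2 (hlt i hi)
    have ii : ∀ {g : ℝ → ℝ}, ContinuousOn g (Icc 0 1) →
        IntervalIntegrable g volume (X i) (X (i + 1)) := fun hg =>
      ContinuousOn.intervalIntegrable (by
        rw [uIcc_of_le (hlt i hi).le]; exact hg.mono (hsub i hi))
    have h1 : |δ i| ≤ 100 * M / N ^ 2 := by
      have := nodal_increment h hβ hS hi hy
      rw [← div_le_iff₀ h0, ← abs_of_pos h0, ← abs_div] at this
      refine this.trans (le_of_eq ?_)
      rw [div_pow]; ring
    have h2 : |I i| ≤ B * ∫ x in X i..X (i + 1), |v (x, y)| := by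
      rw [← intervalIntegral.integral_const_mul]
      refine (intervalIntegral.abs_integral_le_integral_abs (hlt i hi).le).trans ?_
      refine intervalIntegral.integral_mono_on (hlt i hi).le (ii (cb.mul cv).abs)
        (ii (continuousOn_const.mul cv.abs)) fun x hx => ?_
      rw [abs_mul]
      exact mul_le_mul_of_nonneg_right (hB _ (mem_OmBar (hsub i hi hx) hy)) (abs_nonneg _)
    rw [abs_mul]
    calc _ ≤ 100 * M / N ^ 2 * (B * ∫ x in X i..X (i + 1), |v (x, y)|) :=
          mul_le_mul h1 h2 (abs_nonneg _) (by positivity)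
      _ = _ := by ring
  -- the correction
  have hm2 : N / 2 - 2 + 1 = N / 2 - 1 := by omega
  -- Only the two strips adjacent to the line N/2 - 1 see the correction, with opposite signs.
  have e3 : ∑ i ∈ Finset.range N, (z (i + 1) - z i) / (X (i + 1) - X i) * I i =
      D * (I (N / 2 - 2) / (X (N / 2 - 1) - X (N / 2 - 2)) -
        I (N / 2 - 1) / (X (N / 2) - X (N / 2 - 1))) := by
    rw [Finset.sum_eq_add_of_mem (N / 2 - 2) (N / 2 - 1) (Finset.mem_range.2 (by omega))
      (Finset.mem_range.2 (by omega)) (by omega)]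
    · simp only [hz, lineCorr, hm2, hm, if_true]
      rw [if_neg (by omega), if_neg (by omega)]
      ring
    · intro i _ hi
      simp only [hz, lineCorr]
      rw [if_neg (by omega), if_neg (by omega)]
      simp
  have hclose : ∀ i < N / 2, ∀ x ∈ Icc (X i) (X (i + 1)),
      |b (x, y) - b (transX β ε, y)| ≤ Λ * transX β ε := by
    intro i hi x hx
    have hx1 : x ≤ transX β ε := by
      rw [← Xn]; exact hx.2.trans (mesh_le hlt hi hn.le)
    have hx0 := hsub i (by omega) hx
    have hm := hmem _ hn.le
    rw [Xn] at hm
    have := hΛ x hx0 y hy _ hm y hy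
    rw [sub_self, abs_zero, add_zero] at this
    refine this.trans (mul_le_mul_of_nonneg_left ?_ hΛ0)
    rw [abs_le]; constructor <;> linarith [hx0.1]
  have avg : ∀ i < N / 2, |I i / (X (i + 1) - X i) -
      b (transX β ε, y) * ((v (X i, y) + v (X (i + 1), y)) / 2)| ≤
      Λ * transX β ε * (|v (X i, y)| + |v (X (i + 1), y)|) := by
    intro i hi
    obtain ⟨s, hs⟩ := hlin i (by omega)
    exact mean_mul_affine (g := fun x => b (x, y)) (w := fun x => v (x, y)) (hlt i (by omega)) hs
      (cb.mono (hsub i (by omega))) (hclose i hi)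
  have a1 := avg (N / 2 - 2) (by omega)
  have a2 := avg (N / 2 - 1) (by omega)
  rw [hm2] at a1
  rw [hm, Xn] at a2
  rw [Xn] at e3
  set b₀ := b (transX β ε, y)
  set w₀ := v (transX β ε, y)
  set w₁ := v (X (N / 2 - 1), y)
  set w₂ := v (X (N / 2 - 2), y)
  have hDle : |D| ≤ corrConst β M / N ^ 2 := abs_corrFun_le h hβ hS hP hy
  have hc0 : 0 ≤ corrConst β M / N ^ 2 := (abs_nonneg _).trans hDle
  have hb₀ : |b₀| ≤ B := by
    have hm := hmem _ hn.le
    rw [Xn] at hm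
    exact hB _ (mem_OmBar hm hy)
  set Q₂ := I (N / 2 - 2) / (X (N / 2 - 1) - X (N / 2 - 2))
  set Q₁ := I (N / 2 - 1) / (transX β ε - X (N / 2 - 1))
  have p3 : |D * (Q₂ - Q₁) + b₀ * (D / 2) * w₀| ≤ corrConst β M / N ^ 2 * (B * |w₂| +
        Λ * transX β ε * (|w₂| + 2 * |w₁| + |w₀|)) := by
    -- The averages (w₂ + w₁)/2 and (w₁ + w₀)/2 share w₁, which cancels. The w₀ half is absorbed by
    -- the added term, and w₂ is left for the cheaper trace at x_{N/2-2}.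
    have e : D * (Q₂ - Q₁) + b₀ * (D / 2) * w₀ =
        D * (b₀ * w₂ / 2 + (Q₂ - b₀ * ((w₂ + w₁) / 2)) - (Q₁ - b₀ * ((w₁ + w₀) / 2))) := by ring
    rw [e, abs_mul]
    refine mul_le_mul hDle ?_ (abs_nonneg _) hc0
    have h1 : |b₀ * w₂ / 2| ≤ B * |w₂| := by
      rw [abs_div, abs_mul, abs_two]
      have := mul_le_mul_of_nonneg_right hb₀ (abs_nonneg w₂)
      have h2 : 0 ≤ B * |w₂| := by positivity
      linarith
    refine (abs_sub _ _).trans ?_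
    have := abs_add_le (b₀ * w₂ / 2) (Q₂ - b₀ * ((w₂ + w₁) / 2))
    linarith
  rw [split, e3]
  have e : (∑ i ∈ Finset.range N, T i) + (∑ i ∈ Finset.range N, δ i * I i) + D * (Q₂ - Q₁) +
      b₀ * residual β ε N S P y * w₀ =
      ((∑ i ∈ Finset.range N, T i) + H ^ 2 / 12 * (b₀ * pd 2 0 S (transX β ε, y) * w₀)) +
        (∑ i ∈ Finset.range N, δ i * I i) + (D * (Q₂ - Q₁) + b₀ * (D / 2) * w₀) := by
    rw [residual, ← hX, ← hH, ← hD]; ring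
  rw [e]
  refine (abs_add_le _ _).trans ((add_le_add ((abs_add_le _ _).trans (add_le_add p1 p2)) p3).trans
    (le_of_eq ?_))
  ring

end Line

end Bakhvalov

namespace Bakhvalov

/-! ### The residual on the line `x = x_{N/2}` -/

/-- Passes from cells to nodes: each interior node collects the two halves of its hat function, the
form in which the moment conditions apply. -/
lemma sum_regroup (g α γ : ℕ → ℝ) {q r : ℕ} (h : q < r) :
    ∑ j ∈ Finset.Ico q r, (g j * α j + g (j + 1) * γ j) =
      g q * α q + g r * γ (r - 1) +
        ∑ j ∈ Finset.Ico (q + 1) r, g j * (α j + γ (j - 1)) := by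
  induction r, h using Nat.le_induction with
  | base => simp
  | succ k hk ih =>
    rw [Finset.sum_Ico_succ_top (by omega), ih, Finset.sum_Ico_succ_top (by omega),
      Nat.add_sub_cancel]
    ring

section Residual

variable {β ε M B Λ : ℝ} {N : ℕ} {S P v b : ℝ × ℝ → ℝ}

/-- The constant in the bound of the residual. -/
noncomputable def resConst (β M : ℝ) : ℝ := M + corrConst β M

lemma resConst_nonneg (hβ : 0 < β) (hM : 0 ≤ M) : 0 ≤ resConst β M :=
  add_nonneg hM (corrConst_nonneg hβ hM)

lemma transX_mem (h : IsAdmissible β ε N) (hβ : 0 < β) : transX β ε ∈ Icc (0 : ℝ) 1 := by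
  rw [← h.meshX_half]; exact h.meshX_mem hβ (Nat.div_le_self _ _)

lemma continuousOn_residual (h : IsAdmissible β ε N) (hβ : 0 < β) (hS : SmoothBound M S) :
    ContinuousOn (residual β ε N S P) (Icc 0 1) := by
  have h1 := continuousOn_slice_y hS.smooth_pdx_pdx.continuousOn (transX_mem h hβ)
  exact (continuousOn_const.mul h1).add ((h.pl_continuousOn _).div_const 2)

lemma abs_residual_le (h : IsAdmissible β ε N) (hβ : 0 < β) (hS : SmoothBound M S)
    (hP : IsTransitionInterp β ε N S P) {y : ℝ} (hy : y ∈ Icc (0 : ℝ) 1) :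
    |residual β ε N S P y| ≤ resConst β M / N ^ 2 := by
  obtain ⟨hm, hm0, hn, hq, hqr, hr, -⟩ := h.index_facts
  have hN := h.cast_pos
  have hM := hS.nonneg
  have h1 : |pd 2 0 S (transX β ε, y)| ≤ M :=
    hS.bound 2 0 (by norm_num) _ (mem_OmBar (transX_mem h hβ) hy)
  have h2 := abs_corrFun_le h hβ hS hP hy
  have hH : (meshX β ε N (N / 2 + 1) - meshX β ε N (N / 2)) ^ 2 / 12 ≤ 1 / N ^ 2 := by
    have h1 := h.coarse_width_le hβ
    have h0 := (sub_pos.2 (h.meshX_lt hβ _ hn)).le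
    calc _ ≤ (2 / (N : ℝ)) ^ 2 / 12 := by gcongr
      _ = 1 / 3 * (1 / N ^ 2) := by field_simp; norm_num
      _ ≤ 1 * (1 / N ^ 2) := by gcongr; norm_num
      _ = _ := one_mul _
  rw [residual]
  refine (abs_add_le _ _).trans ?_
  rw [abs_mul, abs_of_nonneg (by positivity : 0 ≤
    (meshX β ε N (N / 2 + 1) - meshX β ε N (N / 2)) ^ 2 / 12), abs_div, abs_two]
  calc _ ≤ 1 / (N : ℝ) ^ 2 * M + corrConst β M / N ^ 2 := by
        refine add_le_add (mul_le_mul hH h1 (abs_nonneg _) (by positivity)) ?_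
        have := abs_nonneg (corrFun β ε N S P y)
        linarith
    _ = _ := by rw [resConst]; ring

/-- The moments of the residual. -/
lemma residual_moment (h : IsAdmissible β ε N) (hβ : 0 < β) (hS : SmoothBound M S)
    (hP : IsTransitionInterp β ε N S P) {j : ℕ} (hj : N / 4 < j) (hj' : j < 3 * N / 4) :
    |(∫ y in meshY ε N j..meshY ε N (j + 1), residual β ε N S P y * hat (meshY ε N) j y) +
      ∫ y in meshY ε N (j - 1)..meshY ε N (j - 1 + 1),
        residual β ε N S P y * hat (meshY ε N) (j - 1 + 1) y| ≤
      2 * (5 / β * M + 25 * M) / N * transX β ε * (2 * (1 - 2 * transY ε) / N) := by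
  obtain ⟨hm, hm0, hn, hq, hqr, hr, -⟩ := h.index_facts
  have hN := h.cast_pos
  have hM := hS.nonneg
  obtain ⟨i, rfl⟩ : ∃ i, j = i + 1 := ⟨j - 1, by omega⟩
  have hsys := hP.system h hβ hS hj hj'
  have s1 := h.meshY_middle_step (by omega) (by omega : i < 3 * N / 4)
  have s2 := h.meshY_middle_step (by omega) hj'
  have key := integral_pl_mul_hat h.meshY_lt (by omega : i + 1 < N) s1 s2 (corr β ε N S P)
  rw [momentRhs] at hsys
  rw [Nat.add_sub_cancel] at hsys ⊢
  have hxx := continuousOn_slice_y hS.smooth_pdx_pdx.continuousOn (transX_mem h hβ)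
  have split : ∀ i' < N, ∫ y in meshY ε N i'..meshY ε N (i' + 1),
      residual β ε N S P y * hat (meshY ε N) (i + 1) y =
      (meshX β ε N (N / 2 + 1) - meshX β ε N (N / 2)) ^ 2 / 12 *
        (∫ y in meshY ε N i'..meshY ε N (i' + 1),
          pd 2 0 S (transX β ε, y) * hat (meshY ε N) (i + 1) y) +
      (1 / 2) * ∫ y in meshY ε N i'..meshY ε N (i' + 1),
        pl (meshY ε N) N (corr β ε N S P) y * hat (meshY ε N) (i + 1) y := by
    intro i' hi'
    rw [← intervalIntegral.integral_const_mul, ← intervalIntegral.integral_const_mul,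
      ← intervalIntegral.integral_add]
    · refine intervalIntegral.integral_congr fun y _ => ?_
      simp only [residual, corrFun]; ring
    · exact (intervalIntegrable_mul_hat h (by omega) hi'
        (intervalIntegrable_cellY h hi' hxx)).const_mul _
    · exact (intervalIntegrable_mul_hat h (by omega) hi'
        (intervalIntegrable_cellY h hi' (h.pl_continuousOn _))).const_mul _
  rw [split i (by omega), split (i + 1) (by omega)]
  rw [h.meshX_half] at hsys
  -- By the moment conditions the moments of the residual are those of `stripMean`. The strip's
  -- width is bounded here by x_{N/2} rather than by O(1/N), which keeps the smallness in ε.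
  have hmean : ∀ y ∈ Icc (0 : ℝ) 1, |stripMean β ε N S y| ≤
      (5 / β * M + 25 * M) / N * transX β ε := by
    intro y hy
    refine (abs_stripMean_le h hβ hS hy).trans (mul_le_mul_of_nonneg_left ?_ (by positivity))
    rw [h.meshX_half]
    linarith [(h.meshX_mem hβ (by omega : N / 2 - 1 ≤ N)).1]
  have a1 := abs_integral_mul_hat_le h (by omega : i < N) (by omega : i + 1 ≤ N) hmean
  have a2 := abs_integral_mul_hat_le h (by omega : i + 1 < N) (by omega : i + 1 ≤ N) hmean
  rw [s1] at a1
  rw [s2] at a2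
  refine le_trans (le_of_eq ?_) ((abs_add_le _ _).trans ((add_le_add a1 a2).trans
    (le_of_eq (by ring))))
  congr 1
  rw [h.meshX_half]
  linarith

/-- The product b v is replaced by its piecewise linear interpolant in y, so that the residual is
tested with hat functions only. The replacement gains a factor 1/N from the Lipschitz bound on `b`,
enough to afford `trace_L1_coarse`. The nodal sums carry x_{N/2} from `residual_moment`, which pays
for `trace_L1`. -/
lemma residual_middle (h : IsAdmissible β ε N) (hβ : 0 < β) (hS : SmoothBound M S)
    (hP : IsTransitionInterp β ε N S P) (hv : v ∈ femSpace β ε N)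
    (hb : ContinuousOn b OmBar) (hB : ∀ p ∈ OmBar, |b p| ≤ B) (hB0 : 0 ≤ B) (hΛ0 : 0 ≤ Λ)
    (hΛ : ∀ x ∈ Icc (0 : ℝ) 1, ∀ y ∈ Icc (0 : ℝ) 1, ∀ x' ∈ Icc (0 : ℝ) 1,
      ∀ y' ∈ Icc (0 : ℝ) 1, |b (x, y) - b (x', y')| ≤ Λ * (|x - x'| + |y - y'|)) :
    |∫ y in meshY ε N (N / 4)..meshY ε N (3 * N / 4),
        b (transX β ε, y) * residual β ε N S P y * v (transX β ε, y)| ≤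
      (64 * Λ * resConst β M + 32 * B * resConst β M) / N ^ 2 * energyNorm ε v +
      8 * B * (5 / β * M + 25 * M) * ((N : ℝ)⁻¹ * (transX β ε * √(transX β ε / ε))) *
        energyNorm ε v := by
  obtain ⟨hm, hm0, hn, hq, hqr, hr, hqr'⟩ := h.index_facts
  have hN := h.cast_pos
  have hM := hS.nonneg
  have hlt := h.meshY_lt
  have hX := transX_mem h hβ
  have hε := h.eps_pos
  have hR := resConst_nonneg hβ hM
  have hk := h.middle_width_pos
  have hk2 := h.middle_width_le
  set k := 2 * (1 - 2 * transY ε) / N with hkdef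
  set Y := meshY ε N with hY
  have Y0 : Y 0 = 0 := IsAdmissible.meshY_zero
  have YN : Y N = 1 := h.meshY_last
  set en := energyNorm ε v
  have en0 : 0 ≤ en := energyNorm_nonneg
  set F := residual β ε N S P with hF
  set g : ℝ → ℝ := fun y => b (transX β ε, y) with hg
  set w : ℝ → ℝ := fun y => v (transX β ε, y) with hw
  have cg : ContinuousOn g (Icc 0 1) := continuousOn_slice_y hb hX
  have cw : ContinuousOn w (Icc 0 1) := continuousOn_slice_y hv.1 hX
  have cF : ContinuousOn F (Icc 0 1) := continuousOn_residual h hβ hS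
  have hFle : ∀ y ∈ Icc (0 : ℝ) 1, |F y| ≤ resConst β M / N ^ 2 := fun y hy =>
    abs_residual_le h hβ hS hP hy
  have hgle : ∀ y ∈ Icc (0 : ℝ) 1, |g y| ≤ B := fun y hy => hB _ (mem_OmBar hX hy)
  have hlin := fun j (hj : j < N) => fem_linear_y h hv hX hj
  have hstep : ∀ j ∈ Finset.Ico (N / 4) (3 * N / 4), Y (j + 1) - Y j = k := fun j hj =>
    h.meshY_middle_step (Finset.mem_Ico.1 hj).1 (Finset.mem_Ico.1 hj).2
  set W : ℕ → ℝ := fun j => ∫ y in Y j..Y (j + 1), |w y| with hW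
  have W0 : ∀ j < N, 0 ≤ W j := fun j hj =>
    intervalIntegral.integral_nonneg (hlt j hj).le fun y _ => abs_nonneg _
  have hnodes : ∀ j ∈ Finset.Ico (N / 4) (3 * N / 4),
      k * |w (Y j)| ≤ 4 * W j ∧ k * |w (Y (j + 1))| ≤ 4 * W j := fun j hj => by
    have hjN : j < N := by have := (Finset.mem_Ico.1 hj).2; omega
    have := mul_abs_nodes_le hlt hlin hjN
    rw [hstep j hj] at this
    exact this
  have hsumW : ∑ j ∈ Finset.Ico (N / 4) (3 * N / 4), W j =
      ∫ y in Y (N / 4)..Y (3 * N / 4), |w y| :=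
    sum_integral_cells hlt (by rw [Y0, YN]; exact cw.abs) hqr.le hr.le
  have Yq := h.meshY_mem (by omega : N / 4 ≤ N)
  have Yr := h.meshY_mem hr.le
  have Yqr : Y (N / 4) ≤ Y (3 * N / 4) := mesh_le hlt hqr.le hr.le
  have hWcoarse : ∑ j ∈ Finset.Ico (N / 4) (3 * N / 4), W j ≤ 2 * √N * en := by
    rw [hsumW]
    refine (trace_L1_coarse h hβ hv Yq.1 Yqr Yr.2).trans ?_
    have : √(Y (3 * N / 4) - Y (N / 4)) ≤ 1 := by
      exact Real.sqrt_le_one.2 (by linarith [Yq.1, Yr.2])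
    exact mul_le_mul_of_nonneg_right (mul_le_of_le_one_left (by positivity) this) en0
  have hWfine : ∑ j ∈ Finset.Ico (N / 4) (3 * N / 4), W j ≤ √(transX β ε / ε) * en := by
    rw [hsumW]
    have := trace_L1 h hβ hv hn.le Yq.1 Yqr Yr.2
    rw [h.meshX_half] at this
    refine this.trans (mul_le_mul_of_nonneg_right ?_ en0)
    refine mul_le_of_le_one_left (Real.sqrt_nonneg _) ?_
    exact Real.sqrt_le_one.2 (by linarith [Yq.1, Yr.2])
  -- On one cell √k from Cauchy–Schwarz compensates the √N of the coarse trace, because kN ≤ 2.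
  have hWend : ∀ j ∈ Finset.Ico (N / 4) (3 * N / 4), W j ≤ 4 * en := fun j hj => by
    have hjN : j < N := by have := (Finset.mem_Ico.1 hj).2; omega
    refine (trace_L1_coarse h hβ hv (h.meshY_mem hjN.le).1 (hlt j hjN).le
      (h.meshY_mem hjN).2).trans (mul_le_mul_of_nonneg_right ?_ en0)
    rw [← hY, hstep j hj, mul_left_comm, ← Real.sqrt_mul hk.le]
    have : √(k * N) ≤ 2 := by
      rw [Real.sqrt_le_left (by norm_num)]
      have := mul_le_mul_of_nonneg_right hk2 hN.le
      have h2 : (2 : ℝ) / N * N = 2 := div_mul_cancel₀ _ hN.ne'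
      linarith
    linarith
  set α : ℕ → ℝ := fun j => ∫ y in Y j..Y (j + 1), F y * hat Y j y with hα
  set γ : ℕ → ℝ := fun j => ∫ y in Y j..Y (j + 1), F y * hat Y (j + 1) y with hγ
  set G : ℕ → ℝ := fun j => g (Y j) * w (Y j) with hG
  have hGle : ∀ j ≤ N, |G j| ≤ B * |w (Y j)| := fun j hj => by
    simp only [hG, abs_mul]
    exact mul_le_mul_of_nonneg_right (hgle _ (h.meshY_mem hj)) (abs_nonneg _)
  -- replacement of `b v` by its piecewise linear interpolant
  have hcell : ∀ j ∈ Finset.Ico (N / 4) (3 * N / 4),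
      |(∫ y in Y j..Y (j + 1), g y * F y * w y) - (G j * α j + G (j + 1) * γ j)| ≤
        16 * Λ * resConst β M / N ^ 3 * W j := by
    intro j hj
    have hjN : j < N := by have := (Finset.mem_Ico.1 hj).2; omega
    have hsub := h.cellY_subset hjN
    have c1 := h.hat_continuousOn hjN.le
    have c2 := h.hat_continuousOn (Nat.succ_le_of_lt hjN)
    have mj := left_mem_Icc.2 (hlt j hjN).le
    have mj' := right_mem_Icc.2 (hlt j hjN).le
    have cA : ContinuousOn (fun y => g y * F y * w y) (Icc 0 1) := (cg.mul cF).mul cw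
    have cB : ContinuousOn (fun y => G j * (F y * hat Y j y)) (Icc 0 1) :=
      continuousOn_const.mul (cF.mul c1)
    have cC : ContinuousOn (fun y => G (j + 1) * (F y * hat Y (j + 1) y)) (Icc 0 1) :=
      continuousOn_const.mul (cF.mul c2)
    have cBC : ContinuousOn (fun y => G j * (F y * hat Y j y) +
        G (j + 1) * (F y * hat Y (j + 1) y)) (Icc 0 1) := cB.add cC
    have ii : ∀ {f : ℝ → ℝ}, ContinuousOn f (Icc 0 1) →
        IntervalIntegrable f volume (Y j) (Y (j + 1)) := fun hf =>
      intervalIntegrable_cellY h hjN hf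
    simp only [hα, hγ]
    rw [← intervalIntegral.integral_const_mul, ← intervalIntegral.integral_const_mul,
      ← intervalIntegral.integral_add (ii cB) (ii cC),
      ← intervalIntegral.integral_sub (ii cA) (ii cBC)]
    have := intervalIntegral.norm_integral_le_of_norm_le_const
      (a := Y j) (b := Y (j + 1)) (f := fun y => g y * F y * w y -
        (G j * (F y * hat Y j y) + G (j + 1) * (F y * hat Y (j + 1) y)))
      (C := resConst β M / N ^ 2 * (Λ * k * |w (Y j)| + Λ * k * |w (Y (j + 1))|)) (fun y hy => by
        rw [uIoc_of_le (hlt j hjN).le] at hy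
        have hy' := Ioc_subset_Icc_self hy
        have hw' : w y = w (Y j) * hat Y j y + w (Y (j + 1)) * hat Y (j + 1) y := by
          obtain ⟨s, hs⟩ := hlin j hjN
          have e0 : w y = w (Y j) + s * (y - Y j) := hs y hy'
          have e1 : w (Y (j + 1)) = w (Y j) + s * (Y (j + 1) - Y j) := hs _ mj'
          have h0 := (sub_pos.2 (hlt j hjN)).ne'
          rw [hat_left hlt hjN hy', hat_right hy', e0, e1]
          field_simp; ring
        have e : g y * F y * w y - (G j * (F y * hat Y j y) +
            G (j + 1) * (F y * hat Y (j + 1) y)) =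
            F y * ((g y - g (Y j)) * w (Y j) * hat Y j y +
              (g y - g (Y (j + 1))) * w (Y (j + 1)) * hat Y (j + 1) y) := by
          rw [hw']; simp only [hG]; ring
        have hdist : ∀ z ∈ Icc (Y j) (Y (j + 1)), |g y - g z| ≤ Λ * k := by
          intro z hz
          have := hΛ _ hX y (hsub hy') _ hX z (hsub hz)
          rw [sub_self, abs_zero, zero_add] at this
          refine this.trans (mul_le_mul_of_nonneg_left ?_ hΛ0)
          have hs := hstep j hj
          rw [abs_le]; constructor <;> linarith [hy'.1, hy'.2, hz.1, hz.2]
        rw [Real.norm_eq_abs, e, abs_mul]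
        refine mul_le_mul (hFle y (hsub hy')) ((abs_add_le _ _).trans (add_le_add ?_ ?_))
          (abs_nonneg _) (by positivity)
        · rw [abs_mul, abs_mul]
          exact (mul_le_of_le_one_right (by positivity) (h.abs_hat_le hjN.le (hsub hy'))).trans
            (mul_le_mul_of_nonneg_right (hdist _ mj) (abs_nonneg _))
        · rw [abs_mul, abs_mul]
          exact (mul_le_of_le_one_right (by positivity)
            (h.abs_hat_le (Nat.succ_le_of_lt hjN) (hsub hy'))).trans
            (mul_le_mul_of_nonneg_right (hdist _ mj') (abs_nonneg _)))
    rw [Real.norm_eq_abs, hstep j hj, abs_of_pos hk] at this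
    obtain ⟨n1, n2⟩ := hnodes j hj
    have Wj := W0 j hjN
    calc _ ≤ resConst β M / N ^ 2 * (Λ * k * |w (Y j)| + Λ * k * |w (Y (j + 1))|) * k := this
      _ = resConst β M / N ^ 2 * Λ * k * (k * |w (Y j)| + k * |w (Y (j + 1))|) := by ring
      _ ≤ resConst β M / N ^ 2 * Λ * (2 / N) * (4 * W j + 4 * W j) := by gcongr
      _ = _ := by field_simp; ring
  have hFn : ∀ j ∈ Finset.Ico (N / 4) (3 * N / 4), |α j| ≤ resConst β M / N ^ 2 * k ∧
      |γ j| ≤ resConst β M / N ^ 2 * k := by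
    intro j hj
    have hjN : j < N := by have := (Finset.mem_Ico.1 hj).2; omega
    have a1 := abs_integral_mul_hat_le h hjN hjN.le hFle
    have a2 := abs_integral_mul_hat_le h hjN (Nat.succ_le_of_lt hjN) hFle
    rw [← hY, hstep j hj] at a1 a2
    exact ⟨a1, a2⟩
  -- the end points
  have endq : |G (N / 4) * α (N / 4)| ≤ 16 * B * resConst β M / N ^ 2 * en := by
    -- No moment condition exists at an end node, but a single node costs only O(N^{-2}): k|w| ≤ 4W
    -- ≤ 16‖v‖_ε.
    have hj : N / 4 ∈ Finset.Ico (N / 4) (3 * N / 4) := Finset.mem_Ico.2 ⟨le_rfl, hqr⟩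
    rw [abs_mul]
    calc _ ≤ B * |w (Y (N / 4))| * (resConst β M / N ^ 2 * k) :=
          mul_le_mul (hGle _ (by omega)) (hFn _ hj).1 (abs_nonneg _) (by positivity)
      _ = B * resConst β M / N ^ 2 * (k * |w (Y (N / 4))|) := by ring
      _ ≤ B * resConst β M / N ^ 2 * (4 * (4 * en)) := by
          refine mul_le_mul_of_nonneg_left ?_ (by positivity)
          linarith [(hnodes _ hj).1, hWend _ hj]
      _ = _ := by ring
  have endr : |G (3 * N / 4) * γ (3 * N / 4 - 1)| ≤ 16 * B * resConst β M / N ^ 2 * en := by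
    have hj : 3 * N / 4 - 1 ∈ Finset.Ico (N / 4) (3 * N / 4) := Finset.mem_Ico.2 (by omega)
    have hn' := (hnodes _ hj).2
    rw [show 3 * N / 4 - 1 + 1 = 3 * N / 4 by omega] at hn'
    rw [abs_mul]
    calc _ ≤ B * |w (Y (3 * N / 4))| * (resConst β M / N ^ 2 * k) :=
          mul_le_mul (hGle _ (by omega)) (hFn _ hj).2 (abs_nonneg _) (by positivity)
      _ = B * resConst β M / N ^ 2 * (k * |w (Y (3 * N / 4))|) := by ring
      _ ≤ B * resConst β M / N ^ 2 * (4 * (4 * en)) := by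
          refine mul_le_mul_of_nonneg_left ?_ (by positivity)
          linarith [hWend _ hj]
      _ = _ := by ring
  -- the interior nodes
  have inner : |∑ j ∈ Finset.Ico (N / 4 + 1) (3 * N / 4), G j * (α j + γ (j - 1))| ≤
      8 * B * (5 / β * M + 25 * M) / N * transX β ε *
        ∑ j ∈ Finset.Ico (N / 4) (3 * N / 4), W j := by
    have hsubset : Finset.Ico (N / 4 + 1) (3 * N / 4) ⊆ Finset.Ico (N / 4) (3 * N / 4) :=
      Finset.Ico_subset_Ico (by omega) le_rfl
    have hX0 := hX.1
    have hle : ∑ j ∈ Finset.Ico (N / 4 + 1) (3 * N / 4), W j ≤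
        ∑ j ∈ Finset.Ico (N / 4) (3 * N / 4), W j :=
      Finset.sum_le_sum_of_subset_of_nonneg hsubset fun j hj _ => W0 j (by
        have := (Finset.mem_Ico.1 hj).2; omega)
    refine le_trans ?_ (mul_le_mul_of_nonneg_left hle (by positivity))
    rw [Finset.mul_sum]
    refine (Finset.abs_sum_le_sum_abs _ _).trans (Finset.sum_le_sum fun j hj => ?_)
    have hj' := Finset.mem_Ico.1 hj
    have hmom := residual_moment h hβ hS hP (by omega : N / 4 < j) hj'.2
    have e : j - 1 + 1 = j := by omega
    rw [abs_mul]
    calc _ ≤ B * |w (Y j)| * (2 * (5 / β * M + 25 * M) / N * transX β ε * k) := by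
          refine mul_le_mul (hGle j (by omega)) hmom (abs_nonneg _) (by positivity)
      _ = 2 * B * (5 / β * M + 25 * M) / N * transX β ε * (k * |w (Y j)|) := by ring
      _ ≤ 2 * B * (5 / β * M + 25 * M) / N * transX β ε * (4 * W j) := by
          refine mul_le_mul_of_nonneg_left (hnodes j (hsubset hj)).1 (by positivity)
      _ = _ := by ring
  have total : ∫ y in Y (N / 4)..Y (3 * N / 4), g y * F y * w y =
      (∑ j ∈ Finset.Ico (N / 4) (3 * N / 4), ((∫ y in Y j..Y (j + 1), g y * F y * w y) -
        (G j * α j + G (j + 1) * γ j))) +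
      (G (N / 4) * α (N / 4) + G (3 * N / 4) * γ (3 * N / 4 - 1) +
        ∑ j ∈ Finset.Ico (N / 4 + 1) (3 * N / 4), G j * (α j + γ (j - 1))) := by
    rw [← sum_regroup G α γ hqr, ← Finset.sum_add_distrib]
    simp only [sub_add_cancel]
    exact (sum_integral_cells hlt (by rw [Y0, YN]; exact (cg.mul cF).mul cw) hqr.le hr.le).symm
  have first : |∑ j ∈ Finset.Ico (N / 4) (3 * N / 4), ((∫ y in Y j..Y (j + 1), g y * F y * w y) -
        (G j * α j + G (j + 1) * γ j))| ≤ 64 * Λ * resConst β M / N ^ 2 * en := by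
    refine (Finset.abs_sum_le_sum_abs _ _).trans ((Finset.sum_le_sum hcell).trans ?_)
    rw [← Finset.mul_sum]
    -- The prefactor N^{-3} leaves room for this crude bound.
    have hsq : √(N : ℝ) ≤ N := by
      rw [Real.sqrt_le_left hN.le]; nlinarith [h.cast_ge]
    calc _ ≤ 16 * Λ * resConst β M / N ^ 3 * (2 * √N * en) := by gcongr
      _ ≤ 16 * Λ * resConst β M / N ^ 3 * (2 * N * en) := by gcongr
      _ = 32 * Λ * resConst β M / N ^ 2 * en := by field_simp; ring
      _ ≤ _ := by gcongr; norm_num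
  change |∫ y in Y (N / 4)..Y (3 * N / 4), g y * F y * w y| ≤ _
  rw [total]
  refine (abs_add_le _ _).trans ?_
  have t1 := abs_add_le (G (N / 4) * α (N / 4) + G (3 * N / 4) * γ (3 * N / 4 - 1))
    (∑ j ∈ Finset.Ico (N / 4 + 1) (3 * N / 4), G j * (α j + γ (j - 1)))
  have t2 := abs_add_le (G (N / 4) * α (N / 4)) (G (3 * N / 4) * γ (3 * N / 4 - 1))
  have hX0 := hX.1
  have t3 : 8 * B * (5 / β * M + 25 * M) / N * transX β ε *
      (∑ j ∈ Finset.Ico (N / 4) (3 * N / 4), W j) ≤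
      8 * B * (5 / β * M + 25 * M) * ((N : ℝ)⁻¹ * (transX β ε * √(transX β ε / ε))) * en := by
    calc _ ≤ 8 * B * (5 / β * M + 25 * M) / N * transX β ε * (√(transX β ε / ε) * en) := by
          gcongr
      _ = _ := by ring
  have e : (64 * Λ * resConst β M + 32 * B * resConst β M) / N ^ 2 * en =
      64 * Λ * resConst β M / N ^ 2 * en + 16 * B * resConst β M / N ^ 2 * en +
        16 * B * resConst β M / N ^ 2 * en := by ring
  rw [e]
  linarith

end Residual

end Bakhvalov

/-! ### Assembly of the convection estimate -/

namespace Bakhvalov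

variable {β ε M B Λ : ℝ} {N : ℕ} {S P b v : ℝ × ℝ → ℝ}

lemma continuousOn_residual_mul (h : IsAdmissible β ε N) (hβ : 0 < β) (hS : SmoothBound M S)
    (hv : v ∈ femSpace β ε N) (hb : ContinuousOn b OmBar) :
    ContinuousOn (fun y => b (transX β ε, y) * residual β ε N S P y * v (transX β ε, y))
      (Icc 0 1) :=
  ((continuousOn_slice_y hb (transX_mem h hβ)).mul (continuousOn_residual h hβ hS)).mul
    (continuousOn_slice_y hv.1 (transX_mem h hβ))

lemma lineIntegral_residual_le (h : IsAdmissible β ε N) (hβ : 0 < β) (hS : SmoothBound M S)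
    (hP : IsTransitionInterp β ε N S P) (hv : v ∈ femSpace β ε N)
    (hb : ContinuousOn b OmBar) (hB : ∀ p ∈ OmBar, |b p| ≤ B) (hB0 : 0 ≤ B) (hΛ0 : 0 ≤ Λ)
    (hΛ : ∀ x ∈ Icc (0 : ℝ) 1, ∀ y ∈ Icc (0 : ℝ) 1, ∀ x' ∈ Icc (0 : ℝ) 1,
      ∀ y' ∈ Icc (0 : ℝ) 1, |b (x, y) - b (x', y')| ≤ Λ * (|x - x'| + |y - y'|)) :
    |(∫ y in (0 : ℝ)..1, lineIntegral β ε N S P b v y) +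
        ∫ y in (0 : ℝ)..1, b (transX β ε, y) * residual β ε N S P y * v (transX β ε, y)| ≤
      (B * (M * (5 / β / N)) * (2 * (transX β ε * √(transX β ε / ε))) +
        (4 * (2 * Λ * M + 13 * B * M) + 100 * M * B) / N ^ 2 +
        corrConst β M / N ^ 2 * (B * √(meshX β ε N (N / 2 - 2) / ε) +
          4 * Λ * (transX β ε * √(transX β ε / ε)))) * energyNorm ε v := by
  obtain ⟨hm, hm0, hn, hq, hqr, hr, -⟩ := h.index_facts
  have hM := hS.nonneg
  have hK := corrConst_nonneg hβ hM
  have hX0 := h.transX_nonneg hβ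
  have hX1 := (transX_mem h hβ).2
  have en0 := energyNorm_nonneg (ε := ε) (v := v)
  have iL := (integral_convection h hβ hS hP hb hv).1
  have iR : IntervalIntegrable
      (fun y => b (transX β ε, y) * residual β ε N S P y * v (transX β ε, y)) volume 0 1 :=
    ((continuousOn_residual_mul (P := P) h hβ hS hv hb).mono
      (by rw [uIcc_of_le zero_le_one])).intervalIntegrable
  have itr : ∀ {m : ℕ}, m ≤ N →
      IntervalIntegrable (fun y => |v (meshX β ε N m, y)|) volume 0 1 := fun hm =>
    ((continuousOn_slice_y hv.1 (h.meshX_mem hβ hm)).abs.mono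
      (by rw [uIcc_of_le zero_le_one])).intervalIntegrable
  have i1 := intervalIntegrable_slice (G := fun p => |v p|) zero_le_one zero_le_one hv.1.abs
  have i0 := intervalIntegrable_slice (G := fun p => |v p|) hX0 zero_le_one
    (hv.1.abs.mono (prod_mono_left (Icc_subset_Icc_right hX1)))
  have j2 := itr (by omega : N / 2 - 2 ≤ N)
  have j1 := itr (by omega : N / 2 - 1 ≤ N)
  have j0 := itr hn.le
  rw [h.meshX_half] at j0
  have t2 := trace_L1 h hβ hv (by omega : N / 2 - 2 ≤ N) le_rfl zero_le_one le_rfl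
  have t1 := trace_L1 h hβ hv (by omega : N / 2 - 1 ≤ N) le_rfl zero_le_one le_rfl
  have t0 := trace_L1 h hβ hv hn.le le_rfl zero_le_one le_rfl
  rw [h.meshX_half] at t0
  have mono : ∀ m ≤ N / 2, √(meshX β ε N m / ε) ≤ √(transX β ε / ε) := fun m hm => by
    rw [← h.meshX_half (β := β)]
    exact Real.sqrt_le_sqrt (div_le_div_of_nonneg_right (mesh_le (h.meshX_lt hβ) hm hn.le)
      h.eps_pos.le)
  simp only [sub_zero, Real.sqrt_one, one_mul] at t0 t1 t2
  have t1' := t1.trans (mul_le_mul_of_nonneg_right (mono _ (Nat.sub_le _ _)) en0)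
  have t2' := t2.trans (mul_le_mul_of_nonneg_right (mono _ (Nat.sub_le _ _)) en0)
  rw [← intervalIntegral.integral_add iL iR]
  have hint := (((i0.const_mul (B * (M * (5 / β / N)))).add
    (i1.const_mul ((4 * (2 * Λ * M + 13 * B * M) + 100 * M * B) / N ^ 2))).add
    (((j2.const_mul B).add (((j2.add (j1.const_mul 2)).add j0).const_mul
      (Λ * transX β ε))).const_mul (corrConst β M / N ^ 2)))
  refine (intervalIntegral.abs_integral_le_integral_abs zero_le_one).trans
    ((intervalIntegral.integral_mono_on zero_le_one (iL.add iR).abs hint fun y hy =>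
      lineIntegral_bound h hβ hS hP hv hb hB hΛ0 hΛ hy).trans ?_)
  rw [intervalIntegral.integral_add ((i0.const_mul _).add (i1.const_mul _))
      (((j2.const_mul B).add (((j2.add (j1.const_mul 2)).add j0).const_mul _)).const_mul _),
    intervalIntegral.integral_add (i0.const_mul _) (i1.const_mul _),
    intervalIntegral.integral_const_mul, intervalIntegral.integral_const_mul,
    intervalIntegral.integral_const_mul,
    intervalIntegral.integral_add (j2.const_mul B) (((j2.add (j1.const_mul 2)).add j0).const_mul _),
    intervalIntegral.integral_const_mul, intervalIntegral.integral_const_mul,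
    intervalIntegral.integral_add (j2.add (j1.const_mul 2)) j0,
    intervalIntegral.integral_add j2 (j1.const_mul 2), intervalIntegral.integral_const_mul]
  rw [add_mul, add_mul]
  refine add_le_add (add_le_add ?_ ?_) ?_
  · rw [mul_assoc (B * (M * (5 / β / N)))]
    exact mul_le_mul_of_nonneg_left (integral_fine_le h hβ hv) (by positivity)
  · exact mul_le_mul_of_nonneg_left (integral_abs_le_energy h hβ hv) (by positivity)
  · rw [mul_assoc (corrConst β M / (N : ℝ) ^ 2)]
    refine mul_le_mul_of_nonneg_left ?_ (by positivity)
    rw [add_mul]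
    refine add_le_add ?_ ?_
    · rw [mul_assoc]
      exact mul_le_mul_of_nonneg_left t2 hB0
    · calc _ ≤ Λ * transX β ε * (4 * (√(transX β ε / ε) * energyNorm ε v)) :=
            mul_le_mul_of_nonneg_left (by linarith) (by positivity)
        _ = _ := by ring

/-- Used in the layers at y = 0 and y = 1, where the moments give nothing: the thinness √(t - s)
offsets the trace factor by the third part of `transition_bounds`. -/
lemma residual_end_le (h : IsAdmissible β ε N) (hβ : 0 < β) (hS : SmoothBound M S)
    (hP : IsTransitionInterp β ε N S P) (hv : v ∈ femSpace β ε N)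
    (hb : ContinuousOn b OmBar) (hB : ∀ p ∈ OmBar, |b p| ≤ B) {s t : ℝ}
    (hs : 0 ≤ s) (hst : s ≤ t) (ht : t ≤ 1) :
    |∫ y in s..t, b (transX β ε, y) * residual β ε N S P y * v (transX β ε, y)| ≤
      B * (resConst β M / N ^ 2) * (√(t - s) * √(transX β ε / ε)) * energyNorm ε v := by
  have hn := h.index_facts.2.2.1
  have hsub : uIcc s t ⊆ Icc 0 1 := by rw [uIcc_of_le hst]; exact Icc_subset_Icc hs ht
  have hB0 : 0 ≤ B := (abs_nonneg _).trans (hB _ (mem_OmBar (transX_mem h hβ) (transX_mem h hβ)))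
  have hR := div_nonneg (resConst_nonneg hβ hS.nonneg) (sq_nonneg (N : ℝ))
  have t0 := trace_L1 h hβ hv hn.le hs hst ht
  rw [h.meshX_half] at t0
  refine (intervalIntegral.abs_integral_le_integral_abs hst).trans
    ((intervalIntegral.integral_mono_on hst
      (((continuousOn_residual_mul (P := P) h hβ hS hv hb).mono hsub).intervalIntegrable).abs
      ((((continuousOn_slice_y hv.1 (transX_mem h hβ)).mono hsub).intervalIntegrable).abs.const_mul
        (B * (resConst β M / N ^ 2))) fun y hy => ?_).trans ?_)
  · have hy' : y ∈ Icc (0 : ℝ) 1 := ⟨hs.trans hy.1, hy.2.trans ht⟩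
    rw [abs_mul, abs_mul]
    gcongr
    · exact hB _ (mem_OmBar (transX_mem h hβ) hy')
    · exact abs_residual_le h hβ hS hP hy'
  · rw [intervalIntegral.integral_const_mul, mul_assoc _ _ (energyNorm ε v)]
    exact mul_le_mul_of_nonneg_left t0 (mul_nonneg hB0 hR)

lemma residual_le (h : IsAdmissible β ε N) (hβ : 0 < β) (hS : SmoothBound M S)
    (hP : IsTransitionInterp β ε N S P) (hv : v ∈ femSpace β ε N)
    (hb : ContinuousOn b OmBar) (hB : ∀ p ∈ OmBar, |b p| ≤ B) (hB0 : 0 ≤ B) (hΛ0 : 0 ≤ Λ)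
    (hΛ : ∀ x ∈ Icc (0 : ℝ) 1, ∀ y ∈ Icc (0 : ℝ) 1, ∀ x' ∈ Icc (0 : ℝ) 1,
      ∀ y' ∈ Icc (0 : ℝ) 1, |b (x, y) - b (x', y')| ≤ Λ * (|x - x'| + |y - y'|)) :
    |∫ y in (0 : ℝ)..1, b (transX β ε, y) * residual β ε N S P y * v (transX β ε, y)| ≤
      (2 * (B * (resConst β M / N ^ 2) * (√(transY ε) * √(transX β ε / ε))) +
        (64 * Λ * resConst β M + 32 * B * resConst β M) / N ^ 2 +
        8 * B * (5 / β * M + 25 * M) * ((N : ℝ)⁻¹ * (transX β ε * √(transX β ε / ε)))) *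
        energyNorm ε v := by
  have hY0 := h.transY_pos
  have hY1 := h.transY_le
  have hc := continuousOn_residual_mul (P := P) h hβ hS hv hb
  have ii : ∀ {s t : ℝ}, 0 ≤ s → s ≤ t → t ≤ 1 → IntervalIntegrable
      (fun y => b (transX β ε, y) * residual β ε N S P y * v (transX β ε, y)) volume s t :=
    fun hs hst ht => (hc.mono (by rw [uIcc_of_le hst]; exact Icc_subset_Icc hs ht)).intervalIntegrable
  have a1 := residual_end_le h hβ hS hP hv hb hB le_rfl hY0.le (by linarith)
  have a3 := residual_end_le h hβ hS hP hv hb hB (by linarith : 0 ≤ 1 - transY ε)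
    (by linarith) le_rfl
  have a2 := residual_middle h hβ hS hP hv hb hB hB0 hΛ0 hΛ
  rw [h.meshY_quarter, h.meshY_three_quarters] at a2
  rw [sub_zero] at a1
  rw [sub_sub_cancel] at a3
  rw [← intervalIntegral.integral_add_adjacent_intervals
      (ii le_rfl (by linarith : (0 : ℝ) ≤ 1 - transY ε) (by linarith))
      (ii (by linarith) (by linarith) le_rfl),
    ← intervalIntegral.integral_add_adjacent_intervals (ii le_rfl hY0.le (by linarith))
      (ii hY0.le (by linarith : transY ε ≤ 1 - transY ε) (by linarith))]
  refine (abs_add_le _ _).trans ((add_le_add_left (abs_add_le _ _) _).trans ?_)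
  linarith

/-- The constant in front of `ε^(1/4) N^(-3/2)`. -/
noncomputable def layerConst (β M B : ℝ) : ℝ :=
  (10 * B * M / β + 8 * B * (5 / β * M + 25 * M)) * ((30 / β) * √(30 / β))

/-- The constant in front of `N^(-2)`. -/
noncomputable def coarseConst (β M B Λ : ℝ) : ℝ :=
  4 * (2 * Λ * M + 13 * B * M) + 100 * M * B + (64 * Λ * resConst β M + 32 * B * resConst β M) +
    corrConst β M * (B * √(5 / (2 * β)) + 4 * Λ * ((30 / β) * √(30 / β))) +
    2 * B * resConst β M * √(450 / β)

theorem convection_le (h : IsAdmissible β ε N) (hβ : 0 < β) (hS : SmoothBound M S)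
    (hP : IsTransitionInterp β ε N S P) (hv : v ∈ femSpace β ε N)
    (hb : ContinuousOn b OmBar) (hB : ∀ p ∈ OmBar, |b p| ≤ B) (hB0 : 0 ≤ B) (hΛ0 : 0 ≤ Λ)
    (hΛ : ∀ x ∈ Icc (0 : ℝ) 1, ∀ y ∈ Icc (0 : ℝ) 1, ∀ x' ∈ Icc (0 : ℝ) 1,
      ∀ y' ∈ Icc (0 : ℝ) 1, |b (x, y) - b (x', y')| ≤ Λ * (|x - x'| + |y - y'|)) :
    |∫ p in Om, -b p * pdx (S - newInterp β ε N S P) p * v p| ≤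
      layerConst β M B * (ε ^ (1 / 4 : ℝ) * (N : ℝ) ^ (-(3 / 2) : ℝ)) * energyNorm ε v +
      coarseConst β M B Λ * (1 / N ^ 2 * Real.log N ^ (1 / 2 : ℝ)) * energyNorm ε v := by
  have hM := hS.nonneg
  have hN := h.cast_pos
  have hK := corrConst_nonneg hβ hM
  have hR := resConst_nonneg hβ hM
  have en0 := energyNorm_nonneg (ε := ε) (v := v)
  have hlog := h.one_le_sqrt_log
  have hsq := h.sqrt_two_before hβ
  obtain ⟨e1, e2, e3⟩ := h.transition_bounds hβ
  have A := lineIntegral_residual_le h hβ hS hP hv hb hB hB0 hΛ0 hΛ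
  have R := residual_le h hβ hS hP hv hb hB hB0 hΛ0 hΛ
  rw [(integral_convection h hβ hS hP hb hv).2, abs_neg]
  set q := transX β ε * √(transX β ε / ε)
  set en := energyNorm ε v
  set L := Real.log N ^ (1 / 2 : ℝ)
  set D := (30 / β) * √(30 / β)
  set R₀ := resConst β M
  set K := corrConst β M
  set ρ := ε ^ (1 / 4 : ℝ) * (N : ℝ) ^ (-(3 / 2) : ℝ)
  have hD : 0 ≤ D := by positivity
  -- Add and subtract the residual integral: the sum is covered by `lineIntegral_residual_le`, the
  -- subtracted term by `residual_le`.
  rw [← add_sub_cancel_right (∫ y in (0 : ℝ)..1, lineIntegral β ε N S P b v y)]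
  refine ((abs_sub _ _).trans (add_le_add A R)).trans ?_
  rw [← add_mul _ _ en, ← add_mul _ _ en]
  refine mul_le_mul_of_nonneg_right ?_ en0
  have c1 : (10 * B * M / β + 8 * B * (5 / β * M + 25 * M)) * ((N : ℝ)⁻¹ * q) ≤
      layerConst β M B * ρ := by
    rw [layerConst, mul_assoc _ _ ρ]
    exact mul_le_mul_of_nonneg_left e1 (by positivity)
  have c2 : 4 * (2 * Λ * M + 13 * B * M) + 100 * M * B + (64 * Λ * R₀ + 32 * B * R₀) +
      K * (B * √(meshX β ε N (N / 2 - 2) / ε) + 4 * Λ * q) +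
      2 * B * R₀ * (√(transY ε) * √(transX β ε / ε)) ≤ coarseConst β M B Λ * L := by
    have hL0 : 0 ≤ L := zero_le_one.trans hlog
    calc _ ≤ 4 * (2 * Λ * M + 13 * B * M) + 100 * M * B + (64 * Λ * R₀ + 32 * B * R₀) +
          K * (B * (√(5 / (2 * β)) * L) + 4 * Λ * D) + 2 * B * R₀ * √(450 / β) := by gcongr
      _ ≤ (4 * (2 * Λ * M + 13 * B * M) + 100 * M * B + (64 * Λ * R₀ + 32 * B * R₀)) * L +
          K * (B * (√(5 / (2 * β)) * L) + 4 * Λ * D * L) + 2 * B * R₀ * √(450 / β) * L := by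
        gcongr ?_ + K * (_ + ?_) + ?_ <;> exact le_mul_of_one_le_right (by positivity) hlog
      _ = _ := by rw [coarseConst]; ring
  have c3 := mul_le_mul_of_nonneg_left c2 (by positivity : (0 : ℝ) ≤ 1 / N ^ 2)
  calc _ = (10 * B * M / β + 8 * B * (5 / β * M + 25 * M)) * ((N : ℝ)⁻¹ * q) +
      1 / N ^ 2 * (4 * (2 * Λ * M + 13 * B * M) + 100 * M * B + (64 * Λ * R₀ + 32 * B * R₀) +
      K * (B * √(meshX β ε N (N / 2 - 2) / ε) + 4 * Λ * q) +
      2 * B * R₀ * (√(transY ε) * √(transX β ε / ε))) := by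
        field_simp
        ring
    _ ≤ _ := by linarith

lemma layerConst_nonneg (hβ : 0 < β) (hM : 0 ≤ M) (hB : 0 ≤ B) : 0 ≤ layerConst β M B := by
  rw [layerConst]; positivity

lemma coarseConst_nonneg (hβ : 0 < β) (hM : 0 ≤ M) (hB : 0 ≤ B) (hΛ : 0 ≤ Λ) :
    0 ≤ coarseConst β M B Λ := by
  have := corrConst_nonneg hβ hM
  have := resConst_nonneg hβ hM
  rw [coarseConst]; positivity

end Bakhvalov

theorem mainTheorem2 (β γ M : ℝ) (b c : ℝ × ℝ → ℝ) (hdata : Bakhvalov.IsData β γ b c) :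
    ∃ C : ℝ, ∀ (ε : ℝ) (N : ℕ), Bakhvalov.IsAdmissible β ε N →
      ∀ f u S E₁ E₂ E₁₂ : ℝ × ℝ → ℝ, Bakhvalov.IsSolution ε b c f u →
        Bakhvalov.IsDecomposition ε β M u S E₁ E₂ E₁₂ →
        (∃! P : ℝ × ℝ → ℝ, Bakhvalov.IsTransitionInterp β ε N S P) ∧
        ∀ P : ℝ × ℝ → ℝ, Bakhvalov.IsTransitionInterp β ε N S P →
          (∀ j ∈ Finset.Icc (N / 4 + 1) (3 * N / 4 - 1),
            |S (Bakhvalov.meshX β ε N (N / 2 - 1), Bakhvalov.meshY ε N j) -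
              P (Bakhvalov.meshX β ε N (N / 2 - 1), Bakhvalov.meshY ε N j)|
                ≤ C * (N : ℝ) ^ (-2 : ℝ)) ∧
          ∀ v ∈ Bakhvalov.femSpace β ε N,
            |∫ p in Bakhvalov.Om,
                -b p * Bakhvalov.pdx (S - Bakhvalov.newInterp β ε N S P) p * v p|
              ≤ C * ε ^ (1 / 4 : ℝ) * (N : ℝ) ^ (-(3 / 2) : ℝ) * Real.log N ^ (1 / 2 : ℝ) *
                  Bakhvalov.energyNorm ε v +
                C * (N : ℝ) ^ (-2 : ℝ) * Real.log N ^ (1 / 2 : ℝ) *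
                  Bakhvalov.energyNorm ε v := by
  open Bakhvalov in
  have hβ := hdata.beta_pos
  obtain ⟨B, Λ, hB0, hΛ0, hB, hΛ⟩ := exists_bound_lipschitz hdata.b_smooth
  -- One constant serves all three bounds, and it is fixed before ε and N.
  refine ⟨layerConst β M B + coarseConst β M B Λ + corrConst β M, ?_⟩
  intro ε N h f u S E₁ E₂ E₁₂ _ hdec
  have hS : SmoothBound M S := ⟨hdec.smooth_S, hdec.bound_S⟩
  have hM := hS.nonneg
  have hN := h.cast_pos
  have k1 := layerConst_nonneg hβ hM hB0
  have k2 := coarseConst_nonneg hβ hM hB0 hΛ0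
  have k3 := corrConst_nonneg hβ hM
  have hpow : (N : ℝ) ^ (-2 : ℝ) = 1 / N ^ 2 := by
    rw [Real.rpow_neg hN.le, Real.rpow_two, one_div]
  refine ⟨existsUnique_transitionInterp h hβ hS, fun P hP => ⟨fun j hj => ?_, fun v hv => ?_⟩⟩
  · have hj' := Finset.mem_Icc.1 hj
    rw [← corr_interior (by omega) (by omega), hpow, mul_one_div]
    refine (abs_corr_le h hβ hS hP j).trans ?_
    gcongr
    linarith
  · have en0 := energyNorm_nonneg (ε := ε) (v := v)
    have hlog := h.one_le_sqrt_log
    have hε := h.eps_pos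
    rw [hpow]
    refine (convection_le h hβ hS hP hv hdata.b_smooth.continuousOn hB hB0 hΛ0 hΛ).trans ?_
    have hL0 := zero_le_one.trans hlog
    rw [mul_assoc (_ + _ + _) (ε ^ (1 / 4 : ℝ)), mul_assoc (_ + _ + _) (1 / (N : ℝ) ^ 2)]
    refine add_le_add (mul_le_mul_of_nonneg_right ?_ en0) (mul_le_mul_of_nonneg_right ?_ en0)
    -- The first term is proved without the logarithm; since N ≥ 4 gives ln N ≥ 1, the factor can be
    -- inserted for free.
    · refine (mul_le_mul_of_nonneg_right (by linarith :
        layerConst β M B ≤ layerConst β M B + coarseConst β M B Λ + corrConst β M)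
        (by positivity)).trans (le_mul_of_one_le_right (by positivity) hlog)
    · exact mul_le_mul_of_nonneg_right (by linarith) (by positivity)
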